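/- Let $k=\mathbb R$ or $\mathbb C$ and let $A=\bigoplus_{i\ge 0}A^i$ be a strictly unital cyclic $A_\infty$ algebra over $k$: operations $\mu_n:A^{\otimes n}\to A$ ($n\ge 1$) of degree $2-n$, only finitely many of them non-zero, with $\sum_{r+l+t=n}(-1)^{rl+t}\mu_{r+1+t}(1^{\otimes r}\otimes\mu_l\otimes 1^{\otimes t})=0$ (Koszul rule on elements) for all $n$; a strict unit $1\in A^0$; and a trace $\mathrm{Tr}:A\to k$ vanishing on $A^i$ for $i\ne 2$ such that $\omega(a,b)=\mathrm{Tr}(\mu_2(a,b))$ satisfies $\omega(\mu_n(a_1,\dots,a_n),a_{n+1})=(-1)^{n+|a_{n+1}|(|a_1|+\dots+|a_n|)}\,\omega(\mu_n(a_{n+1},a_1,\dots,a_{n-1}),a_n)$ for $n\ge1$. Put $\bar A=A/k$. Normalized Hochschild chains are $\bar C_\bullet(A,A)=\prod_n A\otimes (s\bar A)^{\otimes n}$, where $a_0\otimes\dots\otimes a_n$ has degree $|a_0|+\sum_{i\ge1}(|a_i|-1)$, with the Hochschild boundary $\delta$ of degree $+1$ and the Connes operator $B$ of degree $-1$. Their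 dual $\bar C^\bullet(A,A^*)$ consists of the finite families of functionals on $A\otimes(s\bar A)^{\otimes n}$; likewise $\bar C^\bullet(A,A)$ consists of the finite families of maps $(s\bar A)^{\otimes n}\to A$, and both carry the usual differentials $\delta^*$ (signs by the Koszul rule). Negative cyclic chains are $\bar C_\bullet(A,A)[[u]]$ with differential $\delta+uB$, $|u|=2$; $HC_-^\bullet(A)$ is the cohomology of the finite sums $\sum_i\alpha_iv^{-i}$, $\alpha_i\in\bar C^\bullet(A,A^*)$, with differential $\delta^*+vB^*$ ($|v|=-2$, $v\cdot v^0=0$). Let $I:HH^\bullet(A,A^*)\to HC_-^\bullet(A)$ be induced by $\varphi\mapsto\varphi v^0$ and $\mathcal B:HC_-^\bullet(A)\to HH^{\bullet+1}(A,A^*)$ by $\sum\alpha_iv^{-i}\mapsto B^*\alpha_0$. Assume that $\omega:A\to A^*$ is a quasi-isomorphism and that $\omega_\sharp:HH^\bullet(A,A)\to HH^\bullet(A,A^*)$, $f\mapsto\omega\circ f$, is an isomorphism. Let $\sqcup$ be the product on $HH^\bullet(A,A^*)$ transported by $\omega_\sharp$ from the cup product $f\cup g=\sum_k\pm\mu_k(\dots,f(\dots),\dots,g(\dots),\dots)$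 on $HH^\bullet(A,A)$, and let $\{x,y\}=I(\mathcal Bx\sqcup\mathcal By)$ be the bracket on $HC_-^{2\bullet}(A)=\bigoplus_{m\in\mathbb Z}HC_-^{2m}(A)$. Let $\nu_n$ be the $L_\infty$ operations obtained by symmetrizing $\mu_n$. For $a\in A^1$ put $F(a)=\sum_n\frac1{n!}\nu_n(a^{\wedge n})$ and $\mu'_a(Y)=\sum_n\frac1{n!}\nu_{n+1}(a^{\wedge n}\wedge Y)$, let $MC=\{a\in A^1: F(a)=0\}$, and for $x\in A^0$ let $\xi_x(a)=\sum_n\frac1{n!}\nu_{n+1}(a^{\wedge n}\wedge x)$ be the infinitesimal gauge action. Functions on $MC$ are polynomial functions on $A^1$ modulo the functions $a\mapsto\Lambda_a(F(a))$, with $\Lambda_a\in A^*$ linear and depending polynomially on $a$. A Hamiltonian vector field of $\psi$ is a polynomial vector field $X$ on $A^1$ tangent to $MC$ (that is, $\mu'_a(X_a)=0$ modulo $F(a)$) such that $\omega(X_a,Y)=d\psi_a(Y)$ for tangent vectors $Y$ (that is, modulo $F(a)$ and $\mu'_a(Y)$). Let $\mathcal O(\mathcal{MC})$ be the space of functions $\psi$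 on $MC$ that are gauge invariant ($d\psi_a(\xi_x(a))=0$ on $MC$ for all $x\in A^0$) and have a Hamiltonian vector field $X^\psi$, with the Poisson bracket $\{\psi,\chi\}=\omega(X^\psi,X^\chi)$. For $a\in A^1$ let $R(a)=\sum_{n\ge0}1\otimes a^{\otimes n}\in\bar C_\bullet(A,A)\subset\bar C_\bullet(A,A)[[u]]$. **Theorem.** The bracket $\{\,,\}$ on $HC_-^{2\bullet}(A)$ and the Poisson bracket on $\mathcal O(\mathcal{MC})$ are well defined bilinear operations (independent of all choices of representatives and of Hamiltonian vector fields), the formula $\rho([\alpha])(a)=\langle\alpha,R(a)\rangle$ gives a well defined linear map $\rho:HC_-^{2\bullet}(A)\to\mathcal O(\mathcal{MC})$, and $\rho$ is a map of Lie algebras: $\rho(\{x,y\})=\{\rho(x),\rho(y)\}$ for all $x,y\in HC_-^{2\bullet}(A)$. -/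

import Mathlib

open scoped DirectSum

noncomputable section

namespace StringBracket

/-! ## Words of homogeneous elements -/

section Words

variable {𝕜 A : Type*} [RCLike 𝕜] [AddCommGroup A] [Module 𝕜 A]

/-- A homogeneous element of the graded vector space `A = ⨁ i, 𝒜 i`, together with its degree. -/
@[ext]
structure Homog (𝒜 : ℤ → Submodule 𝕜 A) where
  deg : ℤ
  val : A
  mem : val ∈ 𝒜 deg

variable {𝒜 : ℤ → Submodule 𝕜 A}

/-- An element of `𝒜 i`, seen as a homogeneous element of degree `i`. -/
def Homog.of {i : ℤ} (x : 𝒜 i) : Homog 𝒜 := ⟨i, x, x.2⟩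

/-- The degree `d` component of an element of `A`, as a homogeneous element. -/
def Homog.comp [DirectSum.Decomposition 𝒜] (d : ℤ) (x : A) : Homog 𝒜 :=
  Homog.of (DirectSum.decompose 𝒜 x d)

/-- The suspended degree `|a| - 1` of a homogeneous element. -/
def Homog.sdeg (a : Homog 𝒜) : ℤ := a.deg - 1

/-- `|a₁| + ⋯ + |aₙ|`. -/
def degSum (w : List (Homog 𝒜)) : ℤ := (w.map Homog.deg).sum

/-- `(|a₁| - 1) + ⋯ + (|aₙ| - 1)`, the degree of a word in the suspended graded space. -/
def sdegSum (w : List (Homog 𝒜)) : ℤ := (w.map Homog.sdeg).sum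

/-- `∑ F X Y` over all ways to cut the word `w = X ++ Y` in two (possibly empty) pieces. -/
def sumSplit {α M : Type*} [AddCommMonoid M] (F : List α → List α → M) (w : List α) : M :=
  ∑ r ∈ Finset.range (w.length + 1), F (w.take r) (w.drop r)

/-- `∑ F X Y Z` over all ways to cut the word `w = X ++ Y ++ Z` in three pieces. -/
def sumSplit3 {α M : Type*} [AddCommMonoid M] (F : List α → List α → List α → M)
    (w : List α) : M :=
  sumSplit (fun X R => sumSplit (fun Y Z => F X Y Z) R) w

/-- `∑ F X₁ X₂ X₃ X₄ X₅` over all ways to cut a word in five pieces. -/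
def sumSplit5 {α M : Type*} [AddCommMonoid M]
    (F : List α → List α → List α → List α → List α → M) (w : List α) : M :=
  sumSplit3 (fun X₁ X₂ R => sumSplit3 (fun X₃ X₄ X₅ => F X₁ X₂ X₃ X₄ X₅) R) w

/-- The value of a family of multilinear operations on a list of arguments. -/
def evalWord (μ : (n : ℕ) → MultilinearMap 𝕜 (fun _ : Fin n => A) A) (L : List A) : A :=
  μ L.length L.get

/-- A function on words of homogeneous elements that is linear in every letter, that is, a family
of linear maps `A^{⊗ n} → M`, `n ≥ 0`. -/
def IsMultilinear {M : Type*} [AddCommGroup M] [Module 𝕜 M] (f : List (Homog 𝒜) → M) : Prop :=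
  ∀ (l r : List (Homog 𝒜)) (i : ℤ) (c : 𝕜) (x y : 𝒜 i),
    f (l ++ Homog.of (c • x + y) :: r) =
      c • f (l ++ Homog.of x :: r) + f (l ++ Homog.of y :: r)

end Words

/-! ## Cyclic A-infinity algebras -/

/-- A unital cyclic `A_∞` algebra on the graded space `A = ⨁ i, 𝒜 i` with finitely many non-zero
operations `μ n : A^{⊗ n} → A`, `n ≥ 1`, of degree `2 - n`, with a strict unit, and with a trace of
degree `-2` such that `ω(a, b) = Tr (μ₂(a, b))` is cyclically invariant (Koszul signs). -/
structure CyclicAInfinityAlgebra (𝕜 : Type*) {A : Type*} [RCLike 𝕜] [AddCommGroup A] [Module 𝕜 A]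
    (𝒜 : ℤ → Submodule 𝕜 A) where
  μ : (n : ℕ) → MultilinearMap 𝕜 (fun _ : Fin n => A) A
  mu_zero : μ 0 = 0
  mu_bounded : ∃ N : ℕ, ∀ n, N < n → μ n = 0
  mu_degree : ∀ (n : ℕ) (d : Fin n → ℤ) (a : Fin n → A), (∀ i, a i ∈ 𝒜 (d i)) →
    μ n a ∈ 𝒜 (∑ i, d i + 2 - n)
  /-- `∑ (-1)^{rl + t} μ_{r+1+t} (1^{⊗ r} ⊗ μ_l ⊗ 1^{⊗ t}) = 0`, evaluated on homogeneous elements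
  with the Koszul rule. -/
  stasheff : ∀ w : List (Homog 𝒜),
    sumSplit3 (fun X Y Z =>
      ((X.length * Y.length + Z.length + Y.length * degSum X : ℤ)).negOnePow •
        evalWord μ (X.map Homog.val ++ evalWord μ (Y.map Homog.val) :: Z.map Homog.val)) w = 0
  one : A
  one_mem : one ∈ 𝒜 0
  mu_two_one : ∀ a, μ 2 ![a, one] = a
  mu_one_two : ∀ a, μ 2 ![one, a] = a
  mu_unit : ∀ (n : ℕ) (v : Fin n → A) (i : Fin n), n ≠ 2 → v i = one → μ n v = 0
  Tr : A →ₗ[𝕜] 𝕜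
  Tr_degree : ∀ (i : ℤ) (a : A), i ≠ 2 → a ∈ 𝒜 i → Tr a = 0
  /-- `ω(μₙ(a₁, …, aₙ), aₙ₊₁) = (-1)^{n + |aₙ₊₁|(|a₁| + ⋯ + |aₙ|)} ω(μₙ(aₙ₊₁, a₁, …, aₙ₋₁), aₙ)`,
  with `a₁, …, aₙ₋₁ = w`, `aₙ = x` and `aₙ₊₁ = y`. -/
  cyclic : ∀ (w : List (Homog 𝒜)) (x y : Homog 𝒜),
    Tr (μ 2 ![evalWord μ (w.map Homog.val ++ [x.val]), y.val]) =
      ((w.length + 1 + y.deg * (degSum w + x.deg) : ℤ)).negOnePow •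
        Tr (μ 2 ![evalWord μ (y.val :: w.map Homog.val), x.val])

namespace CyclicAInfinityAlgebra

variable {𝕜 A : Type*} [RCLike 𝕜] [AddCommGroup A] [Module 𝕜 A] {𝒜 : ℤ → Submodule 𝕜 A}
  (S : CyclicAInfinityAlgebra 𝕜 𝒜)

/-- The trace pairing `ω(a, b) = Tr (μ₂(a, b))`. -/
def ω (a b : A) : 𝕜 := S.Tr (S.μ 2 ![a, b])

/-- The unit as a homogeneous element of degree `0`. -/
def unit : Homog 𝒜 := ⟨0, S.one, S.one_mem⟩

/-- The trace pairing `ω : A → A^*` is a quasi-isomorphism onto the graded dual: it induces, for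
every `i`, an injective and surjective map from `H^i(A, μ₁)` to the cohomology of `A^*` at
`(𝒜 (2 - i))^*`. -/
def TraceIsQuasiIso : Prop :=
  ∀ i : ℤ,
    (∀ x ∈ 𝒜 i, S.μ 1 ![x] = 0 →
      (∃ l : A →ₗ[𝕜] 𝕜, ∀ y ∈ 𝒜 (2 - i), S.ω x y = l (S.μ 1 ![y])) →
        ∃ z ∈ 𝒜 (i - 1), x = S.μ 1 ![z]) ∧
    (∀ l : A →ₗ[𝕜] 𝕜, (∀ z ∈ 𝒜 (1 - i), l (S.μ 1 ![z]) = 0) →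
      ∃ x ∈ 𝒜 i, S.μ 1 ![x] = 0 ∧
        ∃ l₁ : A →ₗ[𝕜] 𝕜, ∀ y ∈ 𝒜 (2 - i), l y = S.ω x y + l₁ (S.μ 1 ![y]))

/-! ### Hochschild complexes (normalized) -/

lemma evalWord_mem (w : List (Homog 𝒜)) :
    evalWord S.μ (w.map Homog.val) ∈ 𝒜 (sdegSum w + 2) := by
  have h := S.mu_degree (w.map Homog.val).length
    (fun i => (w.get (i.cast (by simp))).deg) (w.map Homog.val).get
    (fun i => by simpa using (w.get (i.cast (by simp))).mem)
  have e : (∑ i : Fin (w.map Homog.val).length, (w.get (i.cast (by simp))).deg) + 2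
      - ((w.map Homog.val).length : ℤ) = sdegSum w + 2 := by
    have h1 : (∑ i : Fin (w.map Homog.val).length, (w.get (i.cast (by simp))).deg)
        = ∑ i : Fin w.length, (w.get i).deg :=
      Fintype.sum_equiv (finCongr (by simp)) _ _ (fun i => rfl)
    have h2 : (∑ i : Fin w.length, (w.get i).deg) = sdegSum w + w.length := by
      clear h1 h
      induction w with
      | nil => simp [sdegSum]
      | cons a w ih =>
        have : (∑ i : Fin (a :: w).length, ((a :: w).get i).deg)
            = a.deg + ∑ i : Fin w.length, (w.get i).deg :=
          Fin.sum_univ_succ (n := w.length) (fun i => ((a :: w).get i).deg)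
        rw [this, ih]
        simp [sdegSum, Homog.sdeg]
        ring
    rw [h1, h2]
    simp
    ring
  rw [e] at h
  exact h

/-- `(n-1)(|a₁| - 1) + (n-2)(|a₂| - 1) + ⋯ + (|aₙ₋₁| - 1)`. -/
def suspExponent : List (Homog 𝒜) → ℤ
  | [] => 0
  | a :: w => w.length * a.sdeg + suspExponent w

/-- The operation `bₙ(a₁, …, aₙ) = (-1)^{∑ (n-i)(|aᵢ|-1)} μₙ(a₁, …, aₙ)` which corresponds to `μₙ`
on the suspension of `A`, where it has degree `1`. -/
def b (w : List (Homog 𝒜)) : Homog 𝒜 :=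
  ⟨sdegSum w + 2, (suspExponent w).negOnePow • evalWord S.μ (w.map Homog.val), by
    rcases Int.even_or_odd (suspExponent w) with h | h
    · simpa [Int.negOnePow_even _ h] using S.evalWord_mem w
    · simpa [Int.negOnePow_odd _ h] using S.evalWord_mem w⟩

/-- The space `C̄^•(A, A)` in degree `p`: finite families of multilinear maps `f : (sĀ)^{⊗ n} → A` of
degree `p`. -/
def hochA (p : ℤ) : Submodule 𝕜 (List (Homog 𝒜) → A) where
  carrier := {f | IsMultilinear (𝕜 := 𝕜) f ∧ (∀ l r, f (l ++ S.unit :: r) = 0) ∧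
    (∀ w, f w ∈ 𝒜 (sdegSum w + p)) ∧ ∃ N : ℕ, ∀ w, N < w.length → f w = 0}
  zero_mem' := ⟨fun _ _ _ _ _ _ => by simp, fun _ _ => rfl, fun _ => Submodule.zero_mem _,
    0, fun _ _ => rfl⟩
  add_mem' := by
    rintro f g ⟨hf, hf1, hf2, N, hN⟩ ⟨hg, hg1, hg2, N', hN'⟩
    refine ⟨fun l r i c x y => ?_, fun l r => ?_, fun w => ?_, max N N', fun w hw => ?_⟩
    · simp only [Pi.add_apply, hf l r i c x y, hg l r i c x y, smul_add]
      abel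
    · simp [hf1, hg1]
    · exact Submodule.add_mem _ (hf2 w) (hg2 w)
    · simp [hN w (lt_of_le_of_lt (le_max_left _ _) hw),
        hN' w (lt_of_le_of_lt (le_max_right _ _) hw)]
  smul_mem' := by
    rintro k f ⟨hf, hf1, hf2, N, hN⟩
    refine ⟨fun l r i c x y => ?_, fun l r => ?_, fun w => ?_, N, fun w hw => ?_⟩
    · simp only [Pi.smul_apply, hf l r i c x y, smul_add, smul_comm k c]
    · simp [hf1]
    · exact Submodule.smul_mem _ _ (hf2 w)
    · simp [hN w hw]

/-- The space `C̄^•(A, A^*)`, the dual of the normalized Hochschild chains, in degree `q`: finite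
families of multilinear functionals `φ(a₀; a₁, …, aₙ)` on `A ⊗ (sĀ)^{⊗ n}` which are concentrated on
chains of total degree `|a₀| + ∑ (|aᵢ| - 1) = q`. -/
def hochDual (q : ℤ) : Submodule 𝕜 (Homog 𝒜 → List (Homog 𝒜) → 𝕜) where
  carrier := {φ | (∀ (i : ℤ) (c : 𝕜) (x y : 𝒜 i) (w : List (Homog 𝒜)),
      φ (Homog.of (c • x + y)) w = c • φ (Homog.of x) w + φ (Homog.of y) w) ∧
    (∀ a, IsMultilinear (𝕜 := 𝕜) (φ a)) ∧ (∀ a l r, φ a (l ++ S.unit :: r) = 0) ∧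
    (∀ a w, a.deg + sdegSum w ≠ q → φ a w = 0) ∧
    ∃ N : ℕ, ∀ a w, N < w.length → φ a w = 0}
  zero_mem' := ⟨fun _ _ _ _ _ => by simp, fun _ _ _ _ _ _ _ => by simp, fun _ _ _ => rfl,
    fun _ _ _ => rfl, 0, fun _ _ _ => rfl⟩
  add_mem' := by
    rintro f g ⟨hf0, hf, hf1, hf2, N, hN⟩ ⟨hg0, hg, hg1, hg2, N', hN'⟩
    refine ⟨fun i c x y w => ?_, fun a l r i c x y => ?_, fun a l r => ?_, fun a w h => ?_,
      max N N', fun a w hw => ?_⟩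
    · simp only [Pi.add_apply, hf0 i c x y w, hg0 i c x y w, smul_add]
      abel
    · simp only [Pi.add_apply, hf a l r i c x y, hg a l r i c x y, smul_add]
      abel
    · simp [hf1, hg1]
    · simp [hf2 a w h, hg2 a w h]
    · simp [hN a w (lt_of_le_of_lt (le_max_left _ _) hw),
        hN' a w (lt_of_le_of_lt (le_max_right _ _) hw)]
  smul_mem' := by
    rintro k f ⟨hf0, hf, hf1, hf2, N, hN⟩
    refine ⟨fun i c x y w => ?_, fun a l r i c x y => ?_, fun a l r => ?_, fun a w h => ?_,
      N, fun a w hw => ?_⟩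
    · simp only [Pi.smul_apply, hf0 i c x y w, smul_add, smul_comm k c]
    · simp only [Pi.smul_apply, hf a l r i c x y, smul_add, smul_comm k c]
    · simp [hf1]
    · simp [hf2 a w h]
    · simp [hN a w hw]

/-- The differential of `C̄^•(A, A^*)`: the transpose of the Hochschild boundary
`δ(a₀, …, aₙ) = ∑ ± (a₀, …, b(…), …, aₙ) + ∑ ± (b(a_s, …, aₙ, a₀, …, a_r), …)`. -/
def deltaDual : (Homog 𝒜 → List (Homog 𝒜) → 𝕜) →ₗ[𝕜] (Homog 𝒜 → List (Homog 𝒜) → 𝕜) where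
  toFun φ a w :=
    sumSplit3 (fun X Y Z => (a.sdeg + sdegSum X).negOnePow • φ a (X ++ S.b Y :: Z)) w +
    sumSplit3 (fun X Y Z => (sdegSum Z * (a.sdeg + sdegSum X + sdegSum Y)).negOnePow •
      φ (S.b (Z ++ a :: X)) Y) w
  map_add' φ ψ := by
    funext a w
    simp only [sumSplit3, sumSplit, Pi.add_apply, smul_add, Finset.sum_add_distrib]
    abel
  map_smul' c φ := by
    funext a w
    simp only [sumSplit3, sumSplit, Pi.smul_apply, smul_add, Finset.smul_sum, RingHom.id_apply,
      smul_comm c]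

/-- The transpose of the Connes operator
`B(a₀, …, aₙ) = ∑ᵢ ± (1, aᵢ, …, aₙ, a₀, …, aᵢ₋₁)`. -/
def connesDual : (Homog 𝒜 → List (Homog 𝒜) → 𝕜) →ₗ[𝕜] (Homog 𝒜 → List (Homog 𝒜) → 𝕜) where
  toFun φ a w :=
    sumSplit (fun X Z => (sdegSum Z * (a.sdeg + sdegSum X)).negOnePow •
      φ S.unit (Z ++ a :: X)) w
  map_add' φ ψ := by
    funext a w
    simp only [sumSplit, Pi.add_apply, smul_add, Finset.sum_add_distrib]
  map_smul' c φ := by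
    funext a w
    simp only [sumSplit, Pi.smul_apply, Finset.smul_sum, RingHom.id_apply, smul_comm c]

/-- The map `ω_♯ : C̄^•(A, A) → C̄^•(A, A^*)`, `f ↦ ω ∘ f`; the sign is the Koszul sign of the
identification `f(a₁, …, aₙ)(a₀) ↔ φ(a₀; a₁, …, aₙ)`. -/
def sharp (f : List (Homog 𝒜) → A) : Homog 𝒜 → List (Homog 𝒜) → 𝕜 :=
  fun a w => (a.deg * sdegSum w).negOnePow • S.ω (f w) a.val

section Cochains

variable [DirectSum.Decomposition 𝒜]

/-- The differential of `C̄^•(A, A)` on a cochain `f` of degree `p`: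
`∑ ± b(…, f(…), …) ± ∑ ± f(…, b(…), …)`. -/
def deltaA (p : ℤ) (f : List (Homog 𝒜) → A) : List (Homog 𝒜) → A := fun w =>
  sumSplit3 (fun X Y Z => ((p - 1) * sdegSum X).negOnePow •
    (S.b (X ++ Homog.comp (sdegSum Y + p) (f Y) :: Z)).val) w -
  (p - 1).negOnePow • sumSplit3 (fun X Y Z => (sdegSum X).negOnePow •
    f (X ++ S.b Y :: Z)) w

/-- The generalized cup product `∑_k ± μ_k(…, f(…), …, g(…), …)` of cochains `f`, `g` of degrees
`p`, `q`. -/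
def cup (p q : ℤ) (f g : List (Homog 𝒜) → A) : List (Homog 𝒜) → A :=
  sumSplit5 fun X₁ X₂ X₃ X₄ X₅ =>
    (p - 1 + (p - 1) * sdegSum X₁ +
      (q - 1) * (sdegSum X₁ + sdegSum X₂ + sdegSum X₃)).negOnePow •
    (S.b (X₁ ++ Homog.comp (sdegSum X₂ + p) (f X₂) :: (X₃ ++
      Homog.comp (sdegSum X₄ + q) (g X₄) :: X₅))).val

/-- `ω_♯` induces an isomorphism `HH^•(A, A) → HH^•(A, A^*)`: in each degree the map induced on
cohomology is injective and surjective. -/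
def SharpIsIso : Prop :=
  ∀ p : ℤ,
    (∀ f ∈ S.hochA p, S.deltaA p f = 0 →
      (∃ φ ∈ S.hochDual (3 - p), S.sharp f = S.deltaDual φ) →
        ∃ g ∈ S.hochA (p - 1), f = S.deltaA (p - 1) g) ∧
    (∀ ψ ∈ S.hochDual (2 - p), S.deltaDual ψ = 0 →
      ∃ f ∈ S.hochA p, S.deltaA p f = 0 ∧
        ∃ φ ∈ S.hochDual (3 - p), ψ = S.sharp f + S.deltaDual φ)

end Cochains

/-! ### Negative cyclic cohomology -/

/-- Negative cyclic cochains of degree `m`: finite sums `∑ αᵢ v^{-i}` with `αᵢ ∈ C̄^{m-2i}(A, A^*)`. -/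
def negCyclic (m : ℤ) : Submodule 𝕜 (ℕ → Homog 𝒜 → List (Homog 𝒜) → 𝕜) where
  carrier := {α | (∀ i : ℕ, α i ∈ S.hochDual (m - 2 * i)) ∧ ∃ N : ℕ, ∀ i, N < i → α i = 0}
  zero_mem' := ⟨fun _ => Submodule.zero_mem _, 0, fun _ _ => rfl⟩
  add_mem' := by
    rintro α β ⟨h, N, hN⟩ ⟨h', N', hN'⟩
    refine ⟨fun i => Submodule.add_mem _ (h i) (h' i), max N N', fun i hi => ?_⟩
    simp [hN i (lt_of_le_of_lt (le_max_left _ _) hi),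
      hN' i (lt_of_le_of_lt (le_max_right _ _) hi)]
  smul_mem' := by
    rintro c α ⟨h, N, hN⟩
    exact ⟨fun i => Submodule.smul_mem _ _ (h i), N, fun i hi => by simp [hN i hi]⟩

/-- The differential `δ^* + v B^*`. -/
def dNeg : (ℕ → Homog 𝒜 → List (Homog 𝒜) → 𝕜) →ₗ[𝕜] (ℕ → Homog 𝒜 → List (Homog 𝒜) → 𝕜) where
  toFun α i := S.deltaDual (α i) + S.connesDual (α (i + 1))
  map_add' α β := by
    funext i
    simp only [Pi.add_apply, map_add]
    abel
  map_smul' c α := by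
    funext i
    simp only [Pi.smul_apply, map_smul, RingHom.id_apply, smul_add]

/-- Negative cyclic cocycles of degree `m`. -/
def negCocycle (m : ℤ) : Submodule 𝕜 (ℕ → Homog 𝒜 → List (Homog 𝒜) → 𝕜) :=
  S.negCyclic m ⊓ LinearMap.ker S.dNeg

/-- Negative cyclic coboundaries of degree `m` (the differential lowers the degree by one). -/
def negCoboundary (m : ℤ) : Submodule 𝕜 (ℕ → Homog 𝒜 → List (Homog 𝒜) → 𝕜) :=
  (S.negCyclic (m + 1)).map S.dNeg

/-- The negative cyclic cohomology `HC_-^m(A)`. -/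
abbrev HC (m : ℤ) : Type _ :=
  S.negCocycle m ⧸ (S.negCoboundary m).comap (S.negCocycle m).subtype

/-- The class in `HC_-^m(A)` of a cocycle. -/
def HC.mk {m : ℤ} (α : S.negCocycle m) : S.HC m := Submodule.Quotient.mk α

/-- The even part `HC_-^{2•}(A)`. -/
abbrev HCeven : Type _ := ⨁ m : ℤ, S.HC (2 * m)

/-- The class of a cocycle of degree `2m`, as an element of `HC_-^{2•}(A)`. -/
def HCeven.mk (m : ℤ) (α : S.negCocycle (2 * m)) : S.HCeven :=
  DirectSum.lof 𝕜 ℤ (fun m => S.HC (2 * m)) m (HC.mk S α)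

/-- The inclusion `I : C̄^•(A, A^*) → CC_-^•(A)` as the `v^0` part. -/
def incl (φ : Homog 𝒜 → List (Homog 𝒜) → 𝕜) : ℕ → Homog 𝒜 → List (Homog 𝒜) → 𝕜 :=
  Pi.single 0 φ

section Bracket

variable [DirectSum.Decomposition 𝒜]

/-- `f` is a cocycle in `C̄^•(A, A)` with `ω_♯[f] = 𝓑[α]` in `HH^•(A, A^*)`, where `α` has degree `2m`
and the connecting map `𝓑` sends `∑ αᵢ v^{-i}` to `B^* α₀`. -/
def Represents (m : ℤ) (α : ℕ → Homog 𝒜 → List (Homog 𝒜) → 𝕜) (f : List (Homog 𝒜) → A) : Prop :=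
  f ∈ S.hochA (1 - 2 * m) ∧ S.deltaA (1 - 2 * m) f = 0 ∧
    ∃ γ ∈ S.hochDual (2 * m + 2), S.connesDual (α 0) = S.sharp f + S.deltaDual γ

/-- `br` is the bracket `{x, y} = I(𝓑 x ⊔ 𝓑 y)` on `HC_-^{2•}(A)`, where
`φ ⊔ ψ = ω_♯(ω_♯⁻¹ φ ∪ ω_♯⁻¹ ψ)`, whatever the representatives. -/
def IsCyclicBracket (br : S.HCeven →ₗ[𝕜] S.HCeven →ₗ[𝕜] S.HCeven) : Prop :=
  ∀ (m n : ℤ) (α : S.negCocycle (2 * m)) (β : S.negCocycle (2 * n)),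
    (∃ f, S.Represents m α f) ∧
    ∀ f g, S.Represents m α f → S.Represents n β g →
      ∃ h : incl (S.sharp (S.cup (1 - 2 * m) (1 - 2 * n) f g)) ∈ S.negCocycle (2 * (m + n)),
        br (HCeven.mk S m α) (HCeven.mk S n β) = HCeven.mk S (m + n) ⟨_, h⟩

end Bracket

/-! ### The Maurer-Cartan moduli space -/

/-- The Koszul sign of `a₁ ∧ ⋯ ∧ aₙ ↦ a_{σ(1)} ⊗ ⋯ ⊗ a_{σ(n)}` for elements of degrees `d`. -/
def koszulSign {n : ℕ} (d : Fin n → ℤ) (σ : Equiv.Perm (Fin n)) : ℤˣ :=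
  Equiv.Perm.sign σ *
    ∏ i, ∏ j, if i < j ∧ σ j < σ i then (d (σ i) * d (σ j)).negOnePow else 1

/-- The `L_∞` operations `νₙ = μₙ ∘ Sⁿ`, on elements `aᵢ` of degrees `dᵢ`. -/
def nu (n : ℕ) (d : Fin n → ℤ) (a : Fin n → A) : A :=
  ∑ σ : Equiv.Perm (Fin n), koszulSign d σ • S.μ n (a ∘ σ)

/-- The curvature `ν₁(a) + (1/2!) ν₂(a ∧ a) + (1/3!) ν₃(a ∧ a ∧ a) + ⋯` of `a ∈ A^1`. -/
def curv (a : 𝒜 1) : A :=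
  ∑ᶠ n : ℕ, ((n.factorial : 𝕜)⁻¹) • S.nu n (fun _ => 1) (fun _ => (a : A))

/-- The Maurer-Cartan solutions. -/
def MC : Set (𝒜 1) := {a | S.curv a = 0}

/-- The derivative `μ'_a(Y) = ν₁(Y) + ν₂(a ∧ Y) + (1/2!) ν₃(a ∧ a ∧ Y) + ⋯` of the curvature. -/
def dcurv (a Y : 𝒜 1) : A :=
  ∑ᶠ n : ℕ, ((n.factorial : 𝕜)⁻¹) •
    S.nu (n + 1) (fun _ => 1) (Fin.snoc (α := fun _ => A) (fun _ => (a : A)) (Y : A))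

/-- `ν₁(x) + ν₂(a ∧ x) + (1/2!) ν₃(a ∧ a ∧ x) + ⋯` for `x ∈ A^0`. -/
def gaugeVal (x : 𝒜 0) (a : 𝒜 1) : A :=
  ∑ᶠ n : ℕ, ((n.factorial : 𝕜)⁻¹) •
    S.nu (n + 1) (Fin.snoc (α := fun _ => ℤ) (fun _ => 1) 0)
      (Fin.snoc (α := fun _ => A) (fun _ => (a : A)) (x : A))

lemma nu_mem (n : ℕ) (d : Fin n → ℤ) (a : Fin n → A) (h : ∀ i, a i ∈ 𝒜 (d i)) :
    S.nu n d a ∈ 𝒜 (∑ i, d i + 2 - n) := by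
  refine Submodule.sum_mem _ fun σ _ => ?_
  have := S.mu_degree n (d ∘ σ) (a ∘ σ) (fun i => h (σ i))
  have e : ∑ i, (d ∘ σ) i = ∑ i, d i := Equiv.sum_comp σ d
  rw [e] at this
  rcases Int.units_eq_one_or (koszulSign d σ) with hs | hs <;> simpa [hs] using this

lemma gaugeVal_mem (x : 𝒜 0) (a : 𝒜 1) : S.gaugeVal x a ∈ 𝒜 1 := by
  refine finsum_induction (· ∈ 𝒜 1) (Submodule.zero_mem _)
    (fun _ _ => Submodule.add_mem _) fun n => Submodule.smul_mem _ _ ?_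
  have := S.nu_mem (n + 1) (Fin.snoc (α := fun _ => ℤ) (fun _ => 1) 0)
    (Fin.snoc (α := fun _ => A) (fun _ => (a : A)) (x : A)) (fun i => by
      refine Fin.lastCases ?_ (fun j => ?_) i
      · simp
      · simp)
  have e : (∑ i, (Fin.snoc (α := fun _ => ℤ) (fun _ : Fin n => (1 : ℤ)) 0 : Fin (n + 1) → ℤ) i)
      + 2 - ((n + 1 : ℕ) : ℤ) = 1 := by
    rw [Fin.sum_univ_castSucc]
    simp
  rwa [e] at this

/-- The infinitesimal gauge action of `x ∈ A^0`, a vector field on `A^1`. -/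
def gauge (x : 𝒜 0) (a : 𝒜 1) : 𝒜 1 := ⟨S.gaugeVal x a, S.gaugeVal_mem x a⟩

end CyclicAInfinityAlgebra

/-- Polynomial maps `V → W`: finite sums of maps `v ↦ p(v, …, v)` with `p` multilinear. -/
def PolyMap (𝕜 V W : Type*) [RCLike 𝕜] [AddCommGroup V] [Module 𝕜 V] [AddCommGroup W]
    [Module 𝕜 W] : Submodule 𝕜 (V → W) :=
  Submodule.span 𝕜 {f | ∃ (n : ℕ) (p : MultilinearMap 𝕜 (fun _ : Fin n => V) W),
    f = fun v => p fun _ => v}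

/-- The derivative `d/dt ψ(a + tY)` at `t = 0`. -/
def dirDeriv {𝕜 V : Type*} [RCLike 𝕜] [AddCommGroup V] [Module 𝕜 V] (ψ : V → 𝕜) (a Y : V) : 𝕜 :=
  deriv (fun t : 𝕜 => ψ (a + t • Y)) 0

lemma differentiable_of_mem_polyMap {𝕜 V : Type*} [RCLike 𝕜] [AddCommGroup V] [Module 𝕜 V]
    {ψ : V → 𝕜} (h : ψ ∈ PolyMap 𝕜 V 𝕜) (a Y : V) :
    Differentiable 𝕜 (fun t : 𝕜 => ψ (a + t • Y)) := by
  induction h using Submodule.span_induction with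
  | mem f hf =>
    obtain ⟨n, p, rfl⟩ := hf
    have : (fun t : 𝕜 => p fun _ => a + t • Y) = fun t : 𝕜 =>
        ∑ s : Finset (Fin n), t ^ sᶜ.card • p (s.piecewise (fun _ => a) (fun _ => Y)) := by
      funext t
      have h1 := p.map_add_univ (fun _ => a) (fun _ => t • Y)
      have h2 : (fun _ : Fin n => a) + (fun _ => t • Y) = fun _ => a + t • Y := rfl
      rw [h2] at h1
      rw [h1]
      refine Finset.sum_congr rfl fun s _ => ?_
      have h3 := p.map_piecewise_smul (fun _ => t) (s.piecewise (fun _ => a) (fun _ => Y)) sᶜ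
      rw [Finset.prod_const] at h3
      rw [← h3]
      congr 1
      funext i
      by_cases hi : i ∈ s <;> simp [Finset.piecewise, hi]
    rw [this]
    fun_prop
  | zero => simp
  | add f g _ _ hf hg => exact Differentiable.fun_add hf hg
  | smul c f _ hf => exact hf.const_mul c

lemma dirDeriv_add {𝕜 V : Type*} [RCLike 𝕜] [AddCommGroup V] [Module 𝕜 V] {ψ χ : V → 𝕜}
    (hψ : ψ ∈ PolyMap 𝕜 V 𝕜) (hχ : χ ∈ PolyMap 𝕜 V 𝕜) (a Y : V) :
    dirDeriv (ψ + χ) a Y = dirDeriv ψ a Y + dirDeriv χ a Y :=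
  deriv_fun_add (differentiable_of_mem_polyMap hψ a Y 0) (differentiable_of_mem_polyMap hχ a Y 0)

lemma dirDeriv_smul {𝕜 V : Type*} [RCLike 𝕜] [AddCommGroup V] [Module 𝕜 V] {ψ : V → 𝕜}
    (c : 𝕜) (hψ : ψ ∈ PolyMap 𝕜 V 𝕜) (a Y : V) :
    dirDeriv (c • ψ) a Y = c • dirDeriv ψ a Y :=
  deriv_fun_const_smul c (differentiable_of_mem_polyMap hψ a Y 0)

namespace CyclicAInfinityAlgebra

variable {𝕜 A : Type*} [RCLike 𝕜] [AddCommGroup A] [Module 𝕜 A] {𝒜 : ℤ → Submodule 𝕜 A}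
  (S : CyclicAInfinityAlgebra 𝕜 𝒜)

/-- The ideal of the Maurer-Cartan equation in the polynomial functions on `A^1`: the functions
`a ↦ Λ_a(curv a)`, with `Λ_a` a linear functional depending polynomially on `a`. -/
def mcIdeal : Submodule 𝕜 (𝒜 1 → 𝕜) where
  carrier := {ψ | ∃ Λ ∈ PolyMap 𝕜 (𝒜 1) (A →ₗ[𝕜] 𝕜), ∀ a, ψ a = Λ a (S.curv a)}
  zero_mem' := ⟨0, Submodule.zero_mem _, fun _ => by simp⟩
  add_mem' := by
    rintro f g ⟨Λ, h, e⟩ ⟨Λ', h', e'⟩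
    exact ⟨Λ + Λ', Submodule.add_mem _ h h', fun a => by simp [e, e']⟩
  smul_mem' := by
    rintro c f ⟨Λ, h, e⟩
    exact ⟨c • Λ, Submodule.smul_mem _ c h, fun a => by simp [e]⟩

/-- `X` is a Hamiltonian vector field of `ψ` on the Maurer-Cartan space: `X` is a polynomial vector
field on `A^1` which is tangent to the Maurer-Cartan space (`μ'_a(X_a) = 0` modulo the
Maurer-Cartan equation `curv a = 0`), and `ω(X_a, Y) = dψ_a(Y)` for tangent vectors `Y` (that is,
modulo the equations `curv a = 0` and `μ'_a(Y) = 0` of the Zariski tangent spaces). -/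
def IsHamiltonianField (ψ : 𝒜 1 → 𝕜) (X : 𝒜 1 → 𝒜 1) : Prop :=
  X ∈ PolyMap 𝕜 (𝒜 1) (𝒜 1) ∧
  (∃ L ∈ PolyMap 𝕜 (𝒜 1) (A →ₗ[𝕜] A), ∀ a, S.dcurv a (X a) = L a (S.curv a)) ∧
  ∃ M ∈ PolyMap 𝕜 (𝒜 1) (A →ₗ[𝕜] 𝒜 1 →ₗ[𝕜] 𝕜), ∃ Λ ∈ PolyMap 𝕜 (𝒜 1) (A →ₗ[𝕜] 𝕜),
    ∀ a Y : 𝒜 1, S.ω (X a) Y = dirDeriv ψ a Y + M a (S.curv a) Y + Λ a (S.dcurv a Y)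

lemma nu_snoc_add_smul (n : ℕ) (d : Fin (n + 1) → ℤ) (a : Fin n → A) (c : 𝕜) (y z : A) :
    S.nu (n + 1) d (Fin.snoc (α := fun _ => A) a (c • y + z)) =
      c • S.nu (n + 1) d (Fin.snoc (α := fun _ => A) a y) +
        S.nu (n + 1) d (Fin.snoc (α := fun _ => A) a z) := by
  have key : ∀ (σ : Equiv.Perm (Fin (n + 1))) (x : A),
      (Fin.snoc (α := fun _ => A) a x) ∘ σ =
        Function.update ((Fin.snoc (α := fun _ => A) a 0) ∘ σ) (σ.symm (Fin.last n)) x := by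
    intro σ x
    rw [← Function.update_comp_equiv, Fin.update_snoc_last]
  unfold nu
  rw [Finset.smul_sum, ← Finset.sum_add_distrib]
  refine Finset.sum_congr rfl fun σ _ => ?_
  rw [key σ (c • y + z), key σ y, key σ z, MultilinearMap.map_update_add,
    MultilinearMap.map_update_smul, smul_add, smul_comm c]

lemma dcurv_add_smul (a : 𝒜 1) (c : 𝕜) (Y Z : 𝒜 1) :
    S.dcurv a (c • Y + Z) = c • S.dcurv a Y + S.dcurv a Z := by
  obtain ⟨N, hN⟩ := S.mu_bounded
  have hs : ∀ Y : 𝒜 1, S.dcurv a Y = ∑ n ∈ Finset.range (N + 1), ((n.factorial : 𝕜)⁻¹) •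
      S.nu (n + 1) (fun _ => 1) (Fin.snoc (α := fun _ => A) (fun _ => (a : A)) (Y : A)) := by
    intro Y
    refine finsum_eq_sum_of_support_subset _ fun n hn => ?_
    by_contra hlt
    refine hn ?_
    have h0 : S.μ (n + 1) = 0 := hN _ (by simp at hlt; omega)
    simp [nu, h0]
  rw [hs, hs, hs]
  simp only [Submodule.coe_add, Submodule.coe_smul, nu_snoc_add_smul, smul_add,
    Finset.sum_add_distrib, Finset.smul_sum]
  congr 1
  exact Finset.sum_congr rfl fun n _ => smul_comm _ _ _

lemma ω_add_smul (c : 𝕜) (x y z : A) : S.ω (c • x + y) z = c • S.ω x z + S.ω y z := by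
  have h : ∀ x : A, (![x, z] : Fin 2 → A) = Function.update ![0, z] 0 x := by
    intro x
    funext i
    fin_cases i <;> simp
  unfold ω
  rw [h (c • x + y), h x, h y, MultilinearMap.map_update_add, MultilinearMap.map_update_smul,
    map_add, map_smul]

/-- The polynomial functions on `A^1` which represent elements of the Poisson algebra of the
Maurer-Cartan moduli space: they are invariant under the infinitesimal gauge action on the
Maurer-Cartan space and have a Hamiltonian vector field. -/
def invFunctions : Submodule 𝕜 (𝒜 1 → 𝕜) where
  carrier := {ψ | ψ ∈ PolyMap 𝕜 (𝒜 1) 𝕜 ∧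
    (∀ x : 𝒜 0, (fun a => dirDeriv ψ a (S.gauge x a)) ∈ S.mcIdeal) ∧
    ∃ X, S.IsHamiltonianField ψ X}
  zero_mem' := by
    refine ⟨Submodule.zero_mem _, fun x => ?_, 0, Submodule.zero_mem _,
      ⟨0, Submodule.zero_mem _, fun a => ?_⟩, 0, Submodule.zero_mem _, 0, Submodule.zero_mem _,
      fun a Y => ?_⟩
    · have : (fun a : 𝒜 1 => dirDeriv (0 : 𝒜 1 → 𝕜) a (S.gauge x a)) = 0 := by
        funext a
        simp [dirDeriv]
      rw [this]
      exact Submodule.zero_mem _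
    · have := S.dcurv_add_smul a (-1) 0 0
      simp at this
      simpa using this
    · have := S.ω_add_smul (-1) 0 0 (Y : A)
      simp at this
      simp [dirDeriv, this]
  add_mem' := by
    rintro ψ χ ⟨p, i, X, hX, ⟨L, hL, eL⟩, M, hM, Λ, hΛ, e⟩
      ⟨p', i', X', hX', ⟨L', hL', eL'⟩, M', hM', Λ', hΛ', e'⟩
    refine ⟨Submodule.add_mem _ p p', fun x => ?_, X + X', Submodule.add_mem _ hX hX',
      ⟨L + L', Submodule.add_mem _ hL hL', fun a => ?_⟩, M + M', Submodule.add_mem _ hM hM',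
      Λ + Λ', Submodule.add_mem _ hΛ hΛ', fun a Y => ?_⟩
    · simp only [dirDeriv_add p p']
      exact Submodule.add_mem _ (i x) (i' x)
    · have := S.dcurv_add_smul a 1 (X a) (X' a)
      simp only [one_smul] at this
      simp [this, eL, eL']
    · have := S.ω_add_smul 1 (X a : A) (X' a) (Y : A)
      simp only [one_smul] at this
      simp only [Pi.add_apply, Submodule.coe_add, this, e, e', dirDeriv_add p p',
        LinearMap.add_apply]
      ring
  smul_mem' := by
    rintro c ψ ⟨p, i, X, hX, ⟨L, hL, eL⟩, M, hM, Λ, hΛ, e⟩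
    refine ⟨Submodule.smul_mem _ c p, fun x => ?_, c • X, Submodule.smul_mem _ c hX,
      ⟨c • L, Submodule.smul_mem _ c hL, fun a => ?_⟩, c • M, Submodule.smul_mem _ c hM,
      c • Λ, Submodule.smul_mem _ c hΛ, fun a Y => ?_⟩
    · simp only [dirDeriv_smul c p]
      exact Submodule.smul_mem _ c (i x)
    · have h0 := S.dcurv_add_smul a (-1) 0 0
      simp at h0
      have := S.dcurv_add_smul a c (X a) 0
      simp only [add_zero, h0] at this
      simp [this, eL]
    · have h0 := S.ω_add_smul (-1) 0 0 (Y : A)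
      simp at h0
      have := S.ω_add_smul c (X a : A) 0 (Y : A)
      simp only [add_zero, h0] at this
      simp only [Pi.smul_apply, Submodule.coe_smul, this, e, dirDeriv_smul c p,
        LinearMap.smul_apply, smul_eq_mul]
      ring

/-- The Poisson algebra of functions on the Maurer-Cartan moduli space: gauge invariant polynomial
functions with a Hamiltonian vector field, modulo the Maurer-Cartan equation. -/
abbrev ModuliFunction : Type _ :=
  S.invFunctions ⧸ S.mcIdeal.comap S.invFunctions.subtype

/-- The function on the moduli space given by a polynomial function on `A^1`. -/
def ModuliFunction.mk (ψ : S.invFunctions) : S.ModuliFunction := Submodule.Quotient.mk ψ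

/-- The value of a function on the moduli space at a Maurer-Cartan solution `a`. -/
def ModuliFunction.eval (a : S.MC) : S.ModuliFunction →ₗ[𝕜] 𝕜 :=
  Submodule.liftQ _ ((LinearMap.proj (R := 𝕜) (φ := fun _ : 𝒜 1 => 𝕜) a.1).comp
    S.invFunctions.subtype) (by
      rintro ⟨ψ, hψ⟩ ⟨Λ, _, e⟩
      have ha : S.curv a.1 = 0 := a.2
      simpa [ha] using e a.1)

/-- `PB` is the Poisson bracket `{ψ, χ} = ω(X^ψ, X^χ)`, whatever the representatives and the choice
of the Hamiltonian vector fields. -/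
def IsPoissonBracket (PB : S.ModuliFunction →ₗ[𝕜] S.ModuliFunction →ₗ[𝕜] S.ModuliFunction) : Prop :=
  ∀ (ψ χ : S.invFunctions) (X Z : 𝒜 1 → 𝒜 1),
    S.IsHamiltonianField ψ X → S.IsHamiltonianField χ Z →
      ∃ h : (fun a => S.ω (X a) (Z a)) ∈ S.invFunctions,
        PB (ModuliFunction.mk S ψ) (ModuliFunction.mk S χ) = ModuliFunction.mk S ⟨_, h⟩

/-! ### The map from negative cyclic cohomology to functions -/

/-- The components `1 ⊗ a^{⊗ n}`, `n ≥ 0`, of the Hochschild chain `P(a) = ∑ 1 ⊗ a^{⊗ n}`, each as a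
pair of its coefficient `a₀` and the word `a₁, …, aₙ`. -/
def chainP (a : 𝒜 1) (n : ℕ) : Homog 𝒜 × List (Homog 𝒜) :=
  (S.unit, List.replicate n (Homog.of a))

/-- The pairing `⟨α, R(a)⟩` of a negative cyclic cochain `∑ αᵢ v^{-i}` with the negative cyclic chain
`R(a) = P(a) u^0`. -/
def pairingR (α : ℕ → Homog 𝒜 → List (Homog 𝒜) → 𝕜) (a : 𝒜 1) : 𝕜 :=
  ∑ᶠ n : ℕ, α 0 (S.chainP a n).1 (S.chainP a n).2

/-- `ρ` is the map `ρ([α])([a]) = ⟨α, R(a)⟩`, whatever the representative `α`. -/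
def IsRho (ρ : S.HCeven →ₗ[𝕜] S.ModuliFunction) : Prop :=
  ∀ (m : ℤ) (α : S.negCocycle (2 * m)),
    (∃ h : S.pairingR α ∈ S.invFunctions,
      ρ (HCeven.mk S m α) = ModuliFunction.mk S ⟨_, h⟩) ∧
    ∀ a : S.MC, ModuliFunction.eval S a (ρ (HCeven.mk S m α)) = S.pairingR α a.1

end CyclicAInfinityAlgebra

end StringBracket

end

/-! ### Cuts of words, signs, and the operations `b` on the suspension. -/

noncomputable section

namespace StringBracket

/-! ## Sums over the cuts of a word -/

section SumSplit

variable {α M N : Type*} [AddCommMonoid M] [AddCommMonoid N]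

/-! A letter `a` of degree one has suspended degree zero, so on the words `a, …, a` the Koszul signs
disappear, and Hochschild calculus becomes differential calculus on the vector space `A^1` along the
zero locus of the curvature `F`. Summation over the powers of `a` (`tot`) turns a cochain `f` in
`C̄(A, A)` of degree one into a polynomial vector field `X_f`, and a cochain `φ` in `C̄(A, A^*)`
into the one-form `Y ↦ ∑ φ(Y; a, …, a)`. Under this dictionary `B^* φ` is the differential of the
function `∑ φ(1; a, …, a)` (`connesDual_tot`), while `δ^* φ` consists of a term with `F(a)` inserted
and a term that depends on `Y` through `μ'_a(Y)` (`deltaDual_tot`). Likewise `δ f = 0` makes `X_f`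
tangent to the Maurer-Cartan space (`dcurv_cochainField`). Hence the equation `B^* α₀ = ω_♯ f + δ^*
γ`, which expresses `𝓑[α] = ω_♯[f]`, makes `X_f` a Hamiltonian field of `ρ[α]`
(`isHamiltonianField_pairingR`).

The two brackets agree because cyclicity and strict unitality leave only the `μ₂` term when `f ∪ g`
is paired with the unit: the sum over the powers of `a` is `ω(X_f, X_g)` (`ω_cup_one`,
`pairingR_cup`). Other degrees contribute nothing. The chains `1 ⊗ a^{⊗ n}` have degree zero, so `ρ`
kills the classes of degree `2m` with `m ≠ 0`; and if `m + n = 0` with `m ≠ 0`, then one of `f`, `g`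
has negative degree and vanishes on the powers of `a` (`pairingR_cup_eq_zero`).

The bracket on negative cyclic cohomology is well defined because `B^*` squares to zero and
anticommutes with `δ^*` (`deltaDual_connesDual`), `ω_♯` commutes with the differentials up to sign
(`sharp_deltaDual`) and is an isomorphism on cohomology, and the cup product obeys the Leibniz rule
(`deltaA_cup`).

The Poisson bracket is a matter of a constant two-form along the zero locus of a polynomial map. The
commutator of two Hamiltonian fields is Hamiltonian for `ω(X, Z)` (`IsHamiltonianAlong.bracket`), a
function in the ideal has its brackets in the ideal (`IsHamiltonianAlong.bracket_ideal`), and gauge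
invariance follows from `ω(X, ξ_x) = ω(μ'_a(X), x)` (`ω_gauge`, `mem_invFunctions`). Independence of
choices is obtained for both brackets from `exists_bilinear_of_relations`. -/

@[simp] lemma sumSplit_nil (F : List α → List α → M) : sumSplit F [] = F [] [] := by
  simp [sumSplit]

lemma sumSplit_cons (F : List α → List α → M) (a : α) (w : List α) :
    sumSplit F (a :: w) = F [] (a :: w) + sumSplit (fun X Z => F (a :: X) Z) w := by
  simp only [sumSplit, List.length_cons]
  rw [Finset.sum_range_succ']
  simp [add_comm]

lemma sumSplit_congr {F G : List α → List α → M} {w : List α}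
    (h : ∀ X Z, w = X ++ Z → F X Z = G X Z) : sumSplit F w = sumSplit G w :=
  Finset.sum_congr rfl fun r _ => h _ _ (List.take_append_drop r w).symm

lemma sumSplit_zero {F : List α → List α → M} {w : List α}
    (h : ∀ X Z, w = X ++ Z → F X Z = 0) : sumSplit F w = 0 :=
  Finset.sum_eq_zero fun r _ => h _ _ (List.take_append_drop r w).symm

lemma sumSplit_add (F G : List α → List α → M) (w : List α) :
    sumSplit (fun X Z => F X Z + G X Z) w = sumSplit F w + sumSplit G w :=
  Finset.sum_add_distrib

lemma map_sumSplit {H : Type*} [FunLike H M N] [AddMonoidHomClass H M N] (f : H)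
    (F : List α → List α → M) (w : List α) :
    f (sumSplit F w) = sumSplit (fun X Z => f (F X Z)) w :=
  map_sum f _ _

lemma smul_sumSplit {R : Type*} [DistribSMul R M] (c : R)
    (F : List α → List α → M) (w : List α) :
    c • sumSplit F w = sumSplit (fun X Z => c • F X Z) w :=
  Finset.smul_sum

lemma sumSplit_comm {β : Type*} (F : List α → List α → List β → List β → M)
    (w : List α) (v : List β) :
    sumSplit (fun X Z => sumSplit (fun U V => F X Z U V) v) w =
      sumSplit (fun U V => sumSplit (fun X Z => F X Z U V) w) v :=
  Finset.sum_comm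

lemma sumSplit_assoc (F : List α → List α → List α → M) (w : List α) :
    sumSplit (fun L Z => sumSplit (fun X Y => F X Y Z) L) w =
      sumSplit (fun X R => sumSplit (fun Y Z => F X Y Z) R) w := by
  induction w generalizing F with
  | nil => simp
  | cons a w ih =>
    rw [sumSplit_cons, sumSplit_cons]
    simp only [sumSplit_nil, sumSplit_cons, sumSplit_add]
    rw [ih (fun X Y Z => F (a :: X) Y Z), add_assoc]

/-- The letter `y` falls into the second piece or into the first. The case distinctions below on the
position of a letter relative to a cut rest on this. -/
lemma sumSplit_append_cons (F : List α → List α → M) (U V : List α) (y : α) :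
    sumSplit F (U ++ y :: V) = sumSplit (fun U₁ U₂ => F U₁ (U₂ ++ y :: V)) U +
      sumSplit (fun V₁ V₂ => F (U ++ y :: V₁) V₂) V := by
  induction U generalizing F with
  | nil => simp [sumSplit_cons]
  | cons a U ih => simp [sumSplit_cons, ih, add_assoc]

lemma sumSplit3_congr {F G : List α → List α → List α → M} {w : List α}
    (h : ∀ X Y Z, w = X ++ (Y ++ Z) → F X Y Z = G X Y Z) : sumSplit3 F w = sumSplit3 G w :=
  sumSplit_congr fun X R hR => sumSplit_congr fun Y Z hZ => h X Y Z (by rw [hR, hZ])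

lemma sumSplit3_zero {F : List α → List α → List α → M} {w : List α}
    (h : ∀ X Y Z, w = X ++ (Y ++ Z) → F X Y Z = 0) : sumSplit3 F w = 0 :=
  sumSplit_zero fun X R hR => sumSplit_zero fun Y Z hZ => h X Y Z (by rw [hR, hZ])

lemma sumSplit3_add (F G : List α → List α → List α → M) (w : List α) :
    sumSplit3 (fun X Y Z => F X Y Z + G X Y Z) w = sumSplit3 F w + sumSplit3 G w := by
  simp only [sumSplit3, sumSplit_add]

lemma map_sumSplit3 {H : Type*} [FunLike H M N] [AddMonoidHomClass H M N] (f : H)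
    (F : List α → List α → List α → M) (w : List α) :
    f (sumSplit3 F w) = sumSplit3 (fun X Y Z => f (F X Y Z)) w := by
  simp only [sumSplit3, map_sumSplit]

lemma smul_sumSplit3 {R : Type*} [DistribSMul R M] (c : R)
    (F : List α → List α → List α → M) (w : List α) :
    c • sumSplit3 F w = sumSplit3 (fun X Y Z => c • F X Y Z) w := by
  simp only [sumSplit3, smul_sumSplit]

lemma sumSplit3_append_cons (F : List α → List α → List α → M) (U V : List α) (y : α) :
    sumSplit3 F (U ++ y :: V) = sumSplit3 (fun X Y Z => F X Y (Z ++ y :: V)) U +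
      sumSplit (fun U₁ U₂ => sumSplit (fun V₁ V₂ => F U₁ (U₂ ++ y :: V₁) V₂) V) U +
      sumSplit3 (fun X Y Z => F (U ++ y :: X) Y Z) V := by
  simp only [sumSplit3, sumSplit_append_cons, sumSplit_add]

/-- Cutting the first of three pieces. -/
lemma sumSplit3_sumSplit_left (F : List α → List α → List α → List α → M) (w : List α) :
    sumSplit3 (fun X Y Z => sumSplit (fun X₁ X₂ => F X₁ X₂ Y Z) X) w =
      sumSplit (fun P Q => sumSplit3 (fun X Y Z => F P X Y Z) Q) w := by
  simp only [sumSplit3]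
  rw [← sumSplit_assoc (fun P X R => sumSplit (fun Y Z => F P X Y Z) R)]
  exact sumSplit_congr fun X Z _ => sumSplit_comm (fun Y Z X₁ X₂ => F X₁ X₂ Y Z) _ _

/-- Cutting the last of three pieces. -/
lemma sumSplit3_sumSplit_right (F : List α → List α → List α → List α → M) (w : List α) :
    sumSplit3 (fun X Y Z => sumSplit (fun Z₁ Z₂ => F X Y Z₁ Z₂) Z) w =
      sumSplit (fun P Q => sumSplit3 (fun X Y Z => F X Y Z Q) P) w := by
  simp only [sumSplit3, sumSplit_assoc]

/-- `∑ F X c Z` over all ways to single out a letter of the word `w = X ++ c :: Z`. -/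
def sumLetter (F : List α → α → List α → M) : List α → M
  | [] => 0
  | a :: w => F [] a w + sumLetter (fun X c Z => F (a :: X) c Z) w

lemma sumLetter_congr {F G : List α → α → List α → M} {w : List α}
    (h : ∀ X c Z, w = X ++ c :: Z → F X c Z = G X c Z) : sumLetter F w = sumLetter G w := by
  induction w generalizing F G with
  | nil => rfl
  | cons a w ih =>
    simp only [sumLetter]
    rw [h [] a w rfl, ih fun X c Z e => h _ _ _ (by rw [e]; rfl)]

/-- Each cut but the last is indexed by the letter after it, and each cut but the first by the
letter before it. Having both indexings allows the terms in `sum_unit_terms` to be matched letter by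
letter. -/
lemma sumSplit_eq_sumLetter_right (F : List α → List α → M) (w : List α) :
    sumSplit F w = sumLetter (fun X c Z => F X (c :: Z)) w + F w [] := by
  induction w generalizing F with
  | nil => simp [sumLetter]
  | cons a w ih => simp [sumSplit_cons, sumLetter, ih, add_assoc]

lemma sumSplit_eq_sumLetter_left (F : List α → List α → M) (w : List α) :
    sumSplit F w = F [] w + sumLetter (fun X c Z => F (X ++ [c]) Z) w := by
  induction w generalizing F with
  | nil => simp [sumLetter]
  | cons a w ih => simp [sumSplit_cons, sumLetter, ih]

end SumSplit

/-! ## Degrees and signs -/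

/-- The sign comparisons below become identities between exponents in `ZMod 2`, that is, polynomial
identities modulo `x * x = x`. -/
lemma negOnePow_congr {m n : ℤ} (h : (m : ZMod 2) = n) : m.negOnePow = n.negOnePow := by
  rw [Int.negOnePow_eq_iff, even_iff_two_dvd]
  have := (ZMod.intCast_eq_intCast_iff_dvd_sub n m 2).1 h.symm
  exact_mod_cast this

lemma zmod_two_mul_self (x : ℤ) : (x : ZMod 2) * x = x := by
  generalize (x : ZMod 2) = x
  revert x
  decide

lemma zmod_two_natCast_mul_self (x : ℕ) : (x : ZMod 2) * x = x := by
  exact_mod_cast zmod_two_mul_self x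

section Degrees

variable {𝕜 A : Type*} [RCLike 𝕜] [AddCommGroup A] [Module 𝕜 A] {𝒜 : ℤ → Submodule 𝕜 A}

@[simp] lemma sdegSum_nil : sdegSum ([] : List (Homog 𝒜)) = 0 := rfl

@[simp] lemma sdegSum_cons (a : Homog 𝒜) (w : List (Homog 𝒜)) :
    sdegSum (a :: w) = a.sdeg + sdegSum w := by
  simp [sdegSum]

@[simp] lemma sdegSum_append (v w : List (Homog 𝒜)) :
    sdegSum (v ++ w) = sdegSum v + sdegSum w := by
  simp [sdegSum]

lemma deg_eq (a : Homog 𝒜) : a.deg = a.sdeg + 1 := by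
  simp [Homog.sdeg]

lemma degSum_eq (w : List (Homog 𝒜)) : degSum w = sdegSum w + w.length := by
  induction w with
  | nil => simp [degSum]
  | cons a w ih =>
    have : degSum (a :: w) = a.deg + degSum w := by simp [degSum]
    rw [this, ih, deg_eq]
    simp
    ring

@[simp] lemma sdeg_of {i : ℤ} (x : 𝒜 i) : (Homog.of x).sdeg = i - 1 := rfl

@[simp] lemma deg_of {i : ℤ} (x : 𝒜 i) : (Homog.of x).deg = i := rfl

@[simp] lemma val_of {i : ℤ} (x : 𝒜 i) : (Homog.of x).val = x := rfl

lemma Homog.eq_of {i : ℤ} (a : Homog 𝒜) (x : 𝒜 i) (h : a.deg = i) (h' : a.val = x) :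
    a = Homog.of x :=
  Homog.ext h h'

section Comp

variable [DirectSum.Decomposition 𝒜]

@[simp] lemma Homog.deg_comp (d : ℤ) (x : A) : (Homog.comp d x : Homog 𝒜).deg = d := rfl

@[simp] lemma Homog.sdeg_comp (d : ℤ) (x : A) : (Homog.comp d x : Homog 𝒜).sdeg = d - 1 := rfl

lemma Homog.val_comp {d : ℤ} {x : A} (h : x ∈ 𝒜 d) : (Homog.comp d x : Homog 𝒜).val = x :=
  DirectSum.decompose_of_mem_same 𝒜 h

lemma Homog.comp_eq {d : ℤ} {x : A} (h : x ∈ 𝒜 d) :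
    (Homog.comp d x : Homog 𝒜) = Homog.of ⟨x, h⟩ :=
  Homog.ext rfl (Homog.val_comp h)

end Comp

lemma sign_smul_comm {M : Type*} [AddCommGroup M] [Module 𝕜 M] (c : 𝕜) (u : ℤˣ) (x : M) :
    u • c • x = c • u • x :=
  smul_comm u c x

end Degrees

/-! ## Multilinear operations on words -/

section Multilinear

variable {𝕜 A : Type*} [RCLike 𝕜] [AddCommGroup A] [Module 𝕜 A] {𝒜 : ℤ → Submodule 𝕜 A}

lemma evalWord_eq (μ : (n : ℕ) → MultilinearMap 𝕜 (fun _ : Fin n => A) A) {n : ℕ} (L : List A)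
    (h : L.length = n) : evalWord μ L = μ n (fun i => L.get (i.cast h.symm)) := by
  subst h
  rfl

/-- The operation used by `evalWord` depends on the length of the list. Multilinearity of `μ n`
applies once the words that differ in one letter are updates of one function on a fixed `Fin`. -/
lemma evalWord_eq_update (μ : (n : ℕ) → MultilinearMap 𝕜 (fun _ : Fin n => A) A) (l r : List A)
    (x : A) : evalWord μ (l ++ x :: r) = μ (l.length + (r.length + 1))
      (Function.update (fun i => (l ++ 0 :: r).get (i.cast (by simp)))
        ⟨l.length, by omega⟩ x) := by
  rw [evalWord_eq μ (n := l.length + (r.length + 1)) (l ++ x :: r) (by simp)]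
  congr 1
  funext i
  by_cases h : i = ⟨l.length, by omega⟩
  · subst h
    simp
  · rw [Function.update_of_ne h]
    have h' : (i : ℕ) ≠ l.length := fun e => h (Fin.ext e)
    simp only [List.get_eq_getElem, Fin.val_cast, List.getElem_append, List.getElem_cons]
    split_ifs with h1 h2
    · rfl
    · omega
    · rfl

lemma evalWord_add_smul (μ : (n : ℕ) → MultilinearMap 𝕜 (fun _ : Fin n => A) A) (l r : List A)
    (c : 𝕜) (x y : A) : evalWord μ (l ++ (c • x + y) :: r) =
      c • evalWord μ (l ++ x :: r) + evalWord μ (l ++ y :: r) := by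
  simp only [evalWord_eq_update, MultilinearMap.map_update_add, MultilinearMap.map_update_smul]

lemma evalWord_zero (μ : (n : ℕ) → MultilinearMap 𝕜 (fun _ : Fin n => A) A) (l r : List A) :
    evalWord μ (l ++ 0 :: r) = 0 := by
  rw [evalWord_eq_update]
  exact MultilinearMap.map_coord_zero _ ⟨l.length, by omega⟩ (by simp)

lemma evalWord_smul (μ : (n : ℕ) → MultilinearMap 𝕜 (fun _ : Fin n => A) A) (l r : List A)
    (c : 𝕜) (x : A) : evalWord μ (l ++ (c • x) :: r) = c • evalWord μ (l ++ x :: r) := by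
  simpa [evalWord_zero] using evalWord_add_smul μ l r c x 0

lemma evalWord_units_smul (μ : (n : ℕ) → MultilinearMap 𝕜 (fun _ : Fin n => A) A) (l r : List A)
    (u : ℤˣ) (x : A) : evalWord μ (l ++ (u • x) :: r) = u • evalWord μ (l ++ x :: r) := by
  rcases Int.units_eq_one_or u with rfl | rfl
  · simp
  · have := evalWord_smul μ l r (-1) x
    simpa using this

lemma evalWord_two (μ : (n : ℕ) → MultilinearMap 𝕜 (fun _ : Fin n => A) A) (x y : A) :
    evalWord μ [x, y] = μ 2 ![x, y] := by
  rw [evalWord_eq μ (n := 2) [x, y] rfl]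
  congr 1
  funext i
  fin_cases i <;> rfl

variable {M : Type*} [AddCommGroup M] [Module 𝕜 M]

lemma IsMultilinear.zero {f : List (Homog 𝒜) → M} (hf : IsMultilinear (𝕜 := 𝕜) f)
    (l r : List (Homog 𝒜)) (i : ℤ) : f (l ++ Homog.of (0 : 𝒜 i) :: r) = 0 := by
  have := hf l r i 1 0 0
  simpa using this

lemma IsMultilinear.smul {f : List (Homog 𝒜) → M} (hf : IsMultilinear (𝕜 := 𝕜) f)
    (l r : List (Homog 𝒜)) {i : ℤ} (c : 𝕜) (x : 𝒜 i) :
    f (l ++ Homog.of (c • x) :: r) = c • f (l ++ Homog.of x :: r) := by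
  have := hf l r i c x 0
  simpa [hf.zero] using this

lemma IsMultilinear.add {f : List (Homog 𝒜) → M} (hf : IsMultilinear (𝕜 := 𝕜) f)
    (l r : List (Homog 𝒜)) {i : ℤ} (x y : 𝒜 i) :
    f (l ++ Homog.of (x + y) :: r) = f (l ++ Homog.of x :: r) + f (l ++ Homog.of y :: r) := by
  have := hf l r i 1 x y
  simpa using this

/-- A multilinear function on words as a linear function of one of the letters. -/
def IsMultilinear.letter {f : List (Homog 𝒜) → M} (hf : IsMultilinear (𝕜 := 𝕜) f)
    (l r : List (Homog 𝒜)) (i : ℤ) : 𝒜 i →ₗ[𝕜] M where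
  toFun x := f (l ++ Homog.of x :: r)
  map_add' x y := hf.add l r x y
  map_smul' c x := hf.smul l r c x

/-- A linear combination in one slot involves letters of one degree only, so a sign that depends on
degrees alone is constant there. -/
lemma IsMultilinear.units_smul_left {f : List (Homog 𝒜) → M} (hf : IsMultilinear (𝕜 := 𝕜) f)
    (s : List (Homog 𝒜) → ℤ) (hs : ∀ v w, (v.map Homog.deg) = w.map Homog.deg → s v = s w) :
    IsMultilinear (𝕜 := 𝕜) (fun w => (s w).negOnePow • f w) := by
  intro l r i c x y
  have h1 := hs (l ++ Homog.of (c • x + y) :: r) (l ++ Homog.of x :: r) (by simp)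
  have h2 := hs (l ++ Homog.of y :: r) (l ++ Homog.of x :: r) (by simp)
  simp only [h1, h2, hf l r i c x y, smul_add, sign_smul_comm]

end Multilinear

namespace CyclicAInfinityAlgebra

variable {𝕜 A : Type*} [RCLike 𝕜] [AddCommGroup A] [Module 𝕜 A] {𝒜 : ℤ → Submodule 𝕜 A}
  (S : CyclicAInfinityAlgebra 𝕜 𝒜)

@[simp] lemma sdeg_unit : S.unit.sdeg = -1 := rfl

@[simp] lemma deg_unit : S.unit.deg = 0 := rfl

@[simp] lemma deg_b (w : List (Homog 𝒜)) : (S.b w).deg = sdegSum w + 2 := rfl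

@[simp] lemma sdeg_b (w : List (Homog 𝒜)) : (S.b w).sdeg = sdegSum w + 1 := by
  simp [Homog.sdeg]
  ring

lemma suspExponent_append (v w : List (Homog 𝒜)) :
    suspExponent (v ++ w) = suspExponent v + w.length * sdegSum v + suspExponent w := by
  induction v with
  | nil => simp [suspExponent]
  | cons a v ih =>
    simp only [List.cons_append, suspExponent, ih, sdegSum_cons, List.length_append]
    push_cast
    ring

lemma val_b (w : List (Homog 𝒜)) :
    (S.b w).val = (suspExponent w).negOnePow • evalWord S.μ (w.map Homog.val) := rfl

lemma suspExponent_congr {v w : List (Homog 𝒜)} (h : v.map Homog.deg = w.map Homog.deg) :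
    suspExponent v = suspExponent w := by
  induction v generalizing w with
  | nil =>
    cases w with
    | nil => rfl
    | cons a w => simp at h
  | cons a v ih =>
    cases w with
    | nil => simp at h
    | cons a' w =>
      simp only [List.map_cons, List.cons.injEq] at h
      have hl : v.length = w.length := by simpa using congrArg List.length h.2
      simp only [suspExponent, ih h.2, hl, Homog.sdeg, h.1]

lemma isMultilinear_evalWord (μ : (n : ℕ) → MultilinearMap 𝕜 (fun _ : Fin n => A) A) :
    IsMultilinear (𝕜 := 𝕜) (fun w : List (Homog 𝒜) => evalWord μ (w.map Homog.val)) := by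
  intro l r i c x y
  simpa using evalWord_add_smul μ (l.map Homog.val) (r.map Homog.val) c (x : A) (y : A)

lemma isMultilinear_b : IsMultilinear (𝕜 := 𝕜) (fun w => (S.b w).val) :=
  (isMultilinear_evalWord S.μ).units_smul_left _ fun _ _ h => suspExponent_congr h

lemma b_bounded : ∃ N : ℕ, ∀ w, N < w.length → (S.b w).val = 0 := by
  obtain ⟨N, hN⟩ := S.mu_bounded
  refine ⟨N, fun w hw => ?_⟩
  rw [val_b, evalWord, hN _ (by simpa using hw)]
  simp

/-- The `A_∞` relations on the suspension. -/
lemma b_b (w : List (Homog 𝒜)) :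
    sumSplit3 (fun X Y Z => (sdegSum X).negOnePow • (S.b (X ++ S.b Y :: Z)).val) w = 0 := by
  -- Multiplication by the suspension sign of the whole word turns the Stasheff sign of each term
  -- into the sign of `b` passing `X`.
  have h := congrArg (fun x => (suspExponent w).negOnePow • x) (S.stasheff w)
  simp only [smul_zero] at h
  rw [← h, smul_sumSplit3]
  refine sumSplit3_congr fun X Y Z hw => ?_
  simp only [val_b, List.map_append, List.map_cons, evalWord_units_smul, smul_smul,
    ← Int.negOnePow_add]
  congr 1
  apply negOnePow_congr
  rw [hw]
  simp only [suspExponent_append, suspExponent, degSum_eq, sdeg_b, List.length_cons,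
    List.length_append]
  push_cast
  clear h hw
  grind [=_ zmod_two_mul_self, =_ zmod_two_natCast_mul_self]

lemma evalWord_unit {w : List (Homog 𝒜)} (l r : List (Homog 𝒜)) (h : w = l ++ S.unit :: r)
    (h2 : w.length ≠ 2) : (S.b w).val = 0 := by
  subst h
  rw [val_b, List.map_append, List.map_cons, evalWord_eq_update]
  rw [S.mu_unit _ _ ⟨(l.map Homog.val).length, by omega⟩ (by simp at h2 ⊢; omega)]
  · simp
  · simp [unit]

lemma b_unit_left (c : Homog 𝒜) : (S.b [S.unit, c]).val = - c.val := by
  rw [val_b]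
  simp [suspExponent, evalWord_two, unit, S.mu_one_two, Homog.sdeg]

lemma b_unit_right (c : Homog 𝒜) : (S.b [c, S.unit]).val = c.sdeg.negOnePow • c.val := by
  rw [val_b]
  simp [suspExponent, evalWord_two, unit, S.mu_two_one]

/-! ### The trace pairing -/

/-- The trace pairing as a bilinear map. -/
def ωL : A →ₗ[𝕜] A →ₗ[𝕜] 𝕜 :=
  LinearMap.mk₂ 𝕜 S.ω
    (fun x y z => by simpa using S.ω_add_smul 1 x y z)
    (fun c x z => by
      have h0 := S.ω_add_smul (-1) 0 0 z
      have h := S.ω_add_smul c x 0 z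
      simp at h0 h
      simp [h, h0])
    (fun x y z => by
      have := evalWord_add_smul S.μ [x] [] 1 y z
      simp only [List.cons_append, List.nil_append, evalWord_two, one_smul] at this
      simp [ω, this])
    (fun c x y => by
      have := evalWord_smul S.μ [x] [] c y
      simp only [List.cons_append, List.nil_append, evalWord_two] at this
      simp [ω, this])

@[simp] lemma ωL_apply (x y : A) : S.ωL x y = S.ω x y := rfl

lemma ω_units_left (u : ℤˣ) (x y : A) : S.ω (u • x) y = u • S.ω x y := by
  rcases Int.units_eq_one_or u with rfl | rfl
  · simp
  · simpa only [Units.neg_smul, one_smul, ωL_apply] using S.ωL.map_neg₂ x y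

/-- This is cyclicity of `μ₂` on the unit and `x`, where both inner products collapse. -/
lemma ω_symm (x y : Homog 𝒜) :
    S.ω x.val y.val = (x.deg * y.deg).negOnePow • S.ω y.val x.val := by
  have h := S.cyclic [S.unit] x y
  simp only [List.map_cons, List.map_nil, List.cons_append, List.nil_append, evalWord_two] at h
  have h1 : S.μ 2 ![S.unit.val, x.val] = x.val := S.mu_one_two _
  have h2 : S.μ 2 ![y.val, S.unit.val] = y.val := S.mu_two_one _
  rw [h1, h2] at h
  rw [ω, h, ω]
  congr 1
  apply negOnePow_congr
  simp only [degSum, List.map_cons, List.map_nil, List.sum_cons, List.sum_nil, deg_unit,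
    List.length_cons, List.length_nil]
  push_cast
  clear h h1 h2
  grind

/-- Cyclic invariance of the operations on the suspension, for one letter. -/
lemma ω_b_rotate_one (w : List (Homog 𝒜)) (x y : Homog 𝒜) :
    S.ω (S.b (w ++ [x])).val y.val =
      (y.sdeg * (sdegSum w + x.sdeg) + x.sdeg + y.sdeg).negOnePow •
        S.ω (S.b (y :: w)).val x.val := by
  have h := S.cyclic w x y
  simp only [val_b, ω_units_left, List.map_append, List.map_cons, List.map_nil]
  rw [ω, h, ω, smul_smul, smul_smul, ← Int.negOnePow_add, ← Int.negOnePow_add]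
  congr 1
  apply negOnePow_congr
  simp only [suspExponent_append, suspExponent, degSum_eq, deg_eq, List.length_cons,
    List.length_nil]
  push_cast
  clear h
  grind [=_ zmod_two_mul_self, =_ zmod_two_natCast_mul_self]

/-- Cyclic invariance of the operations on the suspension. -/
lemma ω_b_rotate (X Z : List (Homog 𝒜)) (y a : Homog 𝒜) :
    S.ω (S.b (X ++ y :: Z)).val a.val =
      ((sdegSum Z + a.sdeg) * (sdegSum X + y.sdeg) + a.sdeg + y.sdeg).negOnePow •
        S.ω (S.b (Z ++ a :: X)).val y.val := by
  induction Z using List.reverseRecOn generalizing X a with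
  | nil =>
    rw [ω_b_rotate_one]
    congr 1
    apply negOnePow_congr
    simp
    ring
  | append_singleton Z c ih =>
    -- One rotation brings `a` to the front and `c` into the second slot of `ω`; the induction
    -- hypothesis then moves the shorter tail `Z`, with `a :: X` and `c` in place of `X` and `a`.
    have h1 := S.ω_b_rotate_one (X ++ y :: Z) c a
    rw [List.append_assoc, List.cons_append] at h1
    have h2 := ih (a :: X) c
    rw [List.cons_append] at h2
    rw [h1, h2, smul_smul, ← Int.negOnePow_add, List.append_assoc, List.cons_append,
      List.nil_append]
    congr 1
    apply negOnePow_congr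
    simp only [sdegSum_append, sdegSum_cons, sdegSum_nil]
    push_cast
    grind [=_ zmod_two_mul_self]

end CyclicAInfinityAlgebra

end StringBracket

end

/-! ### The complex `C̄(A, A^*)`, the Connes operator and the map `ω_♯`. -/

noncomputable section

namespace StringBracket

section SumSplit

variable {α M : Type*} [AddCommMonoid M]

lemma sumSplit_eq_left_nil {F : List α → List α → M} {w : List α}
    (h : ∀ X Z, X ≠ [] → F X Z = 0) : sumSplit F w = F [] w := by
  cases w with
  | nil => simp
  | cons a w => rw [sumSplit_cons, sumSplit_zero fun X Z _ => h _ _ (by simp), add_zero]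

lemma sumSplit_eq_right_nil {F : List α → List α → M} {w : List α}
    (h : ∀ X Z, Z ≠ [] → F X Z = 0) : sumSplit F w = F w [] := by
  induction w generalizing F with
  | nil => simp
  | cons a w ih =>
    rw [sumSplit_cons, h [] _ (by simp), zero_add, ih fun X Z hZ => h _ _ hZ]

/-- A sum over the cuts of a word in three pieces, for a function which vanishes unless the outer
pieces together consist of one letter. -/
lemma sumSplit3_eq_of_outer_length_one {F : List α → List α → List α → M}
    (h : ∀ X Y Z, X.length + Z.length ≠ 1 → F X Y Z = 0) (C : List α) (hC : C ≠ []) :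
    sumSplit3 F C = F (C.take 1) (C.drop 1) [] + F [] C.dropLast (C.reverse.take 1) := by
  have h1 : sumSplit (fun Y Z => F [] Y Z) C = F [] C.dropLast (C.reverse.take 1) := by
    obtain ⟨E, y, rfl⟩ := List.eq_nil_or_concat'  C |>.resolve_left hC
    rw [sumSplit_append_cons]
    simp only [sumSplit_nil, h [] (E ++ [y]) [] (by simp), add_zero]
    rw [sumSplit_eq_right_nil]
    · simp
    · intro X Z hZ
      refine h _ _ _ ?_
      have := List.length_pos_of_ne_nil hZ
      simp
      omega
  have h2 : ∀ (x : α) (D : List α),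
      sumSplit (fun X R => sumSplit (fun Y Z => F (x :: X) Y Z) R) D = F [x] D [] := by
    intro x D
    rw [sumSplit_eq_left_nil, sumSplit_eq_right_nil]
    · intro X Z hZ
      refine h _ _ _ ?_
      have := List.length_pos_of_ne_nil hZ
      simp
      omega
    · intro X Z hX
      refine sumSplit_zero fun Y Z _ => h _ _ _ ?_
      have := List.length_pos_of_ne_nil hX
      simp
      omega
  cases C with
  | nil => exact absurd rfl hC
  | cons x D =>
    rw [← h1, sumSplit3, sumSplit_cons, h2, add_comm]
    simp

end SumSplit

lemma negOnePow_smul_neg {M : Type*} [AddCommGroup M] {m n : ℤ} (h : (m : ZMod 2) = n + 1) (x : M) :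
    m.negOnePow • x = - (n.negOnePow • x) := by
  rw [negOnePow_congr (n := n + 1) (by rw [h]; push_cast; rfl), Int.negOnePow_succ, Units.neg_smul]

lemma sumSplit_neg {α M : Type*} [AddCommGroup M] (F : List α → List α → M) (w : List α) :
    sumSplit (fun X Z => - F X Z) w = - sumSplit F w :=
  Finset.sum_neg_distrib _

lemma sumSplit3_neg {α M : Type*} [AddCommGroup M] (F : List α → List α → List α → M)
    (w : List α) : sumSplit3 (fun X Y Z => - F X Y Z) w = - sumSplit3 F w := by
  simp only [sumSplit3, sumSplit_neg]

lemma sumLetter_neg {α M : Type*} [AddCommGroup M] (F : List α → α → List α → M) (w : List α) :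
    sumLetter (fun X c Z => - F X c Z) w = - sumLetter F w := by
  induction w generalizing F with
  | nil => simp [sumLetter]
  | cons b w ih => simp [sumLetter, ih, add_comm]

section

variable {𝕜 A : Type*} [RCLike 𝕜] [AddCommGroup A] [Module 𝕜 A]

lemma map_units_smul {M N : Type*} [AddCommGroup M] [Module 𝕜 M] [AddCommGroup N] [Module 𝕜 N]
    (f : M →ₗ[𝕜] N) (u : ℤˣ) (x : M) : f (u • x) = u • f x := by
  rcases Int.units_eq_one_or u with rfl | rfl <;> simp

end

section

variable {𝕜 A : Type*} [RCLike 𝕜] [AddCommGroup A] [Module 𝕜 A] {𝒜 : ℤ → Submodule 𝕜 A}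

lemma sdegSum_congr {v w : List (Homog 𝒜)} (h : v.map Homog.deg = w.map Homog.deg) :
    sdegSum v = sdegSum w := by
  have e : ∀ u : List (Homog 𝒜), sdegSum u = ((u.map Homog.deg).map (fun d => d - 1)).sum := by
    intro u
    rw [List.map_map]
    rfl
  rw [e, e, h]

variable {M : Type*} [AddCommGroup M] [Module 𝕜 M]

lemma isMultilinear_sumSplit {F : List (Homog 𝒜) → List (Homog 𝒜) → M}
    (h : ∀ X, IsMultilinear (𝕜 := 𝕜) (F X)) (h' : ∀ Z, IsMultilinear (𝕜 := 𝕜) fun X => F X Z) :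
    IsMultilinear (𝕜 := 𝕜) (sumSplit F) := by
  intro l r i c x y
  simp only [sumSplit_append_cons, h _ _ _ i c x y, h' _ _ _ i c x y, sumSplit_add,
    ← smul_sumSplit, smul_add]
  abel

end

namespace CyclicAInfinityAlgebra

variable {𝕜 A : Type*} [RCLike 𝕜] [AddCommGroup A] [Module 𝕜 A] {𝒜 : ℤ → Submodule 𝕜 A}
  (S : CyclicAInfinityAlgebra 𝕜 𝒜)

/-! ## Hochschild cochains -/

section HochDual

variable {S} {q : ℤ} {φ : Homog 𝒜 → List (Homog 𝒜) → 𝕜}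

/-- A Hochschild cochain as a linear function of its coefficient. -/
def coeffLin (hφ : φ ∈ S.hochDual q) (i : ℤ) (w : List (Homog 𝒜)) : 𝒜 i →ₗ[𝕜] 𝕜 where
  toFun x := φ (Homog.of x) w
  map_add' x y := by simpa using hφ.1 i 1 x y w
  map_smul' c x := by
    have h0 := hφ.1 i 1 0 0 w
    have h := hφ.1 i c x 0 w
    simp at h0
    simpa [h0] using h

/-- A letter carries its degree as data, so linearity in the coefficient can relate `b(1, c)` to `c`
only after their degrees have been identified. -/
lemma hochDual_of_units_smul (hφ : φ ∈ S.hochDual q) {a c : Homog 𝒜} (u : ℤˣ)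
    (hd : a.deg = c.deg) (hv : a.val = u • c.val) (w : List (Homog 𝒜)) :
    φ a w = u • φ c w := by
  have h : a = Homog.of (u • (⟨c.val, c.mem⟩ : 𝒜 c.deg)) := by
    refine Homog.eq_of _ _ hd ?_
    rw [hv]
    rcases Int.units_eq_one_or u with rfl | rfl <;> simp
  rw [h]
  exact map_units_smul (coeffLin hφ c.deg w) u _

lemma hochDual_of_val_zero (hφ : φ ∈ S.hochDual q) {a : Homog 𝒜} (hv : a.val = 0)
    (w : List (Homog 𝒜)) : φ a w = 0 := by
  rw [Homog.eq_of a (0 : 𝒜 a.deg) rfl (by simpa using hv)]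
  exact map_zero (coeffLin hφ a.deg w)

end HochDual

lemma connesDual_apply (φ : Homog 𝒜 → List (Homog 𝒜) → 𝕜) (a : Homog 𝒜) (w : List (Homog 𝒜)) :
    S.connesDual φ a w = sumSplit (fun X Z => (sdegSum Z * (a.sdeg + sdegSum X)).negOnePow •
      φ S.unit (Z ++ a :: X)) w := rfl

lemma deltaDual_apply (φ : Homog 𝒜 → List (Homog 𝒜) → 𝕜) (a : Homog 𝒜) (w : List (Homog 𝒜)) :
    S.deltaDual φ a w =
      sumSplit3 (fun X Y Z => (a.sdeg + sdegSum X).negOnePow • φ a (X ++ S.b Y :: Z)) w +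
      sumSplit3 (fun X Y Z => (sdegSum Z * (a.sdeg + sdegSum X + sdegSum Y)).negOnePow •
        φ (S.b (Z ++ a :: X)) Y) w := rfl

/-- The first operator makes the unit the coefficient, the second moves it among the reduced
letters, where normalized cochains vanish. -/
lemma connesDual_connesDual {q : ℤ} {φ : Homog 𝒜 → List (Homog 𝒜) → 𝕜} (hφ : φ ∈ S.hochDual q) :
    S.connesDual (S.connesDual φ) = 0 := by
  funext a w
  rw [connesDual_apply]
  refine sumSplit_zero fun X Z _ => ?_
  rw [connesDual_apply, sumSplit_zero, smul_zero]
  intro U V _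
  rw [hφ.2.2.1, smul_zero]

/-- The sum of the terms of the transposed Hochschild differential which involve the unit of a
normalized chain `1 ⊗ C`. -/
lemma sumSplit3_b_unit {q : ℤ} {φ : Homog 𝒜 → List (Homog 𝒜) → 𝕜} (hφ : φ ∈ S.hochDual q)
    (C : List (Homog 𝒜)) (hC : C ≠ []) :
    sumSplit3 (fun X Y Z => (sdegSum Z * (S.unit.sdeg + sdegSum X + sdegSum Y)).negOnePow •
        φ (S.b (Z ++ S.unit :: X)) Y) C =
      (fun X Y Z => (sdegSum Z * (S.unit.sdeg + sdegSum X + sdegSum Y)).negOnePow •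
        φ (S.b (Z ++ S.unit :: X)) Y) (C.take 1) (C.drop 1) [] +
      (fun X Y Z => (sdegSum Z * (S.unit.sdeg + sdegSum X + sdegSum Y)).negOnePow •
        φ (S.b (Z ++ S.unit :: X)) Y) [] C.dropLast (C.reverse.take 1) := by
  refine sumSplit3_eq_of_outer_length_one (fun X Y Z h => ?_) C hC
  rw [hochDual_of_val_zero hφ, smul_zero]
  exact S.evalWord_unit _ _ rfl (by simp; omega)

lemma phi_b_unit_left {q : ℤ} {φ : Homog 𝒜 → List (Homog 𝒜) → 𝕜} (hφ : φ ∈ S.hochDual q)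
    (c : Homog 𝒜) (w : List (Homog 𝒜)) : φ (S.b [S.unit, c]) w = (-1 : ℤˣ) • φ c w := by
  refine hochDual_of_units_smul hφ _ ?_ ?_ w
  · simp [deg_eq c]
    ring
  · rw [b_unit_left]
    simp

lemma phi_b_unit_right {q : ℤ} {φ : Homog 𝒜 → List (Homog 𝒜) → 𝕜} (hφ : φ ∈ S.hochDual q)
    (c : Homog 𝒜) (w : List (Homog 𝒜)) : φ (S.b [c, S.unit]) w = c.sdeg.negOnePow • φ c w := by
  refine hochDual_of_units_smul hφ _ ?_ ?_ w
  · simp [deg_eq c]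
    ring
  · rw [b_unit_right]

/-- The unit terms in the anticommutator of the Hochschild and Connes operators cancel. -/
lemma sum_unit_terms {q : ℤ} {φ : Homog 𝒜 → List (Homog 𝒜) → 𝕜} (hφ : φ ∈ S.hochDual q)
    (a : Homog 𝒜) (w : List (Homog 𝒜)) :
    sumSplit (fun P Q => (sdegSum Q * (a.sdeg + sdegSum P)).negOnePow •
      sumSplit3 (fun X Y Z => (sdegSum Z * (S.unit.sdeg + sdegSum X + sdegSum Y)).negOnePow •
        φ (S.b (Z ++ S.unit :: X)) Y) (Q ++ a :: P)) w = 0 := by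
  simp only [S.sumSplit3_b_unit hφ _ (List.append_ne_nil_of_right_ne_nil _ (List.cons_ne_nil _ _)),
    smul_add, sumSplit_add]
  -- `b(1, c)` removes the first letter of a rotation of `a, w`, and `b(c, 1)` removes the last
  -- letter of the neighbouring rotation. For a letter `c` of `w` both leave the same word with
  -- coefficient `c`. The two extreme cuts remain, where the removed letter is `a`; they cancel each
  -- other.
  rw [sumSplit_eq_sumLetter_right, sumSplit_eq_sumLetter_left]
  have e1 : ∀ (P Q : List (Homog 𝒜)) (c : Homog 𝒜),
      (Q ++ a :: (P ++ [c])) = (Q ++ a :: P) ++ [c] := by simp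
  simp only [e1, List.reverse_concat, List.dropLast_concat, List.take_succ_cons, List.take_zero,
    List.cons_append, List.drop_succ_cons, List.drop_zero, List.nil_append, S.phi_b_unit_left hφ,
    S.phi_b_unit_right hφ, sdegSum_nil, sdegSum_cons, zero_mul, Int.negOnePow_zero,
    add_zero, sdegSum_append, sdeg_unit, smul_smul, ← Int.negOnePow_add, Units.neg_smul,
    one_smul, smul_neg, sumLetter_neg]
  rw [negOnePow_congr (n := 0)]
  · rw [Int.negOnePow_zero, one_smul]
    have : ∀ x y z : 𝕜, x = z → -x + -y + (y + z) = 0 := by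
      rintro x y z rfl
      ring
    refine this _ _ _ (sumLetter_congr fun X c Z _ => ?_)
    congr 1
    apply negOnePow_congr
    push_cast
    grind [=_ zmod_two_mul_self]
  · push_cast
    grind [=_ zmod_two_mul_self]

/-- Both composites put a unit in front of a rotation of `a, w` in which a subword is replaced by
its `b`. The terms are matched by the position of this subword and have opposite signs; the terms in
which `b` takes the new unit as an argument cancel among themselves by `sum_unit_terms`. -/
lemma deltaDual_connesDual {q : ℤ} {φ : Homog 𝒜 → List (Homog 𝒜) → 𝕜} (hφ : φ ∈ S.hochDual q) :
    S.deltaDual (S.connesDual φ) = - S.connesDual (S.deltaDual φ) := by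
  rw [eq_neg_iff_add_eq_zero]
  funext a w
  have hunit := S.sum_unit_terms hφ a w
  have e2 : ∀ P Q : List (Homog 𝒜), S.deltaDual φ S.unit (Q ++ a :: P) =
      sumSplit3 (fun X Y Z => (S.unit.sdeg + sdegSum X).negOnePow •
        φ S.unit (X ++ S.b Y :: Z)) (Q ++ a :: P) +
      sumSplit3 (fun X Y Z => (sdegSum Z * (S.unit.sdeg + sdegSum X + sdegSum Y)).negOnePow •
        φ (S.b (Z ++ S.unit :: X)) Y) (Q ++ a :: P) := fun P Q => rfl
  rw [Pi.add_apply, Pi.add_apply, connesDual_apply S (S.deltaDual φ)]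
  simp only [e2, smul_add, sumSplit_add, hunit, add_zero]
  rw [deltaDual_apply]
  have e3 : ∀ X Y Z : List (Homog 𝒜), S.connesDual φ a (X ++ S.b Y :: Z) =
      sumSplit (fun U V => (sdegSum (V ++ S.b Y :: Z) * (a.sdeg + sdegSum U)).negOnePow •
        φ S.unit ((V ++ S.b Y :: Z) ++ a :: U)) X +
      sumSplit (fun U V => (sdegSum V * (a.sdeg + sdegSum (X ++ S.b Y :: U))).negOnePow •
        φ S.unit (V ++ a :: (X ++ S.b Y :: U))) Z := fun X Y Z => by
    rw [connesDual_apply, sumSplit_append_cons]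
  simp only [e3, smul_add, smul_sumSplit, sumSplit3_add]
  simp only [connesDual_apply, smul_sumSplit, sumSplit3_append_cons, smul_add, sumSplit_add,
    smul_sumSplit3, smul_smul, ← Int.negOnePow_add]
  have e4 : ∀ G : List (Homog 𝒜) → List (Homog 𝒜) → List (Homog 𝒜) → List (Homog 𝒜) → 𝕜,
      sumSplit (fun P Q => sumSplit (fun Q₁ Q₂ => sumSplit (fun P₁ P₂ => G P₁ P₂ Q₁ Q₂) P) Q) w =
      sumSplit3 (fun X Y Z => sumSplit (fun Y₁ Y₂ => G X Y₁ Y₂ Z) Y) w := by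
    intro G
    simp only [sumSplit3, sumSplit_assoc]
    rw [← sumSplit_assoc (fun P₁ P₂ Q => sumSplit (fun Q₁ Q₂ => G P₁ P₂ Q₁ Q₂) Q)]
    exact sumSplit_congr fun P Q _ => sumSplit_comm _ _ _
  -- In `x`, `y`, `z` the cut is before `b`, the cut is after `b`, or `a` is an argument of `b`. In
  -- `x'`, `y'`, `z'` the operation precedes `a` in the rotation, contains `a`, or follows it. A cut
  -- before `b` puts `b` ahead of `a`, and a cut after `b` puts it behind.
  have e5 : ∀ x y z x' y' z' : 𝕜, x = - x' → y = - z' → z = - y' →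
      x + y + z + (x' + y' + z') = 0 := by
    rintro _ _ _ x' y' z' rfl rfl rfl
    ring
  rw [Pi.zero_apply, Pi.zero_apply]
  refine e5 _ _ _ _ _ _ ?_ ?_ ?_
  · rw [← sumSplit_neg]
    simp only [← sumSplit3_neg]
    refine Eq.trans ?_ ((sumSplit3_sumSplit_left (fun U V Y Z =>
      -((sdegSum (V ++ (Y ++ Z)) * (a.sdeg + sdegSum U) + (S.unit.sdeg + sdegSum V)).negOnePow •
        φ S.unit (V ++ S.b Y :: (Z ++ a :: U)))) w).trans ?_)
    · refine sumSplit3_congr fun X Y Z _ => sumSplit_congr fun U V hX => ?_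
      rw [List.append_assoc, List.cons_append, ← negOnePow_smul_neg]
      rw [hX]
      simp only [sdegSum_append, sdegSum_cons, sdeg_b, sdeg_unit]
      push_cast
      grind [=_ zmod_two_mul_self]
    · exact sumSplit_congr fun P Q _ => sumSplit3_congr fun X Y Z hQ => by rw [hQ]
  · rw [← sumSplit_neg]
    simp only [← sumSplit3_neg]
    refine Eq.trans ?_ ((sumSplit3_sumSplit_right (fun X Y Z Q =>
      -((sdegSum Q * (a.sdeg + sdegSum (X ++ (Y ++ Z))) +
        (S.unit.sdeg + sdegSum (Q ++ a :: X))).negOnePow •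
          φ S.unit (Q ++ a :: (X ++ S.b Y :: Z)))) w).trans ?_)
    · refine sumSplit3_congr fun X Y Z _ => sumSplit_congr fun U V hX => ?_
      rw [← negOnePow_smul_neg]
      simp only [sdegSum_append, sdegSum_cons, sdeg_b, sdeg_unit]
      push_cast
      grind [=_ zmod_two_mul_self]
    · exact sumSplit_congr fun P Q _ => sumSplit3_congr fun X Y Z hP => by
        rw [hP, List.append_assoc, List.cons_append]
  · have e6 := e4 fun P₁ P₂ Q₁ Q₂ =>
      (sdegSum (Q₁ ++ Q₂) * (a.sdeg + sdegSum (P₁ ++ P₂)) +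
        (S.unit.sdeg + sdegSum Q₁)).negOnePow • φ S.unit (Q₁ ++ S.b (Q₂ ++ a :: P₁) :: P₂)
    rw [← sumSplit_neg]
    refine Eq.trans ?_ ((congrArg Neg.neg e6).symm.trans ?_)
    · rw [← sumSplit3_neg]
      refine sumSplit3_congr fun X Y Z _ => ?_
      rw [← sumSplit_neg]
      refine sumSplit_congr fun U V hY => ?_
      rw [← negOnePow_smul_neg]
      rw [hY]
      simp only [sdegSum_append, sdegSum_cons, sdeg_b, sdeg_unit]
      push_cast
      grind [=_ zmod_two_mul_self]
    · rw [← sumSplit_neg]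
      refine sumSplit_congr fun P Q _ => congrArg Neg.neg ?_
      refine sumSplit_congr fun Q₁ Q₂ hQ => sumSplit_congr fun P₁ P₂ hP => ?_
      rw [hQ, hP]

/-! ### The map `ω_♯` is a map of complexes -/

/-- Terms with `b` among the arguments of `f` correspond directly. A term with `b` applied to the
coefficient is turned by `ω_symm` and `ω_b_rotate` into one with `b` applied to the value of `f`. -/
lemma sharp_deltaDual [DirectSum.Decomposition 𝒜] {p : ℤ} {f : List (Homog 𝒜) → A}
    (hf : f ∈ S.hochA p) :
    S.deltaDual (S.sharp f) = (p + 1).negOnePow • S.sharp (S.deltaA p f) := by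
  funext a w
  have hω : ∀ x, S.ω x a.val = (S.ωL.flip a.val) x := fun x => rfl
  have hsub : S.sharp (S.deltaA p f) a w = (a.deg * sdegSum w).negOnePow •
      (sumSplit3 (fun X Y Z => ((p - 1) * sdegSum X).negOnePow •
        S.ω (S.b (X ++ Homog.comp (sdegSum Y + p) (f Y) :: Z)).val a.val) w -
      (p - 1).negOnePow • sumSplit3 (fun X Y Z => (sdegSum X).negOnePow •
        S.ω (f (X ++ S.b Y :: Z)) a.val) w) := by
    rw [sharp, deltaA, hω]
    simp only [map_sub, map_units_smul, map_sumSplit3]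
    rfl
  rw [Pi.smul_apply, Pi.smul_apply, hsub, deltaDual_apply, smul_sub, smul_sub, sub_eq_neg_add]
  congr 1
  · simp only [smul_sumSplit3]
    rw [← sumSplit3_neg]
    refine sumSplit3_congr fun X Y Z hw => ?_
    simp only [sharp, smul_smul, ← Int.negOnePow_add]
    rw [← negOnePow_smul_neg]
    rw [hw]
    simp only [deg_eq, sdegSum_append, sdegSum_cons, sdeg_b]
    push_cast
    grind [=_ zmod_two_mul_self]
  · simp only [smul_sumSplit3]
    refine sumSplit3_congr fun X Y Z hw => ?_
    have hY : f Y = (Homog.comp (sdegSum Y + p) (f Y) : Homog 𝒜).val :=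
      (Homog.val_comp (hf.2.2.1 Y)).symm
    simp only [sharp]
    rw [hY, ω_symm, Homog.val_comp (hf.2.2.1 Y), ω_b_rotate]
    simp only [smul_smul, ← Int.negOnePow_add, Homog.val_comp (hf.2.2.1 Y)]
    congr 1
    apply negOnePow_congr
    rw [hw]
    simp only [deg_eq, sdegSum_append, sdegSum_cons, sdeg_b, Homog.sdeg_comp]
    push_cast
    grind [=_ zmod_two_mul_self]

/-! ### Membership -/

lemma connesDual_mem {q : ℤ} {φ : Homog 𝒜 → List (Homog 𝒜) → 𝕜} (hφ : φ ∈ S.hochDual q) :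
    S.connesDual φ ∈ S.hochDual (q + 1) := by
  obtain ⟨h0, h1, h2, h3, N, hN⟩ := hφ
  refine ⟨fun i c x y w => ?_, fun a => ?_, fun a l r => ?_, fun a w h => ?_, N, fun a w h => ?_⟩
  · simp only [connesDual_apply, smul_sumSplit, ← sumSplit_add]
    refine sumSplit_congr fun X Z _ => ?_
    simp only [sdeg_of, h1 S.unit Z X i c x y, smul_add, sign_smul_comm]
  · refine isMultilinear_sumSplit (F := fun X Z => (sdegSum Z * (a.sdeg + sdegSum X)).negOnePow •
      φ S.unit (Z ++ a :: X)) (fun X => ?_) fun Z => ?_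
    · refine IsMultilinear.units_smul_left (f := fun Z => φ S.unit (Z ++ a :: X)) ?_ _ ?_
      · intro l r i c x y
        simpa using h1 S.unit l (r ++ a :: X) i c x y
      · intro v w h
        rw [sdegSum_congr h]
    · refine IsMultilinear.units_smul_left (f := fun X => φ S.unit (Z ++ a :: X)) ?_ _ ?_
      · intro l r i c x y
        simpa using h1 S.unit (Z ++ a :: l) r i c x y
      · intro v w h
        rw [sdegSum_congr h]
  · rw [connesDual_apply, sumSplit_append_cons, sumSplit_zero, sumSplit_zero, add_zero]
    · intro U V _
      have := h2 S.unit (V ++ a :: l) U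
      simp only [List.append_assoc, List.cons_append] at this ⊢
      rw [this, smul_zero]
    · intro U V _
      have := h2 S.unit V (r ++ a :: U)
      simp only [List.append_assoc, List.cons_append] at this ⊢
      rw [this, smul_zero]
  · rw [connesDual_apply, sumSplit_zero]
    intro X Z hw
    rw [h3, smul_zero]
    rw [hw, deg_eq] at h
    simp only [deg_unit, sdegSum_append, sdegSum_cons] at h ⊢
    omega
  · rw [connesDual_apply, sumSplit_zero]
    intro X Z hw
    rw [hN, smul_zero]
    have := congrArg List.length hw
    simp at this ⊢
    omega

lemma sharp_mem {p : ℤ} {f : List (Homog 𝒜) → A} (hf : f ∈ S.hochA p) :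
    S.sharp f ∈ S.hochDual (2 - p) := by
  obtain ⟨h1, h2, h3, N, hN⟩ := hf
  have hz : ∀ x, S.ω 0 x = 0 := fun x => S.ωL.map_zero₂ x
  refine ⟨fun i c x y w => ?_, fun a => ?_, fun a l r => ?_, fun a w h => ?_, N, fun a w h => ?_⟩
  · have : S.ω (f w) (c • (x : A) + y) = c • S.ω (f w) x + S.ω (f w) y := by
      simpa using map_add (S.ωL (f w)) (c • (x : A)) y
    simp only [sharp, deg_of, val_of, Submodule.coe_add, Submodule.coe_smul, this, smul_add,
      sign_smul_comm]
  · refine IsMultilinear.units_smul_left (f := fun w => S.ω (f w) a.val) ?_ _ ?_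
    · intro l r i c x y
      simp only [h1 l r i c x y, S.ω_add_smul]
    · intro v w h
      rw [sdegSum_congr h]
  · simp [sharp, h2, hz]
  · rw [sharp, ω, S.Tr_degree (sdegSum w + p + a.deg), smul_zero]
    · omega
    · have := S.mu_degree 2 ![sdegSum w + p, a.deg] ![f w, a.val] (fun i => by
        fin_cases i
        · exact h3 w
        · exact a.mem)
      simpa [Fin.sum_univ_two] using this
  · simp [sharp, hN w h, hz]

end CyclicAInfinityAlgebra

end StringBracket

end

/-! ### The Leibniz rule for the cup product on `C̄(A, A)`. -/

noncomputable section

namespace StringBracket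

section SumSplit

variable {α M N : Type*} [AddCommMonoid M] [AddCommMonoid N]

lemma sumSplit5_congr {F G : List α → List α → List α → List α → List α → M} {w : List α}
    (h : ∀ X₁ X₂ X₃ X₄ X₅, w = X₁ ++ (X₂ ++ (X₃ ++ (X₄ ++ X₅))) →
      F X₁ X₂ X₃ X₄ X₅ = G X₁ X₂ X₃ X₄ X₅) : sumSplit5 F w = sumSplit5 G w :=
  sumSplit3_congr fun _ _ _ hR => sumSplit3_congr fun _ _ _ hZ => h _ _ _ _ _ (by rw [hR, hZ])

lemma sumSplit5_zero {F : List α → List α → List α → List α → List α → M} {w : List α}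
    (h : ∀ X₁ X₂ X₃ X₄ X₅, w = X₁ ++ (X₂ ++ (X₃ ++ (X₄ ++ X₅))) →
      F X₁ X₂ X₃ X₄ X₅ = 0) : sumSplit5 F w = 0 :=
  sumSplit3_zero fun _ _ _ hR => sumSplit3_zero fun _ _ _ hZ => h _ _ _ _ _ (by rw [hR, hZ])

lemma sumSplit5_add (F G : List α → List α → List α → List α → List α → M) (w : List α) :
    sumSplit5 (fun X₁ X₂ X₃ X₄ X₅ => F X₁ X₂ X₃ X₄ X₅ + G X₁ X₂ X₃ X₄ X₅) w =
      sumSplit5 F w + sumSplit5 G w := by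
  simp only [sumSplit5, sumSplit3_add]

lemma map_sumSplit5 {H : Type*} [FunLike H M N] [AddMonoidHomClass H M N] (f : H)
    (F : List α → List α → List α → List α → List α → M) (w : List α) :
    f (sumSplit5 F w) = sumSplit5 (fun X₁ X₂ X₃ X₄ X₅ => f (F X₁ X₂ X₃ X₄ X₅)) w := by
  simp only [sumSplit5, map_sumSplit3]

lemma smul_sumSplit5 {R : Type*} [DistribSMul R M] (c : R)
    (F : List α → List α → List α → List α → List α → M) (w : List α) :
    c • sumSplit5 F w = sumSplit5 (fun X₁ X₂ X₃ X₄ X₅ => c • F X₁ X₂ X₃ X₄ X₅) w := by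
  simp only [sumSplit5, smul_sumSplit3]

lemma sumSplit5_neg {α M : Type*} [AddCommGroup M]
    (F : List α → List α → List α → List α → List α → M) (w : List α) :
    sumSplit5 (fun X₁ X₂ X₃ X₄ X₅ => - F X₁ X₂ X₃ X₄ X₅) w = - sumSplit5 F w := by
  simp only [sumSplit5, sumSplit3_neg]

/-- A copy of `sumSplit`, which keeps sums over the cuts of a fixed word apart. -/
def sumCut (F : List α → List α → M) (w : List α) : M := sumSplit F w

lemma sumSplit_sumCut {β : Type*} (F : List α → List α → List β → List β → M)
    (w : List α) (v : List β) :
    sumSplit (fun X Z => sumCut (fun U V => F X Z U V) v) w =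
      sumCut (fun U V => sumSplit (fun X Z => F X Z U V) w) v :=
  sumSplit_comm F w v

/-- The end of `X₁`, the piece `X₂` and the beginning of `X₃` merge into a new second piece. This
occurs when an operation takes the value on `X₂` and neighbouring letters as its arguments. -/
lemma sumSplit5_regroup_two
    (K : List α → List α → List α → List α → List α → List α → List α → M) (w : List α) :
    sumSplit5 (fun X₁ X₂ X₃ X₄ X₅ => sumSplit (fun U₁ U₂ => sumSplit (fun V₁ V₂ =>
        K U₁ U₂ X₂ V₁ V₂ X₄ X₅) X₃) X₁) w =
      sumSplit5 (fun Y₁ Y₂ Y₃ Y₄ Y₅ => sumSplit3 (fun P Q R => K Y₁ P Q R Y₃ Y₄ Y₅) Y₂) w := by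
  -- Writing the inner cuts as `sumCut` gives the interchange of sums a direction: `simp` moves them
  -- outwards to the cuts that they refine, where `sumSplit_assoc` applies.
  change sumSplit5 (fun X₁ X₂ X₃ X₄ X₅ => sumCut (fun U₁ U₂ => sumCut (fun V₁ V₂ =>
        K U₁ U₂ X₂ V₁ V₂ X₄ X₅) X₃) X₁) w =
      sumSplit5 (fun Y₁ Y₂ Y₃ Y₄ Y₅ => sumCut (fun P T => sumCut (fun Q R =>
        K Y₁ P Q R Y₃ Y₄ Y₅) T) Y₂) w
  simp only [sumSplit5, sumSplit3, sumSplit_sumCut]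
  simp only [sumCut, sumSplit_assoc]

lemma sumSplit5_regroup_four
    (K : List α → List α → List α → List α → List α → List α → List α → M) (w : List α) :
    sumSplit5 (fun X₁ X₂ X₃ X₄ X₅ => sumSplit (fun U₁ U₂ => sumSplit (fun V₁ V₂ =>
        K X₁ X₂ U₁ U₂ X₄ V₁ V₂) X₅) X₃) w =
      sumSplit5 (fun Y₁ Y₂ Y₃ Y₄ Y₅ => sumSplit3 (fun P Q R => K Y₁ Y₂ Y₃ P Q R Y₅) Y₄) w := by
  change sumSplit5 (fun X₁ X₂ X₃ X₄ X₅ => sumCut (fun U₁ U₂ => sumCut (fun V₁ V₂ =>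
        K X₁ X₂ U₁ U₂ X₄ V₁ V₂) X₅) X₃) w =
      sumSplit5 (fun Y₁ Y₂ Y₃ Y₄ Y₅ => sumCut (fun P T => sumCut (fun Q R =>
        K Y₁ Y₂ Y₃ P Q R Y₅) T) Y₄) w
  simp only [sumSplit5, sumSplit3, sumSplit_sumCut]
  simp only [sumCut, sumSplit_assoc]

lemma sumSplit5_regroup_outer
    (K : List α → List α → List α → List α → List α → List α → List α → M) (w : List α) :
    sumSplit5 (fun X₁ X₂ X₃ X₄ X₅ => sumSplit (fun U₁ U₂ => sumSplit (fun V₁ V₂ =>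
        K U₁ U₂ X₂ X₃ X₄ V₁ V₂) X₅) X₁) w =
      sumSplit3 (fun X Y Z => sumSplit5 (fun Y₁ Y₂ Y₃ Y₄ Y₅ => K X Y₁ Y₂ Y₃ Y₄ Y₅ Z) Y) w := by
  change sumSplit5 (fun X₁ X₂ X₃ X₄ X₅ => sumCut (fun U₁ U₂ => sumCut (fun V₁ V₂ =>
        K U₁ U₂ X₂ X₃ X₄ V₁ V₂) X₅) X₁) w = _
  simp only [sumSplit5, sumSplit3, sumSplit_sumCut]
  simp only [sumCut, sumSplit_assoc]

end SumSplit

namespace CyclicAInfinityAlgebra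

variable {𝕜 A : Type*} [RCLike 𝕜] [AddCommGroup A] [Module 𝕜 A] {𝒜 : ℤ → Submodule 𝕜 A}
  (S : CyclicAInfinityAlgebra 𝕜 𝒜)

section Coderivation

variable {M : Type*} [AddCommGroup M]

/-- Composition of a function on words with the coderivation `∑ ± 1^{⊗ r} ⊗ b ⊗ 1^{⊗ t}`. -/
def coder (H : List (Homog 𝒜) → M) (w : List (Homog 𝒜)) : M :=
  sumSplit3 (fun X Y Z => (sdegSum X).negOnePow • H (X ++ S.b Y :: Z)) w

/-- A cut made after `b` has been applied never separates the arguments of `b`, so `b` acts inside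
one of the pieces; it passes `P` in order to act on `Q`. -/
lemma coder_sumSplit (F : List (Homog 𝒜) → List (Homog 𝒜) → M) (w : List (Homog 𝒜)) :
    S.coder (sumSplit F) w = sumSplit (fun P Q => S.coder (fun P' => F P' Q) P +
      (sdegSum P).negOnePow • S.coder (F P) Q) w := by
  simp only [coder, sumSplit_append_cons, smul_add, sumSplit3_add, sumSplit_add, smul_sumSplit,
    smul_sumSplit3]
  rw [add_comm]
  congr 1
  · exact sumSplit3_sumSplit_right _ w
  · refine Eq.trans ?_ (sumSplit3_sumSplit_left (fun U V Y Z => (sdegSum U).negOnePow •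
      (sdegSum V).negOnePow • F U (V ++ S.b Y :: Z)) w)
    refine sumSplit3_congr fun X Y Z _ => sumSplit_congr fun U V hX => ?_
    rw [hX, sdegSum_append, Int.negOnePow_add, mul_smul]

lemma coder_sum_left {β : Type*} (G : List (Homog 𝒜) → List β → List β → M) (v : List β)
    (w : List (Homog 𝒜)) : S.coder (fun P => sumSplit (G P) v) w =
      sumSplit (fun X Z => S.coder (fun P => G P X Z) w) v := by
  simp only [coder, smul_sumSplit, sumSplit3]
  simp only [sumSplit_comm (v := v)]

lemma coder_sumSplit5
    (F : List (Homog 𝒜) → List (Homog 𝒜) → List (Homog 𝒜) → List (Homog 𝒜) → List (Homog 𝒜) → M)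
    (w : List (Homog 𝒜)) :
    S.coder (sumSplit5 F) w = sumSplit5 (fun X₁ X₂ X₃ X₄ X₅ =>
      S.coder (fun P => F P X₂ X₃ X₄ X₅) X₁ +
      ((sdegSum X₁).negOnePow • S.coder (fun P => F X₁ P X₃ X₄ X₅) X₂ +
      ((sdegSum X₁ + sdegSum X₂).negOnePow • S.coder (fun P => F X₁ X₂ P X₄ X₅) X₃ +
      ((sdegSum X₁ + sdegSum X₂ + sdegSum X₃).negOnePow •
        S.coder (fun P => F X₁ X₂ X₃ P X₅) X₄ +
      (sdegSum X₁ + sdegSum X₂ + sdegSum X₃ + sdegSum X₄).negOnePow •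
        S.coder (fun P => F X₁ X₂ X₃ X₄ P) X₅)))) w := by
  have h : sumSplit5 F = sumSplit (fun X₁ R₁ => sumSplit (fun X₂ R₂ => sumSplit (fun X₃ R₃ =>
    sumSplit (fun X₄ X₅ => F X₁ X₂ X₃ X₄ X₅) R₃) R₂) R₁) := rfl
  rw [h, coder_sumSplit]
  simp only [sumSplit5, sumSplit3, coder_sum_left, coder_sumSplit, smul_add, smul_sumSplit,
    sumSplit_add, smul_smul, ← Int.negOnePow_add]
  simp only [add_assoc]

lemma coder_append_cons (H : List (Homog 𝒜) → M) (U V : List (Homog 𝒜)) (y : Homog 𝒜) :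
    S.coder H (U ++ y :: V) = S.coder (fun P => H (P ++ y :: V)) U +
      sumSplit (fun U₁ U₂ => sumSplit (fun V₁ V₂ => (sdegSum U₁).negOnePow •
        H (U₁ ++ S.b (U₂ ++ y :: V₁) :: V₂)) V) U +
      (sdegSum U + y.sdeg).negOnePow • S.coder (fun P => H (U ++ y :: P)) V := by
  simp only [coder, sumSplit3_append_cons, smul_sumSplit3, smul_smul, ← Int.negOnePow_add,
    sdegSum_append, sdegSum_cons, List.append_assoc, List.cons_append, add_assoc]

lemma coder_units_smul (c : List (Homog 𝒜) → ℤ) (c' : ℤ) (H : List (Homog 𝒜) → M)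
    (w : List (Homog 𝒜)) (h : ∀ v, sdegSum v = sdegSum w + 1 → (c v : ZMod 2) = c') :
    S.coder (fun v => (c v).negOnePow • H v) w = c'.negOnePow • S.coder H w := by
  rw [coder, coder, smul_sumSplit3]
  refine sumSplit3_congr fun X Y Z hw => ?_
  rw [negOnePow_congr (h (X ++ S.b Y :: Z) _), smul_comm]
  rw [hw]
  simp
  ring

lemma coder_b (w : List (Homog 𝒜)) : S.coder (fun v => (S.b v).val) w = 0 := S.b_b w

end Coderivation

section Leibniz

variable [DirectSum.Decomposition 𝒜]

/-- `x ↦ b(l, x, r)`, on the degree `d` component of `x`. -/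
def bSlot (l r : List (Homog 𝒜)) (d : ℤ) : A →ₗ[𝕜] A :=
  (S.isMultilinear_b.letter l r d) ∘ₗ (DirectSum.component 𝕜 ℤ (fun i => 𝒜 i) d) ∘ₗ
    (DirectSum.decomposeLinearEquiv 𝒜).toLinearMap

lemma bSlot_apply (l r : List (Homog 𝒜)) (d : ℤ) (x : A) :
    S.bSlot l r d x = (S.b (l ++ Homog.comp d x :: r)).val := rfl

lemma bSlot_b (l r w : List (Homog 𝒜)) {d : ℤ} (h : sdegSum w + 2 = d) :
    S.bSlot l r d (S.b w).val = (S.b (l ++ S.b w :: r)).val := by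
  subst h
  exact congrArg (fun a => (S.b (l ++ a :: r)).val) (Homog.comp_eq (S.b w).mem)

lemma b_deltaA (l r : List (Homog 𝒜)) (p : ℤ) (f : List (Homog 𝒜) → A) (w : List (Homog 𝒜)) :
    (S.b (l ++ Homog.comp (sdegSum w + (p + 1)) (S.deltaA p f w) :: r)).val =
      sumSplit3 (fun P Q R => ((p - 1) * sdegSum P).negOnePow •
        (S.b (l ++ S.b (P ++ Homog.comp (sdegSum Q + p) (f Q) :: R) :: r)).val) w -
      (p - 1).negOnePow • S.coder (fun v =>
        (S.b (l ++ Homog.comp (sdegSum v + p) (f v) :: r)).val) w := by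
  rw [← bSlot_apply, deltaA, map_sub, map_units_smul, map_sumSplit3, map_sumSplit3, coder]
  congr 1
  · refine sumSplit3_congr fun P Q R hw => ?_
    rw [map_units_smul, bSlot_b]
    rw [hw]
    simp
    ring
  · congr 1
    refine sumSplit3_congr fun P Q R hw => ?_
    rw [map_units_smul, bSlot_apply]
    have : sdegSum w + (p + 1) = sdegSum (P ++ S.b Q :: R) + p := by
      rw [hw]
      simp
      ring
    rw [this]

/-- The Leibniz rule for the cup product. -/
lemma deltaA_cup {p q : ℤ} (f g : List (Homog 𝒜) → A) (w : List (Homog 𝒜)) :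
    S.deltaA (p + q) (S.cup p q f g) w = S.cup (p + 1) q (S.deltaA p f) g w +
      p.negOnePow • S.cup p (q + 1) f (S.deltaA q g) w := by
  set F : List (Homog 𝒜) → Homog 𝒜 := fun X => Homog.comp (sdegSum X + p) (f X) with hF
  set G : List (Homog 𝒜) → Homog 𝒜 := fun X => Homog.comp (sdegSum X + q) (g X) with hG
  have sF : ∀ X, (F X).sdeg = sdegSum X + p - 1 := fun X => rfl
  have sG : ∀ X, (G X).sdeg = sdegSum X + q - 1 := fun X => rfl
  -- The sign exponent of the cup product. It and the families below are kept opaque, to be treated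
  -- as atoms until their defining equations are used.
  obtain ⟨e, he⟩ : ∃ e : List (Homog 𝒜) → List (Homog 𝒜) → List (Homog 𝒜) → ℤ,
    e = fun X₁ X₂ X₃ => p - 1 + (p - 1) * sdegSum X₁ +
      (q - 1) * (sdegSum X₁ + sdegSum X₂ + sdegSum X₃) := ⟨_, rfl⟩
  -- the terms of the `A_∞` relation on the words `X₁ ++ F X₂ :: X₃ ++ G X₄ :: X₅`
  obtain ⟨E₁, hE₁⟩ : ∃ E : List (Homog 𝒜) → List (Homog 𝒜) → List (Homog 𝒜) → List (Homog 𝒜) →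
    List (Homog 𝒜) → A, E = fun X₁ X₂ X₃ X₄ X₅ =>
      S.coder (fun P => (S.b (P ++ F X₂ :: (X₃ ++ G X₄ :: X₅))).val) X₁ := ⟨_, rfl⟩
  obtain ⟨E₂, hE₂⟩ : ∃ E : List (Homog 𝒜) → List (Homog 𝒜) → List (Homog 𝒜) → List (Homog 𝒜) →
    List (Homog 𝒜) → A, E = fun X₁ X₂ X₃ X₄ X₅ =>
      S.coder (fun P => (S.b (X₁ ++ F P :: (X₃ ++ G X₄ :: X₅))).val) X₂ := ⟨_, rfl⟩
  obtain ⟨E₃, hE₃⟩ : ∃ E : List (Homog 𝒜) → List (Homog 𝒜) → List (Homog 𝒜) → List (Homog 𝒜) →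
    List (Homog 𝒜) → A, E = fun X₁ X₂ X₃ X₄ X₅ =>
      S.coder (fun P => (S.b (X₁ ++ F X₂ :: (P ++ G X₄ :: X₅))).val) X₃ := ⟨_, rfl⟩
  obtain ⟨E₄, hE₄⟩ : ∃ E : List (Homog 𝒜) → List (Homog 𝒜) → List (Homog 𝒜) → List (Homog 𝒜) →
    List (Homog 𝒜) → A, E = fun X₁ X₂ X₃ X₄ X₅ =>
      S.coder (fun P => (S.b (X₁ ++ F X₂ :: (X₃ ++ G P :: X₅))).val) X₄ := ⟨_, rfl⟩
  obtain ⟨E₅, hE₅⟩ : ∃ E : List (Homog 𝒜) → List (Homog 𝒜) → List (Homog 𝒜) → List (Homog 𝒜) →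
    List (Homog 𝒜) → A, E = fun X₁ X₂ X₃ X₄ X₅ =>
      S.coder (fun P => (S.b (X₁ ++ F X₂ :: (X₃ ++ G X₄ :: P))).val) X₅ := ⟨_, rfl⟩
  obtain ⟨A₁, hA₁⟩ : ∃ E : List (Homog 𝒜) → List (Homog 𝒜) → List (Homog 𝒜) → List (Homog 𝒜) →
    List (Homog 𝒜) → A, E = fun X₁ X₂ X₃ X₄ X₅ =>
      sumSplit (fun U₁ U₂ => sumSplit (fun V₁ V₂ => (sdegSum U₁).negOnePow •
        (S.b (U₁ ++ S.b (U₂ ++ F X₂ :: V₁) :: (V₂ ++ G X₄ :: X₅))).val) X₃) X₁ := ⟨_, rfl⟩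
  obtain ⟨A₂, hA₂⟩ : ∃ E : List (Homog 𝒜) → List (Homog 𝒜) → List (Homog 𝒜) → List (Homog 𝒜) →
    List (Homog 𝒜) → A, E = fun X₁ X₂ X₃ X₄ X₅ =>
      sumSplit (fun U₁ U₂ => sumSplit (fun V₁ V₂ => (sdegSum U₁).negOnePow •
        (S.b (U₁ ++ S.b (U₂ ++ F X₂ :: (X₃ ++ G X₄ :: V₁)) :: V₂)).val) X₅) X₁ := ⟨_, rfl⟩
  obtain ⟨A₃, hA₃⟩ : ∃ E : List (Homog 𝒜) → List (Homog 𝒜) → List (Homog 𝒜) → List (Homog 𝒜) →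
    List (Homog 𝒜) → A, E = fun X₁ X₂ X₃ X₄ X₅ =>
      sumSplit (fun U₁ U₂ => sumSplit (fun V₁ V₂ => (sdegSum U₁).negOnePow •
        (S.b (X₁ ++ F X₂ :: (U₁ ++ S.b (U₂ ++ G X₄ :: V₁) :: V₂))).val) X₅) X₃ := ⟨_, rfl⟩
  -- The inner operation contains neither special letter (`E₁`, `E₃`, `E₅`), only `F X₂` (`A₁`),
  -- only `G X₄` (`A₃`), or both (`A₂`). The `A₂` make up the part `b(…, f ∪ g, …)` of the left
  -- side, and `A₁`, `A₃` come from `b(…, f, …)` and `b(…, g, …)` inside the products on the right.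
  -- The `E₂` and `E₄`, with `b` among the arguments of `f` or `g`, are absent from this relation
  -- and cancel between the two sides.
  have hS : ∀ X₁ X₂ X₃ X₄ X₅, E₁ X₁ X₂ X₃ X₄ X₅ + (A₁ X₁ X₂ X₃ X₄ X₅ + A₂ X₁ X₂ X₃ X₄ X₅) +
      (sdegSum X₁ + (sdegSum X₂ + p - 1)).negOnePow • (E₃ X₁ X₂ X₃ X₄ X₅ + A₃ X₁ X₂ X₃ X₄ X₅ +
        (sdegSum X₃ + (sdegSum X₄ + q - 1)).negOnePow • E₅ X₁ X₂ X₃ X₄ X₅) = 0 := by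
    intro X₁ X₂ X₃ X₄ X₅
    have h := S.coder_b (X₁ ++ F X₂ :: (X₃ ++ G X₄ :: X₅))
    rw [coder_append_cons, coder_append_cons] at h
    simp only [sumSplit_append_cons, sumSplit_add, sF, sG] at h
    simpa only [hE₁, hE₃, hE₅, hA₁, hA₂, hA₃, List.append_assoc, List.cons_append] using h
  have hL1 : sumSplit3 (fun X Y Z => ((p + q - 1) * sdegSum X).negOnePow •
      (S.b (X ++ Homog.comp (sdegSum Y + (p + q)) (S.cup p q f g Y) :: Z)).val) w =
      sumSplit5 (fun X₁ X₂ X₃ X₄ X₅ => (e X₁ X₂ X₃).negOnePow • A₂ X₁ X₂ X₃ X₄ X₅) w := by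
    trans sumSplit5 (fun X₁ X₂ X₃ X₄ X₅ => sumSplit (fun U₁ U₂ => sumSplit (fun V₁ V₂ =>
        (e (U₁ ++ U₂) X₂ X₃ + sdegSum U₁).negOnePow •
          (S.b (U₁ ++ S.b (U₂ ++ F X₂ :: (X₃ ++ G X₄ :: V₁)) :: V₂)).val) X₅) X₁) w
    · rw [sumSplit5_regroup_outer (fun U₁ U₂ X₂ X₃ X₄ V₁ V₂ =>
        (e (U₁ ++ U₂) X₂ X₃ + sdegSum U₁).negOnePow •
          (S.b (U₁ ++ S.b (U₂ ++ F X₂ :: (X₃ ++ G X₄ :: V₁)) :: V₂)).val)]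
      refine sumSplit3_congr fun X Y Z _ => ?_
      rw [← bSlot_apply, cup, map_sumSplit5, smul_sumSplit5]
      refine sumSplit5_congr fun X₁ X₂ X₃ X₄ X₅ hY => ?_
      rw [map_units_smul, bSlot_b, smul_smul, ← Int.negOnePow_add]
      · congr 1
        apply negOnePow_congr
        simp only [he, sdegSum_append]
        push_cast
        grind [=_ zmod_two_mul_self]
      · rw [hY]
        simp
        ring
    · simp only [hA₂, smul_sumSplit, smul_smul, ← Int.negOnePow_add]
      refine sumSplit5_congr fun X₁ X₂ X₃ X₄ X₅ _ => sumSplit_congr fun U₁ U₂ hX => ?_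
      rw [hX]
  have hL2 : sumSplit3 (fun X Y Z => (sdegSum X).negOnePow •
      S.cup p q f g (X ++ S.b Y :: Z)) w = S.coder (S.cup p q f g) w := rfl
  have hL3 : (p + q - 1).negOnePow • S.coder (S.cup p q f g) w =
      sumSplit5 (fun X₁ X₂ X₃ X₄ X₅ => -((e X₁ X₂ X₃).negOnePow • (E₁ X₁ X₂ X₃ X₄ X₅ +
        (sdegSum X₁ + (sdegSum X₂ + p - 1)).negOnePow • (E₃ X₁ X₂ X₃ X₄ X₅ +
          (sdegSum X₃ + (sdegSum X₄ + q - 1)).negOnePow • E₅ X₁ X₂ X₃ X₄ X₅))) +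
        ((e X₁ X₂ X₃ + p + sdegSum X₁).negOnePow • E₂ X₁ X₂ X₃ X₄ X₅ +
        (e X₁ X₂ X₃ + p + q - 1 + sdegSum X₁ + sdegSum X₂ + sdegSum X₃).negOnePow •
          E₄ X₁ X₂ X₃ X₄ X₅)) w := by
    rw [cup, coder_sumSplit5, smul_sumSplit5]
    refine sumSplit5_congr fun X₁ X₂ X₃ X₄ X₅ _ => ?_
    rw [S.coder_units_smul _ (e X₁ X₂ X₃ + p + q), S.coder_units_smul _ (e X₁ X₂ X₃ + q - 1),
      S.coder_units_smul _ (e X₁ X₂ X₃ + q - 1), S.coder_units_smul _ (e X₁ X₂ X₃),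
      S.coder_units_smul _ (e X₁ X₂ X₃)]
    · simp only [hE₁, hE₂, hE₃, hE₄, hE₅, smul_add, smul_smul, ← Int.negOnePow_add, neg_add]
      have h : ∀ {x₁ x₂ x₃ x₄ x₅ y₁ y₂ y₃ y₄ y₅ : A}, x₁ = -y₁ → x₂ = y₂ → x₃ = -y₃ → x₄ = y₄ →
          x₅ = -y₅ → x₁ + (x₂ + (x₃ + (x₄ + x₅))) = -y₁ + (-y₃ + -y₅) + (y₂ + y₄) := by
        rintro _ _ _ _ _ y₁ y₂ y₃ y₄ y₅ rfl rfl rfl rfl rfl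
        abel
      refine h ?_ ?_ ?_ ?_ ?_
      · rw [← negOnePow_smul_neg]
        push_cast
        grind [=_ zmod_two_mul_self]
      · congr 1
        apply negOnePow_congr
        push_cast
        grind [=_ zmod_two_mul_self]
      · rw [← negOnePow_smul_neg]
        push_cast
        grind [=_ zmod_two_mul_self]
      · congr 1
        apply negOnePow_congr
        push_cast
        grind [=_ zmod_two_mul_self]
      · rw [← negOnePow_smul_neg]
        push_cast
        grind [=_ zmod_two_mul_self]
    all_goals
      intro v hv
      simp only [hv, he] <;> push_cast <;> grind [=_ zmod_two_mul_self]
  have hR1 : S.cup (p + 1) q (S.deltaA p f) g w =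
      sumSplit5 (fun X₁ X₂ X₃ X₄ X₅ => -((e X₁ X₂ X₃).negOnePow • A₁ X₁ X₂ X₃ X₄ X₅)) w -
      sumSplit5 (fun X₁ X₂ X₃ X₄ X₅ =>
        (e X₁ X₂ X₃ + p + sdegSum X₁).negOnePow • E₂ X₁ X₂ X₃ X₄ X₅) w := by
    have h1 : sumSplit5 (fun X₁ X₂ X₃ X₄ X₅ => -((e X₁ X₂ X₃).negOnePow • A₁ X₁ X₂ X₃ X₄ X₅)) w =
        sumSplit5 (fun Y₁ Y₂ Y₃ Y₄ Y₅ => sumSplit3 (fun P Q R =>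
          -((e (Y₁ ++ P) Q (R ++ Y₃) + sdegSum Y₁).negOnePow •
            (S.b (Y₁ ++ S.b (P ++ F Q :: R) :: (Y₃ ++ G Y₄ :: Y₅))).val)) Y₂) w := by
      rw [← sumSplit5_regroup_two (fun Y₁ P Q R Y₃ Y₄ Y₅ =>
          -((e (Y₁ ++ P) Q (R ++ Y₃) + sdegSum Y₁).negOnePow •
            (S.b (Y₁ ++ S.b (P ++ F Q :: R) :: (Y₃ ++ G Y₄ :: Y₅))).val))]
      simp only [hA₁, smul_sumSplit, smul_smul, ← Int.negOnePow_add, ← sumSplit_neg]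
      refine sumSplit5_congr fun X₁ X₂ X₃ X₄ X₅ _ => sumSplit_congr fun U₁ U₂ hX =>
        sumSplit_congr fun V₁ V₂ hX' => ?_
      rw [hX, hX']
    rw [h1, sub_eq_add_neg, ← sumSplit5_neg, ← sumSplit5_add, cup]
    refine sumSplit5_congr fun X₁ X₂ X₃ X₄ X₅ _ => ?_
    rw [b_deltaA, smul_sub, sub_eq_add_neg, smul_sumSplit3]
    congr 1
    · refine sumSplit3_congr fun P Q R hX => ?_
      rw [smul_smul, ← Int.negOnePow_add, ← negOnePow_smul_neg]
      simp only [he, hX, sdegSum_append]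
      push_cast
      grind [=_ zmod_two_mul_self]
    · rw [smul_smul, ← Int.negOnePow_add]
      simp only [hE₂]
      congr 2
      apply negOnePow_congr
      simp only [he]
      push_cast
      grind [=_ zmod_two_mul_self]
  have hR2 : p.negOnePow • S.cup p (q + 1) f (S.deltaA q g) w =
      sumSplit5 (fun X₁ X₂ X₃ X₄ X₅ => -((e X₁ X₂ X₃).negOnePow •
        (sdegSum X₁ + (sdegSum X₂ + p - 1)).negOnePow • A₃ X₁ X₂ X₃ X₄ X₅)) w -
      sumSplit5 (fun X₁ X₂ X₃ X₄ X₅ =>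
        (e X₁ X₂ X₃ + p + q - 1 + sdegSum X₁ + sdegSum X₂ + sdegSum X₃).negOnePow •
          E₄ X₁ X₂ X₃ X₄ X₅) w := by
    have h1 : sumSplit5 (fun X₁ X₂ X₃ X₄ X₅ => -((e X₁ X₂ X₃).negOnePow •
        (sdegSum X₁ + (sdegSum X₂ + p - 1)).negOnePow • A₃ X₁ X₂ X₃ X₄ X₅)) w =
        sumSplit5 (fun Y₁ Y₂ Y₃ Y₄ Y₅ => sumSplit3 (fun P Q R =>
          -((e Y₁ Y₂ (Y₃ ++ P) + (sdegSum Y₁ + (sdegSum Y₂ + p - 1) + sdegSum Y₃)).negOnePow •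
            (S.b (Y₁ ++ F Y₂ :: (Y₃ ++ S.b (P ++ G Q :: R) :: Y₅))).val)) Y₄) w := by
      rw [← sumSplit5_regroup_four (fun Y₁ Y₂ Y₃ P Q R Y₅ =>
          -((e Y₁ Y₂ (Y₃ ++ P) + (sdegSum Y₁ + (sdegSum Y₂ + p - 1) + sdegSum Y₃)).negOnePow •
            (S.b (Y₁ ++ F Y₂ :: (Y₃ ++ S.b (P ++ G Q :: R) :: Y₅))).val))]
      simp only [hA₃, smul_sumSplit, smul_smul, ← Int.negOnePow_add, ← sumSplit_neg]
      refine sumSplit5_congr fun X₁ X₂ X₃ X₄ X₅ _ => sumSplit_congr fun U₁ U₂ hX =>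
        sumSplit_congr fun V₁ V₂ _ => ?_
      rw [hX]
    rw [h1, sub_eq_add_neg, ← sumSplit5_neg, ← sumSplit5_add, cup, smul_sumSplit5]
    refine sumSplit5_congr fun X₁ X₂ X₃ X₄ X₅ _ => ?_
    have h2 := S.b_deltaA (X₁ ++ F X₂ :: X₃) X₅ q g X₄
    simp only [List.append_assoc, List.cons_append] at h2
    rw [h2, smul_smul, ← Int.negOnePow_add, smul_sub, sub_eq_add_neg, smul_sumSplit3]
    congr 1
    · refine sumSplit3_congr fun P Q R _ => ?_
      rw [smul_smul, ← Int.negOnePow_add, ← negOnePow_smul_neg]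
      simp only [he, sdegSum_append]
      push_cast
      grind [=_ zmod_two_mul_self]
    · rw [smul_smul, ← Int.negOnePow_add]
      simp only [hE₄]
      congr 2
      apply negOnePow_congr
      simp only [he]
      push_cast
      grind [=_ zmod_two_mul_self]
  rw [deltaA, hL1, hL2, hL3, hR1, hR2, sub_eq_add_neg, sub_eq_add_neg, sub_eq_add_neg]
  simp only [← sumSplit5_neg, ← sumSplit5_add]
  refine sumSplit5_congr fun X₁ X₂ X₃ X₄ X₅ _ => ?_
  have h := congrArg (fun x => (e X₁ X₂ X₃).negOnePow • x) (hS X₁ X₂ X₃ X₄ X₅)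
  simp only [smul_add, smul_zero] at h ⊢
  rw [← sub_eq_zero, ← h]
  abel

end Leibniz

end CyclicAInfinityAlgebra

end StringBracket

end

/-! ### The bracket on negative cyclic cohomology. -/

noncomputable section

namespace StringBracket

/-- A bilinear map on sources of total linear relations. -/
lemma exists_bilinear_of_relations {𝕜 V W V' W' U : Type*} [Field 𝕜] [AddCommGroup V] [Module 𝕜 V]
    [AddCommGroup W] [Module 𝕜 W] [AddCommGroup V'] [Module 𝕜 V'] [AddCommGroup W'] [Module 𝕜 W']
    [AddCommGroup U] [Module 𝕜 U] (R : Submodule 𝕜 (V × W)) (R' : Submodule 𝕜 (V' × W'))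
    (hR : ∀ v, ∃ w, (v, w) ∈ R) (hR' : ∀ v, ∃ w, (v, w) ∈ R') (B : W →ₗ[𝕜] W' →ₗ[𝕜] U)
    (h : ∀ w w', (0, w) ∈ R → B w w' = 0) (h' : ∀ w w', (0, w') ∈ R' → B w w' = 0) :
    ∃ β : V →ₗ[𝕜] V' →ₗ[𝕜] U, ∀ v w v' w', (v, w) ∈ R → (v', w') ∈ R' → β v v' = B w w' := by
  choose s hs using hR
  choose s' hs' using hR'
  -- Two values at one point differ by a value at `0`, which `B` kills. So the choice `s` does not
  -- matter, and although `s` need not be linear, the result is bilinear because `R` is a subspace.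
  have key : ∀ v w w₂ w', (v, w) ∈ R → (v, w₂) ∈ R → B w w' = B w₂ w' := by
    intro v w w₂ w' h1 h2
    have := h (w - w₂) w' (by simpa using R.sub_mem h1 h2)
    rwa [map_sub, LinearMap.sub_apply, sub_eq_zero] at this
  have key' : ∀ v w w₂ w', (v, w) ∈ R' → (v, w₂) ∈ R' → B w' w = B w' w₂ := by
    intro v w w₂ w' h1 h2
    have := h' w' (w - w₂) (by simpa using R'.sub_mem h1 h2)
    rwa [map_sub, sub_eq_zero] at this
  refine ⟨LinearMap.mk₂ 𝕜 (fun v v' => B (s v) (s' v')) ?_ ?_ ?_ ?_, ?_⟩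
  · intro v₁ v₂ v'
    rw [← LinearMap.add_apply, ← map_add]
    exact key _ _ _ _ (hs _) (R.add_mem (hs v₁) (hs v₂))
  · intro c v v'
    rw [← LinearMap.smul_apply, ← map_smul]
    exact key _ _ _ _ (hs _) (R.smul_mem c (hs v))
  · intro v v₁ v₂
    rw [← map_add]
    exact key' _ _ _ _ (hs' _) (R'.add_mem (hs' v₁) (hs' v₂))
  · intro c v v'
    rw [← map_smul]
    exact key' _ _ _ _ (hs' _) (R'.smul_mem c (hs' v'))
  · intro v w v' w' h1 h2
    rw [LinearMap.mk₂_apply, key _ _ _ _ (hs v) h1, key' _ _ _ _ (hs' v') h2]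

section

variable {𝕜 A : Type*} [RCLike 𝕜] [AddCommGroup A] [Module 𝕜 A] {𝒜 : ℤ → Submodule 𝕜 A}
variable {M : Type*} [AddCommGroup M] [Module 𝕜 M]

lemma isMultilinear_sumSplit_param {β : Type*} {G : List (Homog 𝒜) → List β → List β → M}
    (v : List β) (h : ∀ X Z, IsMultilinear (𝕜 := 𝕜) fun P => G P X Z) :
    IsMultilinear (𝕜 := 𝕜) fun P => sumSplit (G P) v := by
  intro l r i c x y
  rw [smul_sumSplit, ← sumSplit_add]
  exact sumSplit_congr fun X Z _ => h X Z l r i c x y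

lemma isMultilinear_sumSplit5
    {F : List (Homog 𝒜) → List (Homog 𝒜) → List (Homog 𝒜) → List (Homog 𝒜) → List (Homog 𝒜) → M}
    (h₁ : ∀ X₂ X₃ X₄ X₅, IsMultilinear (𝕜 := 𝕜) fun P => F P X₂ X₃ X₄ X₅)
    (h₂ : ∀ X₁ X₃ X₄ X₅, IsMultilinear (𝕜 := 𝕜) fun P => F X₁ P X₃ X₄ X₅)
    (h₃ : ∀ X₁ X₂ X₄ X₅, IsMultilinear (𝕜 := 𝕜) fun P => F X₁ X₂ P X₄ X₅)
    (h₄ : ∀ X₁ X₂ X₃ X₅, IsMultilinear (𝕜 := 𝕜) fun P => F X₁ X₂ X₃ P X₅)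
    (h₅ : ∀ X₁ X₂ X₃ X₄, IsMultilinear (𝕜 := 𝕜) fun P => F X₁ X₂ X₃ X₄ P) :
    IsMultilinear (𝕜 := 𝕜) (sumSplit5 F) := by
  refine isMultilinear_sumSplit (fun X₁ => isMultilinear_sumSplit (fun X₂ =>
    isMultilinear_sumSplit (fun X₃ => isMultilinear_sumSplit (fun X₄ => h₅ X₁ X₂ X₃ X₄)
    fun X₅ => h₄ X₁ X₂ X₃ X₅) fun R₃ => ?_) fun R₂ => ?_) fun R₁ => ?_
  · exact isMultilinear_sumSplit_param _ fun X₄ X₅ => h₃ X₁ X₂ X₄ X₅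
  · exact isMultilinear_sumSplit_param _ fun X₃ R₃ => isMultilinear_sumSplit_param _
      fun X₄ X₅ => h₂ X₁ X₃ X₄ X₅
  · exact isMultilinear_sumSplit_param _ fun X₂ R₂ => isMultilinear_sumSplit_param _
      fun X₃ R₃ => isMultilinear_sumSplit_param _ fun X₄ X₅ => h₁ X₂ X₃ X₄ X₅

lemma sumSplit_mem {α : Type*} (K : Submodule 𝕜 M) {F : List α → List α → M} {w : List α}
    (h : ∀ X Z, w = X ++ Z → F X Z ∈ K) : sumSplit F w ∈ K :=
  Submodule.sum_mem _ fun r _ => h _ _ (List.take_append_drop r w).symm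

end

namespace CyclicAInfinityAlgebra

variable {𝕜 A : Type*} [RCLike 𝕜] [AddCommGroup A] [Module 𝕜 A] {𝒜 : ℤ → Submodule 𝕜 A}
  (S : CyclicAInfinityAlgebra 𝕜 𝒜)

/-- The map `ω_♯` as a linear map. -/
def sharpL : (List (Homog 𝒜) → A) →ₗ[𝕜] (Homog 𝒜 → List (Homog 𝒜) → 𝕜) where
  toFun := S.sharp
  map_add' f g := by
    funext a w
    have : S.ω (f w + g w) a.val = S.ω (f w) a.val + S.ω (g w) a.val :=
      S.ωL.map_add₂ (f w) (g w) a.val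
    simp [sharp, this, smul_add]
  map_smul' c f := by
    funext a w
    have : S.ω (c • f w) a.val = c • S.ω (f w) a.val := S.ωL.map_smul₂ c (f w) a.val
    simp only [sharp, Pi.smul_apply, this, sign_smul_comm, RingHom.id_apply]

@[simp] lemma sharpL_apply (f : List (Homog 𝒜) → A) : S.sharpL f = S.sharp f := rfl

lemma incl_mem_negCyclic {k : ℤ} {φ : Homog 𝒜 → List (Homog 𝒜) → 𝕜} (hφ : φ ∈ S.hochDual k) :
    incl φ ∈ S.negCyclic k := by
  refine ⟨fun i => ?_, 0, fun i hi => ?_⟩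
  · cases i with
    | zero => simpa [incl] using hφ
    | succ i => simp [incl]
  · rw [incl, Pi.single_eq_of_ne (by omega)]

/-- This reflects `v · v^0 = 0`: the `B^*` part of component `i` comes from component `i + 1`, which
is zero here. -/
lemma dNeg_incl (φ : Homog 𝒜 → List (Homog 𝒜) → 𝕜) : S.dNeg (incl φ) = incl (S.deltaDual φ) := by
  funext i
  change S.deltaDual (incl φ i) + S.connesDual (incl φ (i + 1)) = incl (S.deltaDual φ) i
  cases i with
  | zero => simp [incl]
  | succ i => simp [incl]

lemma HC.mk_eq_zero {k : ℤ} (α : S.negCocycle k) : HC.mk S α = 0 ↔ α.1 ∈ S.negCoboundary k := by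
  rw [HC.mk, Submodule.Quotient.mk_eq_zero]
  rfl

section Cup

variable [DirectSum.Decomposition 𝒜]

lemma isMultilinear_bSlot {p : ℤ} {f : List (Homog 𝒜) → A} (hf : IsMultilinear (𝕜 := 𝕜) f)
    (l r : List (Homog 𝒜)) : IsMultilinear (𝕜 := 𝕜) fun w =>
      (S.b (l ++ Homog.comp (sdegSum w + p) (f w) :: r)).val := by
  intro l' r' i c x y
  have h1 := sdegSum_congr (v := l' ++ Homog.of (c • x + y) :: r')
    (w := l' ++ Homog.of x :: r') (by simp)
  have h2 := sdegSum_congr (v := l' ++ Homog.of y :: r') (w := l' ++ Homog.of x :: r') (by simp)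
  simp only [h1, h2, ← bSlot_apply, hf l' r' i c x y, map_add, map_smul]

lemma cup_mem {p q : ℤ} {f g : List (Homog 𝒜) → A} (hf : f ∈ S.hochA p) (hg : g ∈ S.hochA q) :
    S.cup p q f g ∈ S.hochA (p + q) := by
  obtain ⟨hf1, hf2, hf3, Nf, hNf⟩ := hf
  obtain ⟨hg1, hg2, hg3, Ng, hNg⟩ := hg
  obtain ⟨Nb, hNb⟩ := S.b_bounded
  have hz : ∀ l r d, (S.b (l ++ Homog.comp d (0 : A) :: r)).val = 0 := fun l r d =>
    map_zero (S.bSlot l r d)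
  have hz' : ∀ l r d (a : Homog 𝒜) l', (S.b (l ++ a :: (l' ++ Homog.comp d (0 : A) :: r))).val = 0 := by
    intro l r d a l'
    simpa using hz (l ++ a :: l') r d
  -- If `X₂` and `X₄` are within the bounds of `f` and `g`, then a word longer than this leaves more
  -- than `Nb` outer letters for `b`.
  refine ⟨?_, fun l r => ?_, fun w => ?_, Nb + Nf + Ng, fun w hw => ?_⟩
  · refine isMultilinear_sumSplit5 (fun X₂ X₃ X₄ X₅ => ?_) (fun X₁ X₃ X₄ X₅ => ?_)
      (fun X₁ X₂ X₄ X₅ => ?_) (fun X₁ X₂ X₃ X₅ => ?_) (fun X₁ X₂ X₃ X₄ => ?_)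
    · refine IsMultilinear.units_smul_left (f := fun P => (S.b (P ++ _)).val) ?_ _ ?_
      · intro l r i c x y
        simpa using S.isMultilinear_b l (r ++ Homog.comp (sdegSum X₂ + p) (f X₂) ::
          (X₃ ++ Homog.comp (sdegSum X₄ + q) (g X₄) :: X₅)) i c x y
      · intro v w h
        rw [sdegSum_congr h]
    · refine IsMultilinear.units_smul_left (f := fun P => (S.b (X₁ ++ Homog.comp (sdegSum P + p)
        (f P) :: _)).val) ?_ _ ?_
      · exact S.isMultilinear_bSlot hf1 _ _
      · intro v w h
        rw [sdegSum_congr h]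
    · refine IsMultilinear.units_smul_left (f := fun P => (S.b (X₁ ++ _ :: (P ++ _))).val) ?_ _ ?_
      · intro l r i c x y
        simpa using S.isMultilinear_b (X₁ ++ Homog.comp (sdegSum X₂ + p) (f X₂) :: l)
          (r ++ Homog.comp (sdegSum X₄ + q) (g X₄) :: X₅) i c x y
      · intro v w h
        rw [sdegSum_congr h]
    · refine IsMultilinear.units_smul_left (f := fun P => (S.b (X₁ ++ _ :: (X₃ ++
        Homog.comp (sdegSum P + q) (g P) :: _))).val) ?_ _ ?_
      · simpa using S.isMultilinear_bSlot (p := q) hg1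
          (X₁ ++ Homog.comp (sdegSum X₂ + p) (f X₂) :: X₃) X₅
      · intro v w h
        rfl
    · refine IsMultilinear.units_smul_left (f := fun P => (S.b (X₁ ++ _ :: (X₃ ++
        _ :: P))).val) ?_ _ ?_
      · intro l r i c x y
        simpa using S.isMultilinear_b (X₁ ++ Homog.comp (sdegSum X₂ + p) (f X₂) ::
          (X₃ ++ Homog.comp (sdegSum X₄ + q) (g X₄) :: l)) r i c x y
      · intro v w h
        rfl
  · refine sumSplit5_zero fun X₁ X₂ X₃ X₄ X₅ hw => ?_
    have hu : S.unit ∈ X₁ ++ (X₂ ++ (X₃ ++ (X₄ ++ X₅))) := by rw [← hw]; simp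
    simp only [List.mem_append] at hu
    -- A unit in `X₁`, `X₃` or `X₅` forms, with the values of `f` and `g`, a word of at least three
    -- letters, so `hb` applies. A unit in `X₂` or `X₄` is an argument of `f` or `g`.
    have hb : ∀ u : List (Homog 𝒜), S.unit ∈ u → u.length ≠ 2 → (S.b u).val = 0 := by
      intro u hu h2
      obtain ⟨s, t, rfl⟩ := List.append_of_mem hu
      exact S.evalWord_unit s t rfl h2
    rcases hu with h | h | h | h | h
    · rw [hb, smul_zero]
      · simp [h]
      · have := List.length_pos_of_mem h
        simp; omega
    · obtain ⟨s, t, rfl⟩ := List.append_of_mem h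
      rw [hf2, hz, smul_zero]
    · rw [hb, smul_zero]
      · simp [h]
      · have := List.length_pos_of_mem h
        simp; omega
    · obtain ⟨s, t, rfl⟩ := List.append_of_mem h
      rw [hg2, hz', smul_zero]
    · rw [hb, smul_zero]
      · simp [h]
      · have := List.length_pos_of_mem h
        simp; omega
  · have : ∀ (u : ℤˣ) (x : A) (d : ℤ), x ∈ 𝒜 d → u • x ∈ 𝒜 d := by
      intro u x d h
      rcases Int.units_eq_one_or u with rfl | rfl <;> simpa using h
    rw [cup, sumSplit5]
    refine sumSplit_mem _ fun X₁ R₁ h₁ => sumSplit_mem _ fun X₂ R₂ h₂ =>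
      sumSplit_mem _ fun X₃ R₃ h₃ => sumSplit_mem _ fun X₄ X₅ h₄ => this _ _ _ ?_
    convert (S.b _).mem using 2
    rw [h₁, h₂, h₃, h₄]
    simp only [deg_b, sdegSum_append, sdegSum_cons, Homog.sdeg_comp]
    ring
  · refine sumSplit5_zero fun X₁ X₂ X₃ X₄ X₅ h => ?_
    have hl := congrArg List.length h
    simp only [List.length_append] at hl
    by_cases h2 : Nf < X₂.length
    · rw [hNf _ h2, hz, smul_zero]
    by_cases h4 : Ng < X₄.length
    · rw [hNg _ h4, hz', smul_zero]
    rw [hNb, smul_zero]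
    simp
    omega

lemma cup_add_smul_left (p q : ℤ) (c : 𝕜) (f f' g : List (Homog 𝒜) → A) :
    S.cup p q (c • f + f') g = c • S.cup p q f g + S.cup p q f' g := by
  funext w
  rw [Pi.add_apply, Pi.smul_apply, cup, cup, cup, smul_sumSplit5, ← sumSplit5_add]
  refine sumSplit5_congr fun X₁ X₂ X₃ X₄ X₅ _ => ?_
  simp only [← bSlot_apply, Pi.add_apply, Pi.smul_apply, map_add, map_smul, smul_add,
    sign_smul_comm]

lemma cup_add_smul_right (p q : ℤ) (c : 𝕜) (f g g' : List (Homog 𝒜) → A) :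
    S.cup p q f (c • g + g') = c • S.cup p q f g + S.cup p q f g' := by
  funext w
  rw [Pi.add_apply, Pi.smul_apply, cup, cup, cup, smul_sumSplit5, ← sumSplit5_add]
  refine sumSplit5_congr fun X₁ X₂ X₃ X₄ X₅ _ => ?_
  have e : ∀ g : List (Homog 𝒜) → A,
      (S.b (X₁ ++ Homog.comp (sdegSum X₂ + p) (f X₂) ::
        (X₃ ++ Homog.comp (sdegSum X₄ + q) (g X₄) :: X₅))).val =
      S.bSlot (X₁ ++ Homog.comp (sdegSum X₂ + p) (f X₂) :: X₃) X₅ (sdegSum X₄ + q) (g X₄) := by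
    intro g
    rw [bSlot_apply, List.append_assoc, List.cons_append]
  rw [e (c • g + g'), e g, e g']
  simp only [Pi.add_apply, Pi.smul_apply, map_add, map_smul, smul_add, sign_smul_comm]

/-- The cup product as a bilinear map. -/
def cupL (p q : ℤ) : (List (Homog 𝒜) → A) →ₗ[𝕜] (List (Homog 𝒜) → A) →ₗ[𝕜]
    (List (Homog 𝒜) → A) :=
  LinearMap.mk₂ 𝕜 (S.cup p q)
    (fun f f' g => by simpa using S.cup_add_smul_left p q 1 f f' g)
    (fun c f g => by
      have h0 : S.cup p q 0 g = 0 := by simpa using S.cup_add_smul_left p q (-1) 0 0 g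
      simpa [h0] using S.cup_add_smul_left p q c f 0 g)
    (fun f g g' => by simpa using S.cup_add_smul_right p q 1 f g g')
    (fun c f g => by
      have h0 : S.cup p q f 0 = 0 := by simpa using S.cup_add_smul_right p q (-1) f 0 0
      simpa [h0] using S.cup_add_smul_right p q c f g 0)

@[simp] lemma cupL_apply (p q : ℤ) (f g : List (Homog 𝒜) → A) :
    S.cupL p q f g = S.cup p q f g := rfl

/-- The differential of `C̄^•(A, A)` as a linear map. -/
def deltaAL (p : ℤ) : (List (Homog 𝒜) → A) →ₗ[𝕜] (List (Homog 𝒜) → A) where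
  toFun := S.deltaA p
  map_add' f g := by
    funext w
    simp only [deltaA, ← bSlot_apply, Pi.add_apply, map_add, smul_add, sumSplit3_add]
    abel
  map_smul' c f := by
    funext w
    simp only [deltaA, ← bSlot_apply, Pi.smul_apply, map_smul, sign_smul_comm, smul_sub,
      smul_sumSplit3, RingHom.id_apply]

@[simp] lemma deltaAL_apply (p : ℤ) (f : List (Homog 𝒜) → A) :
    S.deltaAL p f = S.deltaA p f := rfl

/-- The cocycles of `C̄^•(A, A)` in degree `p`. -/
def cocycleA (p : ℤ) : Submodule 𝕜 (List (Homog 𝒜) → A) :=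
  S.hochA p ⊓ LinearMap.ker (S.deltaAL p)

lemma deltaA_cup_cocycle {p q : ℤ} {f g : List (Homog 𝒜) → A} (hf : S.deltaA p f = 0)
    (hg : S.deltaA q g = 0) : S.deltaA (p + q) (S.cup p q f g) = 0 := by
  funext w
  rw [deltaA_cup, hf, hg]
  have h1 : S.cup (p + 1) q 0 g = 0 := (S.cupL (p + 1) q).map_zero₂ g
  have h2 : S.cup p (q + 1) f 0 = 0 := map_zero (S.cupL p (q + 1) f)
  simp [h1, h2]

/-! ## The bracket on negative cyclic cohomology -/

lemma incl_sharp_cup_mem {m n : ℤ} {f g : List (Homog 𝒜) → A} (hf : f ∈ S.cocycleA (1 - 2 * m))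
    (hg : g ∈ S.cocycleA (1 - 2 * n)) :
    incl (S.sharp (S.cup (1 - 2 * m) (1 - 2 * n) f g)) ∈ S.negCocycle (2 * (m + n)) := by
  have hc := S.cup_mem hf.1 hg.1
  refine ⟨S.incl_mem_negCyclic ?_, ?_⟩
  · convert S.sharp_mem hc using 2
    ring
  · change S.dNeg _ = 0
    rw [dNeg_incl, sharp_deltaDual S hc,
      S.deltaA_cup_cocycle (LinearMap.mem_ker.1 hf.2) (LinearMap.mem_ker.1 hg.2)]
    have : S.sharp 0 = 0 := map_zero S.sharpL
    rw [this, smul_zero]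
    funext i
    cases i <;> simp [incl]

/-- By `sharp_deltaDual` the cochain `ω_♯ δ c` is `δ^*` of `± ω_♯ c`, and `incl` commutes with the
differentials. -/
lemma incl_sharp_mem_negCoboundary {k : ℤ} {c : List (Homog 𝒜) → A} (hc : c ∈ S.hochA (1 - k)) :
    incl (S.sharp (S.deltaA (1 - k) c)) ∈ S.negCoboundary k := by
  have h := S.sharp_deltaDual hc
  have h' : S.sharp (S.deltaA (1 - k) c) = S.deltaDual ((1 - k + 1).negOnePow • S.sharp c) := by
    rw [map_units_smul, h, smul_smul, Int.units_mul_self, one_smul]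
  refine ⟨incl ((1 - k + 1).negOnePow • S.sharp c), S.incl_mem_negCyclic ?_, ?_⟩
  · have := S.sharp_mem hc
    rw [show 2 - (1 - k) = k + 1 by ring] at this
    rcases Int.units_eq_one_or (1 - k + 1).negOnePow with h | h <;> rw [h] <;> simpa using this
  · rw [dNeg_incl, h']

/-- The class of `ω_♯(f ∪ g)` in negative cyclic cohomology, for cocycles `f` and `g`. -/
def cupClass (m n : ℤ) : S.cocycleA (1 - 2 * m) →ₗ[𝕜] S.cocycleA (1 - 2 * n) →ₗ[𝕜]
    S.HC (2 * (m + n)) :=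
  LinearMap.mk₂ 𝕜 (fun f g => HC.mk S ⟨_, S.incl_sharp_cup_mem f.2 g.2⟩)
    (fun f f' g => by
      refine congrArg (HC.mk S) (Subtype.ext ?_)
      simp only [← cupL_apply, ← sharpL_apply, Submodule.coe_add, map_add, LinearMap.add_apply]
      exact Pi.single_add 0 _ _)
    (fun c f g => by
      refine congrArg (HC.mk S) (Subtype.ext ?_)
      simp only [← cupL_apply, ← sharpL_apply, Submodule.coe_smul, map_smul, LinearMap.smul_apply]
      exact Pi.single_smul 0 c _)
    (fun f g g' => by
      refine congrArg (HC.mk S) (Subtype.ext ?_)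
      simp only [← cupL_apply, ← sharpL_apply, Submodule.coe_add, map_add]
      exact Pi.single_add 0 _ _)
    (fun c f g => by
      refine congrArg (HC.mk S) (Subtype.ext ?_)
      simp only [← cupL_apply, ← sharpL_apply, Submodule.coe_smul, map_smul]
      exact Pi.single_smul 0 c _)

lemma cupClass_apply {m n : ℤ} (f : S.cocycleA (1 - 2 * m)) (g : S.cocycleA (1 - 2 * n)) :
    S.cupClass m n f g = HC.mk S ⟨_, S.incl_sharp_cup_mem f.2 g.2⟩ := rfl

/-- The relation between classes in negative cyclic cohomology and their representing Hochschild
cocycles. -/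
def represents (m : ℤ) : Submodule 𝕜 (S.HC (2 * m) × S.cocycleA (1 - 2 * m)) where
  carrier := {x | ∃ α : S.negCocycle (2 * m), HC.mk S α = x.1 ∧ S.Represents m α x.2}
  zero_mem' := ⟨0, rfl, Submodule.zero_mem _, map_zero (S.deltaAL _), 0, Submodule.zero_mem _, by
    have : S.sharp 0 = 0 := map_zero S.sharpL
    simp [this]⟩
  add_mem' := by
    rintro ⟨x, f⟩ ⟨y, g⟩ ⟨α, rfl, hf, hf', γ, hγ, h⟩ ⟨β, rfl, hg, hg', γ', hγ', h'⟩
    refine ⟨α + β, rfl, Submodule.add_mem _ hf hg, LinearMap.mem_ker.1 (f + g).2.2, γ + γ',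
      Submodule.add_mem _ hγ hγ', ?_⟩
    change S.connesDual (α.1 0 + β.1 0) = S.sharpL (f.1 + g.1) + _
    rw [map_add, map_add, map_add, h, h', sharpL_apply, sharpL_apply]
    abel
  smul_mem' := by
    rintro c ⟨x, f⟩ ⟨α, rfl, hf, hf', γ, hγ, h⟩
    refine ⟨c • α, rfl, Submodule.smul_mem _ _ hf, LinearMap.mem_ker.1 (c • f).2.2, c • γ,
      Submodule.smul_mem _ _ hγ, ?_⟩
    change S.connesDual (c • α.1 0) = S.sharpL (c • f.1) + _
    rw [map_smul, map_smul, map_smul, h, sharpL_apply, smul_add]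

variable {S}

/-- The cocycle equation gives `δ^* α₀ = -B^* α₁`, hence `δ^* B^* α₀ = -B^* δ^* α₀ = B^* B^* α₁ =
0`. Surjectivity of `ω_♯` on cohomology then provides `f`. -/
lemma exists_represents (hHH : S.SharpIsIso) {m : ℤ} (α : S.negCocycle (2 * m)) :
    ∃ f, S.Represents m α f := by
  obtain ⟨α, hα, hα'⟩ := α
  have h0 : α 0 ∈ S.hochDual (2 * m) := by simpa using hα.1 0
  have hd : S.deltaDual (α 0) = - S.connesDual (α 1) := by
    have := congrFun (LinearMap.mem_ker.1 hα') 0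
    exact eq_neg_of_add_eq_zero_left this
  have hc : S.deltaDual (S.connesDual (α 0)) = 0 := by
    rw [S.deltaDual_connesDual h0, hd, map_neg, S.connesDual_connesDual (hα.1 1)]
    simp
  have hm : S.connesDual (α 0) ∈ S.hochDual (2 - (1 - 2 * m)) := by
    convert S.connesDual_mem h0 using 2
    ring
  obtain ⟨f, hf, hf', φ, hφ, h⟩ := (hHH (1 - 2 * m)).2 _ hm hc
  refine ⟨f, hf, hf', φ, ?_, h⟩
  convert hφ using 2
  ring

/-- If `α` is the coboundary of `β`, then `B^* α₀ = -δ^* B^* β₀`. So `ω_♯ f` is exact, and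
injectivity of `ω_♯` on cohomology applies. -/
lemma exact_of_represents_zero (hHH : S.SharpIsIso) {m : ℤ} {f : S.cocycleA (1 - 2 * m)}
    (h : (0, f) ∈ S.represents m) : ∃ g ∈ S.hochA (1 - 2 * m - 1),
      f.1 = S.deltaA (1 - 2 * m - 1) g := by
  obtain ⟨α, hα, hf, hf', γ, hγ, e⟩ := h
  obtain ⟨β, hβ, hβ'⟩ := (HC.mk_eq_zero S α).1 hα
  have h0 : β 0 ∈ S.hochDual (2 * m + 1) := by simpa using hβ.1 0
  have hα0 : α.1 0 = S.deltaDual (β 0) + S.connesDual (β 1) := by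
    rw [← hβ']
    rfl
  have h1 : S.connesDual (α.1 0) = - S.deltaDual (S.connesDual (β 0)) := by
    rw [hα0, map_add, S.connesDual_connesDual (hβ.1 1), S.deltaDual_connesDual h0]
    simp
  refine (hHH (1 - 2 * m)).1 _ hf hf' ⟨- S.connesDual (β 0) - γ, ?_, ?_⟩
  · rw [show 3 - (1 - 2 * m) = 2 * m + 2 by ring]
    refine Submodule.sub_mem _ (Submodule.neg_mem _ ?_) hγ
    convert S.connesDual_mem h0 using 2
    ring
  · rw [map_sub, map_neg, ← h1, e]
    simp

/-- Since `g` is a cocycle, the Leibniz rule gives `δ c ∪ g = δ(c ∪ g)`. -/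
lemma cupClass_exact_left {m n : ℤ} (f : S.cocycleA (1 - 2 * m)) (g : S.cocycleA (1 - 2 * n))
    {c : List (Homog 𝒜) → A} (hc : c ∈ S.hochA (1 - 2 * m - 1))
    (h : f.1 = S.deltaA (1 - 2 * m - 1) c) : S.cupClass m n f g = 0 := by
  rw [cupClass_apply, HC.mk_eq_zero]
  have hm := S.cup_mem hc g.2.1
  have hcup : S.cup (1 - 2 * m) (1 - 2 * n) f.1 g.1 =
      S.deltaA (1 - 2 * m - 1 + (1 - 2 * n)) (S.cup (1 - 2 * m - 1) (1 - 2 * n) c g.1) := by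
    funext w
    have hz : S.cup (1 - 2 * m - 1) (1 - 2 * n + 1) c 0 = 0 := map_zero (S.cupL _ _ c)
    rw [deltaA_cup, show S.deltaA (1 - 2 * n) g.1 = 0 from LinearMap.mem_ker.1 g.2.2, hz, h,
      sub_add_cancel]
    simp
  have e : 1 - 2 * m - 1 + (1 - 2 * n) = 1 - 2 * (m + n) := by ring
  rw [e] at hm hcup
  simp only [hcup]
  exact S.incl_sharp_mem_negCoboundary hm

lemma cupClass_exact_right {m n : ℤ} (f : S.cocycleA (1 - 2 * m)) (g : S.cocycleA (1 - 2 * n))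
    {c : List (Homog 𝒜) → A} (hc : c ∈ S.hochA (1 - 2 * n - 1))
    (h : g.1 = S.deltaA (1 - 2 * n - 1) c) : S.cupClass m n f g = 0 := by
  rw [cupClass_apply, HC.mk_eq_zero]
  have hm := S.cup_mem f.2.1 hc
  have hcup : S.cup (1 - 2 * m) (1 - 2 * n) f.1 g.1 = (1 - 2 * m).negOnePow •
      S.deltaA (1 - 2 * m + (1 - 2 * n - 1)) (S.cup (1 - 2 * m) (1 - 2 * n - 1) f.1 c) := by
    funext w
    have hz : S.cup (1 - 2 * m + 1) (1 - 2 * n - 1) 0 c = 0 := (S.cupL _ _).map_zero₂ c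
    rw [Pi.smul_apply, deltaA_cup, show S.deltaA (1 - 2 * m) f.1 = 0 from LinearMap.mem_ker.1 f.2.2,
      hz, h, sub_add_cancel, Pi.zero_apply, zero_add, smul_smul, Int.units_mul_self, one_smul]
  have e : 1 - 2 * m + (1 - 2 * n - 1) = 1 - 2 * (m + n) := by ring
  rw [e, ← deltaAL_apply, ← map_units_smul] at hcup
  rw [e] at hm
  simp only [hcup]
  refine S.incl_sharp_mem_negCoboundary ?_
  rcases Int.units_eq_one_or (1 - 2 * m).negOnePow with h | h <;> rw [h] <;> simpa using hm

/-- The bracket of two homogeneous components of negative cyclic cohomology. -/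
lemma exists_bracket (hHH : S.SharpIsIso) (m n : ℤ) :
    ∃ β : S.HC (2 * m) →ₗ[𝕜] S.HC (2 * n) →ₗ[𝕜] S.HC (2 * (m + n)),
      ∀ x f y g, (x, f) ∈ S.represents m → (y, g) ∈ S.represents n →
        β x y = S.cupClass m n f g := by
  have htot : ∀ (m : ℤ) (x : S.HC (2 * m)), ∃ f, (x, f) ∈ S.represents m := by
    intro m x
    obtain ⟨α, rfl⟩ := Submodule.Quotient.mk_surjective _ x
    obtain ⟨f, hf⟩ := exists_represents hHH α
    exact ⟨⟨f, hf.1, hf.2.1⟩, α, rfl, hf⟩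
  refine exists_bilinear_of_relations _ _ (htot m) (htot n) (S.cupClass m n) ?_ ?_
  · intro f g h
    obtain ⟨c, hc, e⟩ := exact_of_represents_zero hHH h
    exact cupClass_exact_left f g hc e
  · intro f g h
    obtain ⟨c, hc, e⟩ := exact_of_represents_zero hHH h
    exact cupClass_exact_right f g hc e

lemma exists_isCyclicBracket (hHH : S.SharpIsIso) :
    ∃ br : S.HCeven →ₗ[𝕜] S.HCeven →ₗ[𝕜] S.HCeven, S.IsCyclicBracket br := by
  choose β hβ using fun m n => exists_bracket hHH m n
  refine ⟨DirectSum.toModule 𝕜 ℤ _ fun m => LinearMap.flip (DirectSum.toModule 𝕜 ℤ _ fun n =>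
    LinearMap.flip ((β m n).compr₂ (DirectSum.lof 𝕜 ℤ (fun m => S.HC (2 * m)) (m + n)))), ?_⟩
  intro m n α α'
  refine ⟨exists_represents hHH α, fun f g hf hg => ⟨S.incl_sharp_cup_mem ⟨hf.1, hf.2.1⟩
    ⟨hg.1, hg.2.1⟩, ?_⟩⟩
  have := hβ m n (HC.mk S α) ⟨f, hf.1, hf.2.1⟩ (HC.mk S α') ⟨g, hg.1, hg.2.1⟩ ⟨α, rfl, hf⟩
    ⟨α', rfl, hg⟩
  simp only [HCeven.mk, DirectSum.toModule_lof, LinearMap.flip_apply, LinearMap.compr₂_apply, this]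
  rfl

end Cup

end CyclicAInfinityAlgebra

end StringBracket

end

/-! ### Algebraic differential calculus, without a topology on the spaces. -/

noncomputable section

namespace StringBracket

/-! ## Calculus of polynomial maps -/

section PolyMap

variable {𝕜 V W W₁ W₂ W₃ : Type*} [RCLike 𝕜] [AddCommGroup V] [Module 𝕜 V] [AddCommGroup W]
  [Module 𝕜 W] [AddCommGroup W₁] [Module 𝕜 W₁] [AddCommGroup W₂] [Module 𝕜 W₂] [AddCommGroup W₃]
  [Module 𝕜 W₃]

lemma multilinear_mem_polyMap {n : ℕ} (p : MultilinearMap 𝕜 (fun _ : Fin n => V) W) :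
    (fun v => p fun _ => v) ∈ PolyMap 𝕜 V W :=
  Submodule.subset_span ⟨n, p, rfl⟩

lemma const_mem_polyMap (w : W) : (fun _ => w) ∈ PolyMap 𝕜 V W :=
  multilinear_mem_polyMap (MultilinearMap.constOfIsEmpty 𝕜 (fun _ : Fin 0 => V) w)

lemma linear_mem_polyMap (L : V →ₗ[𝕜] W) : (fun v => L v) ∈ PolyMap 𝕜 V W :=
  multilinear_mem_polyMap (MultilinearMap.ofSubsingleton 𝕜 V W (0 : Fin 1) L)

lemma id_mem_polyMap : (fun v => v) ∈ PolyMap 𝕜 V V :=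
  linear_mem_polyMap LinearMap.id

lemma linear_comp_mem_polyMap (L : W →ₗ[𝕜] W₁) {f : V → W} (hf : f ∈ PolyMap 𝕜 V W) :
    (fun v => L (f v)) ∈ PolyMap 𝕜 V W₁ := by
  induction hf using Submodule.span_induction with
  | mem f hf =>
    obtain ⟨n, p, rfl⟩ := hf
    exact multilinear_mem_polyMap (L.compMultilinearMap p)
  | zero => simpa using const_mem_polyMap (0 : W₁)
  | add f g _ _ hf hg =>
    simp only [Pi.add_apply, map_add]
    exact Submodule.add_mem _ hf hg
  | smul c f _ hf =>
    simp only [Pi.smul_apply, map_smul]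
    exact Submodule.smul_mem _ c hf

/-- Two multilinear maps combine under `B` to a map that is multilinear in the disjoint union of
their arguments. Special choices of `B` give the closure properties of `PolyMap` under products,
evaluation and composition of linear maps. -/
lemma bilinear_mem_polyMap (B : W₁ →ₗ[𝕜] W₂ →ₗ[𝕜] W₃) {f : V → W₁} {g : V → W₂}
    (hf : f ∈ PolyMap 𝕜 V W₁) (hg : g ∈ PolyMap 𝕜 V W₂) :
    (fun v => B (f v) (g v)) ∈ PolyMap 𝕜 V W₃ := by
  induction hf using Submodule.span_induction with
  | mem f hf =>
    obtain ⟨n, p, rfl⟩ := hf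
    induction hg using Submodule.span_induction with
    | mem g hg =>
      obtain ⟨m, q, rfl⟩ := hg
      have := multilinear_mem_polyMap (((TensorProduct.lift B).compMultilinearMap
        (p.domCoprod q)).domDomCongr finSumFinEquiv)
      simpa using this
    | zero => simpa using const_mem_polyMap (0 : W₃)
    | add f g _ _ hf hg =>
      simp only [Pi.add_apply, map_add]
      exact Submodule.add_mem _ hf hg
    | smul c f _ hf =>
      simp only [Pi.smul_apply, map_smul]
      exact Submodule.smul_mem _ c hf
  | zero => simpa using const_mem_polyMap (0 : W₃)
  | add f g _ _ hf hg =>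
    simp only [Pi.add_apply, map_add, LinearMap.add_apply]
    exact Submodule.add_mem _ hf hg
  | smul c f _ hf =>
    simp only [Pi.smul_apply, map_smul, LinearMap.smul_apply]
    exact Submodule.smul_mem _ c hf

lemma add_mem_polyMap {f g : V → W} (hf : f ∈ PolyMap 𝕜 V W) (hg : g ∈ PolyMap 𝕜 V W) :
    (fun v => f v + g v) ∈ PolyMap 𝕜 V W :=
  Submodule.add_mem _ hf hg

lemma sub_mem_polyMap {f g : V → W} (hf : f ∈ PolyMap 𝕜 V W) (hg : g ∈ PolyMap 𝕜 V W) :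
    (fun v => f v - g v) ∈ PolyMap 𝕜 V W :=
  Submodule.sub_mem _ hf hg

lemma neg_mem_polyMap {f : V → W} (hf : f ∈ PolyMap 𝕜 V W) :
    (fun v => - f v) ∈ PolyMap 𝕜 V W :=
  Submodule.neg_mem _ hf

lemma smul_mem_polyMap {f : V → 𝕜} {g : V → W} (hf : f ∈ PolyMap 𝕜 V 𝕜)
    (hg : g ∈ PolyMap 𝕜 V W) : (fun v => f v • g v) ∈ PolyMap 𝕜 V W :=
  bilinear_mem_polyMap (LinearMap.lsmul 𝕜 W) hf hg

lemma apply_mem_polyMap {f : V → W →ₗ[𝕜] W₁} {g : V → W} (hf : f ∈ PolyMap 𝕜 V (W →ₗ[𝕜] W₁))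
    (hg : g ∈ PolyMap 𝕜 V W) : (fun v => f v (g v)) ∈ PolyMap 𝕜 V W₁ :=
  bilinear_mem_polyMap LinearMap.id hf hg

lemma comp_mem_polyMap {f : V → W₁ →ₗ[𝕜] W₂} {g : V → W →ₗ[𝕜] W₁}
    (hf : f ∈ PolyMap 𝕜 V (W₁ →ₗ[𝕜] W₂)) (hg : g ∈ PolyMap 𝕜 V (W →ₗ[𝕜] W₁)) :
    (fun v => f v ∘ₗ g v) ∈ PolyMap 𝕜 V (W →ₗ[𝕜] W₂) :=
  bilinear_mem_polyMap (LinearMap.llcomp 𝕜 W W₁ W₂) hf hg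

lemma flip_mem_polyMap {f : V → W →ₗ[𝕜] W₁ →ₗ[𝕜] W₂}
    (hf : f ∈ PolyMap 𝕜 V (W →ₗ[𝕜] W₁ →ₗ[𝕜] W₂)) :
    (fun v => (f v).flip) ∈ PolyMap 𝕜 V (W₁ →ₗ[𝕜] W →ₗ[𝕜] W₂) :=
  linear_comp_mem_polyMap (LinearMap.lflip (R₀ := 𝕜)).toLinearMap hf

lemma sum_mem_polyMap {ι : Type*} (s : Finset ι) {f : ι → V → W}
    (hf : ∀ i ∈ s, f i ∈ PolyMap 𝕜 V W) : (fun v => ∑ i ∈ s, f i v) ∈ PolyMap 𝕜 V W := by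
  have := Submodule.sum_mem (PolyMap 𝕜 V W) hf
  convert this using 1
  funext v
  simp

/-- `f'` is the derivative of the polynomial map `f`. -/
def HasPolyDeriv (f : V → W) (f' : V → V →ₗ[𝕜] W) : Prop :=
  ∀ a Y, ∃ r ∈ PolyMap 𝕜 𝕜 W, ∀ t : 𝕜, f (a + t • Y) = f a + t • f' a Y + (t * t) • r t

lemma HasPolyDeriv.add {f g : V → W} {f' g' : V → V →ₗ[𝕜] W} (hf : HasPolyDeriv f f')
    (hg : HasPolyDeriv g g') : HasPolyDeriv (f + g) (f' + g') := by
  intro a Y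
  obtain ⟨r, hr, h⟩ := hf a Y
  obtain ⟨s, hs, h'⟩ := hg a Y
  refine ⟨r + s, Submodule.add_mem _ hr hs, fun t => ?_⟩
  simp only [Pi.add_apply, h t, h' t, LinearMap.add_apply, smul_add]
  abel

lemma HasPolyDeriv.linear_comp (L : W →ₗ[𝕜] W₁) {f : V → W} {f' : V → V →ₗ[𝕜] W}
    (hf : HasPolyDeriv f f') : HasPolyDeriv (fun v => L (f v)) (fun v => L ∘ₗ f' v) := by
  intro a Y
  obtain ⟨r, hr, h⟩ := hf a Y
  exact ⟨fun t => L (r t), linear_comp_mem_polyMap L hr, fun t => by simp [h t]⟩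

/-- The derivative of `B(f, g)`, for a bilinear map `B`. -/
def leibniz (B : W₁ →ₗ[𝕜] W₂ →ₗ[𝕜] W₃) (f : V → W₁) (g : V → W₂) (f' : V → V →ₗ[𝕜] W₁)
    (g' : V → V →ₗ[𝕜] W₂) : V → V →ₗ[𝕜] W₃ :=
  fun a => B.flip (g a) ∘ₗ f' a + B (f a) ∘ₗ g' a

lemma leibniz_apply (B : W₁ →ₗ[𝕜] W₂ →ₗ[𝕜] W₃) (f : V → W₁) (g : V → W₂) (f' : V → V →ₗ[𝕜] W₁)
    (g' : V → V →ₗ[𝕜] W₂) (a Y : V) :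
    leibniz B f g f' g' a Y = B (f' a Y) (g a) + B (f a) (g' a Y) := rfl

lemma leibniz_mem_polyMap (B : W₁ →ₗ[𝕜] W₂ →ₗ[𝕜] W₃) {f : V → W₁} {g : V → W₂}
    {f' : V → V →ₗ[𝕜] W₁} {g' : V → V →ₗ[𝕜] W₂} (hf : f ∈ PolyMap 𝕜 V W₁)
    (hg : g ∈ PolyMap 𝕜 V W₂) (hf' : f' ∈ PolyMap 𝕜 V (V →ₗ[𝕜] W₁))
    (hg' : g' ∈ PolyMap 𝕜 V (V →ₗ[𝕜] W₂)) :
    leibniz B f g f' g' ∈ PolyMap 𝕜 V (V →ₗ[𝕜] W₃) :=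
  add_mem_polyMap (comp_mem_polyMap (linear_comp_mem_polyMap B.flip hg) hf')
    (comp_mem_polyMap (linear_comp_mem_polyMap B hf) hg')

lemma HasPolyDeriv.bilinear (B : W₁ →ₗ[𝕜] W₂ →ₗ[𝕜] W₃) {f : V → W₁} {g : V → W₂}
    {f' : V → V →ₗ[𝕜] W₁} {g' : V → V →ₗ[𝕜] W₂} (hf : HasPolyDeriv f f')
    (hg : HasPolyDeriv g g') :
    HasPolyDeriv (fun v => B (f v) (g v)) (leibniz B f g f' g') := by
  intro a Y
  obtain ⟨r, hr, h⟩ := hf a Y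
  obtain ⟨s, hs, h'⟩ := hg a Y
  -- The terms of order at least two in the product of the two expansions, divided by `t * t`.
  refine ⟨fun t => (B (f' a Y) (g' a Y) + B (f a) (s t) + B (r t) (g a)) +
    t • (B (f' a Y) (s t) + B (r t) (g' a Y)) + (t * t) • B (r t) (s t), ?_, fun t => ?_⟩
  · refine add_mem_polyMap (add_mem_polyMap (add_mem_polyMap (add_mem_polyMap
      (const_mem_polyMap _) ?_) ?_) (smul_mem_polyMap id_mem_polyMap (add_mem_polyMap ?_ ?_)))
      (smul_mem_polyMap (smul_mem_polyMap id_mem_polyMap id_mem_polyMap) ?_)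
    · exact bilinear_mem_polyMap B (const_mem_polyMap _) hs
    · exact bilinear_mem_polyMap B hr (const_mem_polyMap _)
    · exact bilinear_mem_polyMap B (const_mem_polyMap _) hs
    · exact bilinear_mem_polyMap B hr (const_mem_polyMap _)
    · exact bilinear_mem_polyMap B hr hs
  · simp only [h t, h' t, leibniz_apply, map_add, map_smul, LinearMap.add_apply,
      LinearMap.smul_apply]
    module

lemma dirDeriv_eq_of_hasPolyDeriv {ψ : V → 𝕜} {ψ' : V → V →ₗ[𝕜] 𝕜} (h : HasPolyDeriv ψ ψ')
    (a Y : V) : dirDeriv ψ a Y = ψ' a Y := by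
  obtain ⟨r, hr, h⟩ := h a Y
  have hd : Differentiable 𝕜 r := by
    have := differentiable_of_mem_polyMap hr 0 1
    simpa using this
  have e : (fun t : 𝕜 => ψ (a + t • Y)) = fun t => ψ a + t • ψ' a Y + (t * t) • r t := funext h
  rw [dirDeriv, e]
  have h1 : HasDerivAt (fun t : 𝕜 => ψ a + t • ψ' a Y + (t * t) • r t)
      (((1 : 𝕜) • ψ' a Y) + (((0 : 𝕜) * 0) • deriv r 0 + (1 * 0 + 0 * 1 : 𝕜) • r 0)) 0 := by
    refine HasDerivAt.add (HasDerivAt.const_add _ ((hasDerivAt_id (0 : 𝕜)).smul_const _)) ?_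
    exact ((hasDerivAt_id (0 : 𝕜)).mul (hasDerivAt_id (0 : 𝕜))).smul (hd 0).hasDerivAt
  rw [h1.deriv]
  simp

/-- Linear functionals separate points, and after composition with one of them both candidates
compute `dirDeriv`. Consequently an identity between polynomial maps may be differentiated on both
sides. -/
lemma HasPolyDeriv.unique {f : V → W} {f' g' : V → V →ₗ[𝕜] W} (hf : HasPolyDeriv f f')
    (hg : HasPolyDeriv f g') : f' = g' := by
  funext a
  ext Y
  rw [← sub_eq_zero, ← Module.forall_dual_apply_eq_zero_iff 𝕜]
  intro ℓ
  rw [map_sub, sub_eq_zero]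
  have h1 := dirDeriv_eq_of_hasPolyDeriv (hf.linear_comp ℓ) a Y
  have h2 := dirDeriv_eq_of_hasPolyDeriv (hg.linear_comp ℓ) a Y
  exact h1.symm.trans h2

/-- `f'` and `f''` are the first two derivatives of the polynomial map `f`. -/
structure IsPolyJet (f : V → W) (f' : V → V →ₗ[𝕜] W) (f'' : V → V →ₗ[𝕜] V →ₗ[𝕜] W) : Prop where
  mem : f ∈ PolyMap 𝕜 V W
  mem' : f' ∈ PolyMap 𝕜 V (V →ₗ[𝕜] W)
  mem'' : f'' ∈ PolyMap 𝕜 V (V →ₗ[𝕜] V →ₗ[𝕜] W)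
  deriv : HasPolyDeriv f f'
  deriv' : HasPolyDeriv f' f''
  symm : ∀ a Y Z, f'' a Y Z = f'' a Z Y

lemma isPolyJet_const (w : W) : IsPolyJet (𝕜 := 𝕜) (fun _ : V => w) 0 0 where
  mem := const_mem_polyMap w
  mem' := Submodule.zero_mem _
  mem'' := Submodule.zero_mem _
  deriv _ _ := ⟨0, Submodule.zero_mem _, fun t => by simp⟩
  deriv' _ _ := ⟨0, Submodule.zero_mem _, fun t => by simp⟩
  symm _ _ _ := rfl

lemma isPolyJet_id : IsPolyJet (𝕜 := 𝕜) (fun v : V => v) (fun _ => LinearMap.id) 0 where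
  mem := id_mem_polyMap
  mem' := const_mem_polyMap _
  mem'' := Submodule.zero_mem _
  deriv _ _ := ⟨0, Submodule.zero_mem _, fun t => by simp⟩
  deriv' _ _ := ⟨0, Submodule.zero_mem _, fun t => by simp⟩
  symm _ _ _ := rfl

lemma IsPolyJet.add {f g : V → W} {f' g' : V → V →ₗ[𝕜] W} {f'' g'' : V → V →ₗ[𝕜] V →ₗ[𝕜] W}
    (hf : IsPolyJet f f' f'') (hg : IsPolyJet g g' g'') :
    IsPolyJet (f + g) (f' + g') (f'' + g'') where
  mem := Submodule.add_mem _ hf.mem hg.mem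
  mem' := Submodule.add_mem _ hf.mem' hg.mem'
  mem'' := Submodule.add_mem _ hf.mem'' hg.mem''
  deriv := hf.deriv.add hg.deriv
  deriv' := hf.deriv'.add hg.deriv'
  symm a Y Z := by simp [hf.symm a Y Z, hg.symm a Y Z]

lemma IsPolyJet.linear_comp (L : W →ₗ[𝕜] W₁) {f : V → W} {f' : V → V →ₗ[𝕜] W}
    {f'' : V → V →ₗ[𝕜] V →ₗ[𝕜] W} (hf : IsPolyJet f f' f'') :
    IsPolyJet (fun v => L (f v)) (fun v => L ∘ₗ f' v)
      (fun v => (LinearMap.llcomp 𝕜 V W W₁ L) ∘ₗ f'' v) where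
  mem := linear_comp_mem_polyMap L hf.mem
  mem' := linear_comp_mem_polyMap (LinearMap.llcomp 𝕜 V W W₁ L) hf.mem'
  mem'' := comp_mem_polyMap (const_mem_polyMap _) hf.mem''
  deriv := hf.deriv.linear_comp L
  deriv' := hf.deriv'.linear_comp (LinearMap.llcomp 𝕜 V W W₁ L)
  symm a Y Z := by simp [hf.symm a Y Z]

lemma IsPolyJet.bilinear (B : W₁ →ₗ[𝕜] W₂ →ₗ[𝕜] W₃) {f : V → W₁} {g : V → W₂}
    {f' : V → V →ₗ[𝕜] W₁} {g' : V → V →ₗ[𝕜] W₂} {f'' : V → V →ₗ[𝕜] V →ₗ[𝕜] W₁}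
    {g'' : V → V →ₗ[𝕜] V →ₗ[𝕜] W₂} (hf : IsPolyJet f f' f'') (hg : IsPolyJet g g' g'') :
    ∃ h'', IsPolyJet (fun v => B (f v) (g v)) (leibniz B f g f' g') h'' := by
  -- The first derivative is a sum of bilinear expressions in `(g, f')` and in `(f, g')`, so the
  -- product rule applies to it once more.
  have e : leibniz B f g f' g' =
      (fun a => ((LinearMap.llcomp 𝕜 V W₁ W₃) ∘ₗ B.flip) (g a) (f' a)) +
      (fun a => ((LinearMap.llcomp 𝕜 V W₂ W₃) ∘ₗ B) (f a) (g' a)) := rfl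
  refine ⟨_, bilinear_mem_polyMap B hf.mem hg.mem,
    leibniz_mem_polyMap B hf.mem hg.mem hf.mem' hg.mem', Submodule.add_mem _
      (leibniz_mem_polyMap ((LinearMap.llcomp 𝕜 V W₁ W₃) ∘ₗ B.flip) hg.mem hf.mem' hg.mem' hf.mem'')
      (leibniz_mem_polyMap ((LinearMap.llcomp 𝕜 V W₂ W₃) ∘ₗ B) hf.mem hg.mem' hf.mem' hg.mem''),
    hf.deriv.bilinear B hg.deriv, ?_, ?_⟩
  · rw [e]
    exact (hg.deriv.bilinear _ hf.deriv').add (hf.deriv.bilinear _ hg.deriv')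
  · intro a Y Z
    simp only [Pi.add_apply, LinearMap.add_apply, leibniz_apply, LinearMap.comp_apply,
      LinearMap.llcomp_apply, LinearMap.flip_apply, hf.symm a Y Z, hg.symm a Y Z]
    abel

end PolyMap

section PolyJet

universe u v w

variable {𝕜 : Type w} {V : Type u} [RCLike 𝕜] [AddCommGroup V] [Module 𝕜 V]

/-- Separating the last argument presents `p(v, …, v)` as the value at `v` of a multilinear map with
one argument less and target `V →ₗ W`. The induction therefore changes the target, and the universe
`max u v` is stable under this change. -/
lemma exists_isPolyJet_multilinear (n : ℕ) : ∀ (W : Type max u v) [AddCommGroup W] [Module 𝕜 W]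
    (p : MultilinearMap 𝕜 (fun _ : Fin n => V) W),
      ∃ (f' : V → V →ₗ[𝕜] W) (f'' : V → V →ₗ[𝕜] V →ₗ[𝕜] W),
        IsPolyJet (fun v => p fun _ => v) f' f'' := by
  induction n with
  | zero =>
    intro W _ _ p
    refine ⟨0, 0, ?_⟩
    convert isPolyJet_const (p fun _ => 0) using 1
    funext v
    congr 1
    funext i
    exact i.elim0
  | succ n ih =>
    intro W _ _ p
    obtain ⟨f', f'', h⟩ := ih (V →ₗ[𝕜] W) p.curryRight
    obtain ⟨h'', H⟩ := h.bilinear LinearMap.id isPolyJet_id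
    have e : (fun v => LinearMap.id (R := 𝕜) (p.curryRight fun _ => v) v) =
        fun v => p fun _ => v := by
      funext v
      rw [LinearMap.id_apply, MultilinearMap.curryRight_apply]
      congr 1
      funext i
      refine Fin.lastCases ?_ (fun j => ?_) i <;> simp
    rw [e] at H
    exact ⟨_, h'', H⟩

lemma exists_isPolyJet {W : Type v} [AddCommGroup W] [Module 𝕜 W] {f : V → W}
    (hf : f ∈ PolyMap 𝕜 V W) : ∃ (f' : V → V →ₗ[𝕜] W) (f'' : V → V →ₗ[𝕜] V →ₗ[𝕜] W),
      IsPolyJet f f' f'' := by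
  induction hf using Submodule.span_induction with
  | mem f hf =>
    obtain ⟨n, p, rfl⟩ := hf
    -- The target is lifted to the universe of the induction; jets pass back along the linear
    -- projection.
    obtain ⟨f', f'', h⟩ := exists_isPolyJet_multilinear.{u, v, w} n (ULift.{u} W)
      ((ULift.moduleEquiv (R := 𝕜) (M := W)).symm.toLinearMap.compMultilinearMap p)
    exact ⟨_, _, h.linear_comp (ULift.moduleEquiv (R := 𝕜) (M := W)).toLinearMap⟩
  | zero => exact ⟨0, 0, isPolyJet_const 0⟩
  | add f g _ _ hf hg =>
    obtain ⟨f', f'', hf⟩ := hf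
    obtain ⟨g', g'', hg⟩ := hg
    exact ⟨_, _, hf.add hg⟩
  | smul c f _ hf =>
    obtain ⟨f', f'', hf⟩ := hf
    exact ⟨_, _, hf.linear_comp (c • LinearMap.id)⟩

end PolyJet

end StringBracket

end

/-! ### Sums over the words `a, …, a` as polynomial maps in `a`, and their derivatives. -/

noncomputable section

namespace StringBracket

/-!   · ext z
    have := hF l (r ++ Homog.of z :: X) i c x y
    simpa [IsMultilinear.letter] using this
 Sums over the powers of an element of degree one -/

section Tot

variable {𝕜 A M N : Type*} [RCLike 𝕜] [AddCommGroup A] [Module 𝕜 A] {𝒜 : ℤ → Submodule 𝕜 A}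
  [AddCommGroup M] [AddCommGroup N]

/-- `a ⊗ ⋯ ⊗ a`. -/
def pow (n : ℕ) (a : 𝒜 1) : List (Homog 𝒜) := List.replicate n (Homog.of a)

lemma pow_succ' (n : ℕ) (a : 𝒜 1) : pow (n + 1) a = Homog.of a :: pow n a := rfl

@[simp] lemma length_pow (n : ℕ) (a : 𝒜 1) : (pow n a).length = n := by simp [pow]

@[simp] lemma sdegSum_pow (n : ℕ) (a : 𝒜 1) : sdegSum (pow n a) = 0 := by
  simp [pow, sdegSum]

/-- A family of multilinear maps vanishes on long words. -/
def IsBounded {α M : Type*} [Zero M] (F : List α → M) : Prop :=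
  ∃ N : ℕ, ∀ w, N < w.length → F w = 0

/-- A family of functions of pairs of words vanishes on long words. -/
def IsBounded₂ {α M : Type*} [Zero M] (G : List α → List α → M) : Prop :=
  ∃ N : ℕ, ∀ X Z, N < X.length + Z.length → G X Z = 0

/-- `∑ F(a, …, a)`. -/
def tot (F : List (Homog 𝒜) → M) (a : 𝒜 1) : M := ∑ᶠ n : ℕ, F (pow n a)

lemma tot_eq_sum {F : List (Homog 𝒜) → M} {K : ℕ} (h : ∀ w, K < w.length → F w = 0) (a : 𝒜 1) :
    tot F a = ∑ n ∈ Finset.range (K + 1), F (pow n a) := by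
  refine finsum_eq_sum_of_support_subset _ fun n hn => ?_
  by_contra hlt
  refine hn (h _ ?_)
  simp at hlt
  simp
  omega

lemma IsBounded.support_finite {F : List (Homog 𝒜) → M} (h : IsBounded F) (a : 𝒜 1) :
    (Function.support fun n => F (pow n a)).Finite := by
  obtain ⟨K, hK⟩ := h
  refine (Finset.range (K + 1)).finite_toSet.subset fun n hn => ?_
  by_contra hlt
  refine hn (hK _ ?_)
  simp at hlt
  simp
  omega

lemma tot_congr {F G : List (Homog 𝒜) → M} {a : 𝒜 1} (h : ∀ n, F (pow n a) = G (pow n a)) :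
    tot F a = tot G a :=
  finsum_congr h

lemma tot_zero {F : List (Homog 𝒜) → M} {a : 𝒜 1} (h : ∀ n, F (pow n a) = 0) : tot F a = 0 :=
  (finsum_congr h).trans finsum_zero

lemma map_tot {H : Type*} [FunLike H M N] [AddMonoidHomClass H M N] (f : H)
    {F : List (Homog 𝒜) → M} (hF : IsBounded F) (a : 𝒜 1) :
    f (tot F a) = tot (fun w => f (F w)) a :=
  (f : M →+ N).map_finsum (hF.support_finite a)

lemma tot_add {F G : List (Homog 𝒜) → M} (hF : IsBounded F) (hG : IsBounded G) (a : 𝒜 1) :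
    tot (fun w => F w + G w) a = tot F a + tot G a :=
  finsum_add_distrib (hF.support_finite a) (hG.support_finite a)

lemma tot_sub {F G : List (Homog 𝒜) → M} (hF : IsBounded F) (hG : IsBounded G) (a : 𝒜 1) :
    tot (fun w => F w - G w) a = tot F a - tot G a :=
  finsum_sub_distrib (hF.support_finite a) (hG.support_finite a)

lemma IsBounded₂.left {G : List (Homog 𝒜) → List (Homog 𝒜) → M} (hG : IsBounded₂ G)
    (X : List (Homog 𝒜)) : IsBounded (G X) := by
  obtain ⟨K, hK⟩ := hG
  exact ⟨K, fun w hw => hK _ _ (by omega)⟩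

lemma IsBounded₂.tot {G : List (Homog 𝒜) → List (Homog 𝒜) → M} (hG : IsBounded₂ G) (a : 𝒜 1) :
    IsBounded (fun X => StringBracket.tot (G X) a) := by
  obtain ⟨K, hK⟩ := hG
  exact ⟨K, fun w hw => tot_zero fun n => hK _ _ (by omega)⟩

lemma IsBounded₂.sumSplit {G : List (Homog 𝒜) → List (Homog 𝒜) → M} (hG : IsBounded₂ G) :
    IsBounded (sumSplit G) := by
  obtain ⟨K, hK⟩ := hG
  exact ⟨K, fun w hw => sumSplit_zero fun X Z e => hK _ _ (by simpa [e] using hw)⟩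

lemma sumSplit_pow (G : List (Homog 𝒜) → List (Homog 𝒜) → M) (n : ℕ) (a : 𝒜 1) :
    sumSplit G (pow n a) = ∑ r ∈ Finset.range (n + 1), G (pow r a) (pow (n - r) a) := by
  simp only [sumSplit, length_pow]
  refine Finset.sum_congr rfl fun r hr => ?_
  simp only [Finset.mem_range] at hr
  simp [pow, List.take_replicate, List.drop_replicate, min_eq_left (by omega : r ≤ n)]

/-- This is a Cauchy product: over all `n`, the cuts of the `n`-letter words run once through all
pairs of lengths. Boundedness keeps the sums finite. -/
lemma tot_sumSplit {G : List (Homog 𝒜) → List (Homog 𝒜) → M} (hG : IsBounded₂ G) (a : 𝒜 1) :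
    tot (sumSplit G) a = tot (fun X => tot (fun Z => G X Z) a) a := by
  have h := hG
  obtain ⟨K, hK⟩ := hG
  rw [tot_eq_sum (K := K) (fun w hw => sumSplit_zero fun X Z e => hK _ _ (by simpa [e] using hw)),
    tot_eq_sum (K := K) (fun w hw => tot_zero fun n => hK _ _ (by omega))]
  simp only [sumSplit_pow]
  rw [Finset.sum_range_diag_flip (K + 1) (fun i j => G (pow i a) (pow j a))]
  refine Finset.sum_congr rfl fun i hi => ?_
  refine (finsum_eq_sum_of_support_subset _ fun j hj => ?_).symm
  by_contra hlt
  refine hj (hK _ _ ?_)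
  simp at hlt hi
  simp
  omega

lemma tot_comm {G : List (Homog 𝒜) → List (Homog 𝒜) → M} (hG : IsBounded₂ G) (a : 𝒜 1) :
    tot (fun X => tot (fun Z => G X Z) a) a = tot (fun Z => tot (fun X => G X Z) a) a := by
  obtain ⟨K, hK⟩ := hG
  have hG' : ∀ X Z, K < X.length + Z.length → G Z X = 0 := fun X Z h => hK _ _ (by omega)
  rw [tot_eq_sum (F := fun X => tot (fun Z => G X Z) a) (K := K)
      (fun w hw => tot_zero fun n => hK _ _ (by omega)),
    tot_eq_sum (F := fun Z => tot (fun X => G X Z) a) (K := K)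
      (fun w hw => tot_zero fun n => hG' _ _ (by omega))]
  have h1 : ∀ n, tot (fun Z => G (pow n a) Z) a =
      ∑ m ∈ Finset.range (K + 1), G (pow n a) (pow m a) :=
    fun n => tot_eq_sum (fun w hw => hK _ _ (by omega)) a
  have h2 : ∀ n, tot (fun X => G X (pow n a)) a =
      ∑ m ∈ Finset.range (K + 1), G (pow m a) (pow n a) :=
    fun n => tot_eq_sum (fun w hw => hK _ _ (by omega)) a
  simp only [h1, h2]
  exact Finset.sum_comm

lemma IsBounded.insert {F : List (Homog 𝒜) → M} (h : IsBounded F) (y : Homog 𝒜) :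
    IsBounded₂ (fun X Z => F (X ++ y :: Z)) := by
  obtain ⟨K, hK⟩ := h
  exact ⟨K, fun X Z hw => hK _ (by simp; omega)⟩

variable [Module 𝕜 M]

/-- `∑ F(a, …, a, y, a, …, a)`. -/
def ins {F : List (Homog 𝒜) → M} (hF : IsMultilinear (𝕜 := 𝕜) F) (d : ℤ) (a : 𝒜 1) :
    𝒜 d →ₗ[𝕜] M :=
  tot (sumSplit fun X Z => hF.letter X Z d) a

lemma IsBounded.letter {F : List (Homog 𝒜) → M} (hF : IsMultilinear (𝕜 := 𝕜) F)
    (h : IsBounded F) (d : ℤ) : IsBounded₂ (fun X Z => hF.letter X Z d) := by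
  obtain ⟨K, hK⟩ := h
  exact ⟨K, fun X Z hw => LinearMap.ext fun y => hK _ (by simp; omega)⟩

lemma ins_apply {F : List (Homog 𝒜) → M} (hF : IsMultilinear (𝕜 := 𝕜) F) (h : IsBounded F)
    {d : ℤ} (a : 𝒜 1) (y : 𝒜 d) :
    ins hF d a y = tot (sumSplit fun X Z => F (X ++ Homog.of y :: Z)) a := by
  have := map_tot (LinearMap.applyₗ (R := 𝕜) (M₂ := M) y) (h.letter hF d).sumSplit a
  refine this.trans (tot_congr fun n => ?_)
  rw [map_sumSplit]
  rfl

/-!   · ext z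
    have := hF l (r ++ Homog.of z :: X) i c x y
    simpa [IsMultilinear.letter] using this
# Polynomiality -/

lemma ofFn_update {α : Type*} {n : ℕ} [DecidableEq (Fin n)] (v : Fin n → α) (i : Fin n) (x : α) :
    List.ofFn (Function.update v i x) =
      (List.ofFn v).take i ++ x :: (List.ofFn v).drop (i + 1) := by
  have hl : (i : ℕ) < (List.ofFn v).length := by simp
  have hs := List.set_eq_take_append_cons_drop (l := List.ofFn v) (i := i) (a := x)
  rw [if_pos hl] at hs
  rw [← hs]
  refine List.ext_getElem (by simp) fun k h1 h2 => ?_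
  simp only [List.getElem_ofFn, List.getElem_set]
  rcases eq_or_ne (i : ℕ) k with rfl | h
  · simp
  · rw [if_neg h, Function.update_of_ne]
    intro e
    exact h (by rw [← e])

/-- The restriction of a multilinear function on words to words of length `n` in `A^1`. -/
def IsMultilinear.toMultilinearMap {F : List (Homog 𝒜) → M} (hF : IsMultilinear (𝕜 := 𝕜) F)
    (n : ℕ) : MultilinearMap 𝕜 (fun _ : Fin n => 𝒜 1) M where
  toFun v := F (List.ofFn fun i => Homog.of (v i))
  map_update_add' v i x y := by
    have h : ∀ x : 𝒜 1, (fun j => Homog.of (Function.update v i x j)) =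
        Function.update (fun j => (Homog.of (v j) : Homog 𝒜)) i (Homog.of x) := fun x => by
      funext j
      rcases eq_or_ne j i with rfl | hj <;> simp [*]
    simp only [h, ofFn_update]
    exact hF.add _ _ _ _
  map_update_smul' v i c x := by
    have h : ∀ x : 𝒜 1, (fun j => Homog.of (Function.update v i x j)) =
        Function.update (fun j => (Homog.of (v j) : Homog 𝒜)) i (Homog.of x) := fun x => by
      funext j
      rcases eq_or_ne j i with rfl | hj <;> simp [*]
    simp only [h, ofFn_update]
    exact hF.smul _ _ _ _

lemma IsMultilinear.pow_mem_polyMap {F : List (Homog 𝒜) → M} (hF : IsMultilinear (𝕜 := 𝕜) F)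
    (n : ℕ) : (fun a => F (pow n a)) ∈ PolyMap 𝕜 (𝒜 1) M := by
  have := multilinear_mem_polyMap (hF.toMultilinearMap n)
  convert this using 2 with a
  simp [IsMultilinear.toMultilinearMap, pow]

lemma tot_mem_polyMap {F : List (Homog 𝒜) → M} (hF : IsMultilinear (𝕜 := 𝕜) F)
    (h : IsBounded F) : tot F ∈ PolyMap 𝕜 (𝒜 1) M := by
  obtain ⟨K, hK⟩ := h
  have e : tot F = fun a => ∑ n ∈ Finset.range (K + 1), F (pow n a) := funext (tot_eq_sum hK)
  rw [e]
  exact sum_mem_polyMap _ fun n _ => hF.pow_mem_polyMap n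

lemma isMultilinear_sumSplit_letter {F : List (Homog 𝒜) → M} (hF : IsMultilinear (𝕜 := 𝕜) F)
    (d : ℤ) : IsMultilinear (𝕜 := 𝕜) (sumSplit fun X Z => hF.letter X Z d) := by
  refine isMultilinear_sumSplit (fun Z l r i c x y => ?_) (fun X l r i c x y => ?_)
  · ext z
    have := hF (Z ++ Homog.of z :: l) r i c x y
    simpa [IsMultilinear.letter] using this
  · ext z
    have := hF l (r ++ Homog.of z :: X) i c x y
    simpa [IsMultilinear.letter] using this

lemma ins_mem_polyMap {F : List (Homog 𝒜) → M} (hF : IsMultilinear (𝕜 := 𝕜) F)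
    (h : IsBounded F) (d : ℤ) : ins hF d ∈ PolyMap 𝕜 (𝒜 1) (𝒜 d →ₗ[𝕜] M) :=
  tot_mem_polyMap (isMultilinear_sumSplit_letter hF d) (h.letter hF d).sumSplit

lemma IsMultilinear.cons {F : List (Homog 𝒜) → M} (hF : IsMultilinear (𝕜 := 𝕜) F) (y : Homog 𝒜) :
    IsMultilinear (𝕜 := 𝕜) fun w => F (y :: w) :=
  fun l r i c u v => hF (y :: l) r i c u v

/-- Only the first letter is expanded; the remaining ones are handled by induction for `F(a, …)` and
`F(Y, …)`. The word has `n + 1` letters because its derivative runs over the cuts of `n` letters;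
the empty word is split off in `hasPolyDeriv_tot`. -/
lemma IsMultilinear.pow_add_smul {F : List (Homog 𝒜) → M} (hF : IsMultilinear (𝕜 := 𝕜) F)
    (n : ℕ) (a Y : 𝒜 1) : ∃ r ∈ PolyMap 𝕜 𝕜 M, ∀ t : 𝕜, F (pow (n + 1) (a + t • Y)) =
      F (pow (n + 1) a) + t • sumSplit (fun X Z => F (X ++ Homog.of Y :: Z)) (pow n a) +
        (t * t) • r t := by
  have h1 : ∀ (w : List (Homog 𝒜)) (t : 𝕜), F (Homog.of (a + t • Y) :: w) =
      F (Homog.of a :: w) + t • F (Homog.of Y :: w) := by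
    intro w t
    rw [add_comm a]
    exact (hF [] w 1 t Y a).trans (add_comm _ _)
  induction n generalizing F with
  | zero =>
    refine ⟨0, Submodule.zero_mem _, fun t => ?_⟩
    have := h1 [] t
    simpa [pow] using this
  | succ n ih =>
    obtain ⟨r, hr, h⟩ := ih (hF.cons (Homog.of a)) (fun w t => by
      rw [add_comm a]
      exact (hF [Homog.of a] w 1 t Y a).trans (add_comm _ _))
    obtain ⟨s, hs, h'⟩ := ih (hF.cons (Homog.of Y)) (fun w t => by
      rw [add_comm a]
      exact (hF [Homog.of Y] w 1 t Y a).trans (add_comm _ _))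
    -- The middle summand is the first-order part of `F(Y, …)`, raised to second order by the factor
    -- `t` that comes with the letter `Y`.
    refine ⟨fun t => r t + sumSplit (fun X Z => F (Homog.of Y :: (X ++ Homog.of Y :: Z))) (pow n a) +
      t • s t, add_mem_polyMap (add_mem_polyMap hr (const_mem_polyMap _))
        (smul_mem_polyMap id_mem_polyMap hs), fun t => ?_⟩
    rw [pow_succ' (n + 1), h1, h, h', pow_succ' n, sumSplit_cons]
    simp only [List.nil_append, List.cons_append, pow_succ']
    module

lemma HasPolyDeriv.sum {V W ι : Type*} [AddCommGroup V] [Module 𝕜 V] [AddCommGroup W] [Module 𝕜 W]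
    (s : Finset ι) {f : ι → V → W} {f' : ι → V → V →ₗ[𝕜] W}
    (h : ∀ i ∈ s, HasPolyDeriv (f i) (f' i)) : HasPolyDeriv (∑ i ∈ s, f i) (∑ i ∈ s, f' i) := by
  classical
  induction s using Finset.induction_on with
  | empty => exact fun _ _ => ⟨0, Submodule.zero_mem _, fun t => by simp⟩
  | insert i s hi ih =>
    rw [Finset.sum_insert hi, Finset.sum_insert hi]
    exact (h i (by simp)).add (ih fun j hj => h j (by simp [hj]))

lemma hasPolyDeriv_tot {F : List (Homog 𝒜) → M} (hF : IsMultilinear (𝕜 := 𝕜) F)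
    (h : IsBounded F) : HasPolyDeriv (tot F) (ins hF 1) := by
  obtain ⟨K, hK⟩ := h
  have e1 : tot F = (∑ n ∈ Finset.range (K + 1), fun a => F (pow (n + 1) a)) + fun _ => F [] := by
    funext a
    rw [tot_eq_sum (K := K + 1) (fun w hw => hK w (by omega)), Finset.sum_range_succ']
    simp [pow]
  have e2 : ins hF 1 = (∑ n ∈ Finset.range (K + 1), fun a =>
      sumSplit (fun X Z => hF.letter X Z 1) (pow n a)) + 0 := by
    funext a
    rw [ins, tot_eq_sum (K := K)]
    · simp
    · intro w hw
      refine sumSplit_zero fun X Z e => LinearMap.ext fun y => hK _ ?_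
      rw [e] at hw
      simp at hw ⊢
      omega
  rw [e1, e2]
  refine HasPolyDeriv.add (HasPolyDeriv.sum _ fun n _ a Y => ?_) (isPolyJet_const (F [])).deriv
  obtain ⟨r, hr, h⟩ := hF.pow_add_smul n a Y
  refine ⟨r, hr, fun t => ?_⟩
  rw [h]
  congr 3
  exact (map_sumSplit (LinearMap.applyₗ (R := 𝕜) (M₂ := M) Y)
    (fun X Z => hF.letter X Z 1) _).symm

end Tot

end StringBracket

end

/-! ### The symmetrized operations `ν` as insertions into `b`. -/

noncomputable section

namespace StringBracket

/-! ## The `L_∞` operations on powers of an element of degree one -/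

/-- Each position is the preimage of the last index under `n!` permutations. Inversion and a
transposition reduce this to the value at `0`, which `Equiv.Perm.decomposeFin` splits off. -/
lemma sum_perm_symm_last {M : Type*} [AddCommMonoid M] (n : ℕ) (G : Fin (n + 1) → M) :
    ∑ σ : Equiv.Perm (Fin (n + 1)), G (σ.symm (Fin.last n)) = n.factorial • ∑ i, G i := by
  have h1 : ∑ σ : Equiv.Perm (Fin (n + 1)), G (σ.symm (Fin.last n)) =
      ∑ σ : Equiv.Perm (Fin (n + 1)), G (σ 0) := by
    refine Fintype.sum_equiv ((Equiv.inv _).trans (Equiv.mulRight (Equiv.swap 0 (Fin.last n)))) _ _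
      fun σ => ?_
    simp [Equiv.Perm.inv_def]
  rw [h1, ← Equiv.Perm.decomposeFin.symm.sum_comp, Fintype.sum_prod_type]
  simp [Fintype.card_perm, Finset.smul_sum]

lemma negOnePow_pow (m : ℤ) (k : ℕ) : m.negOnePow ^ k = ((k : ℤ) * m).negOnePow := by
  induction k with
  | zero => simp
  | succ k ih => rw [pow_succ, ih, ← Int.negOnePow_add, Nat.cast_succ, add_one_mul]

namespace CyclicAInfinityAlgebra

variable {𝕜 A : Type*} [RCLike 𝕜] [AddCommGroup A] [Module 𝕜 A] {𝒜 : ℤ → Submodule 𝕜 A}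
  (S : CyclicAInfinityAlgebra 𝕜 𝒜)

/-- In an inversion of two letters of degree one, the sign of the permutation and the Koszul sign
cancel. What remains is a factor `(-1)^{d-1}` for each letter placed after the special one. -/
lemma koszulSign_snoc (n : ℕ) (d : ℤ) (σ : Equiv.Perm (Fin (n + 1))) :
    koszulSign (Fin.snoc (α := fun _ => ℤ) (fun _ => 1) d) σ =
      ((n - (σ.symm (Fin.last n) : ℕ) : ℤ) * (d - 1)).negOnePow := by
  set p := σ.symm (Fin.last n) with hp
  set D : Fin (n + 1) → ℤ := Fin.snoc (α := fun _ => ℤ) (fun _ => 1) d with hD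
  have hσp : σ p = Fin.last n := by simp [hp]
  have hone : ∀ i, i ≠ p → D (σ i) = 1 := by
    intro i hi
    have h : σ i ≠ Fin.last n := fun e => hi (σ.injective (e.trans hσp.symm))
    obtain ⟨j, hj⟩ := Fin.exists_castSucc_eq.mpr h
    rw [← hj, hD, Fin.snoc_castSucc]
  have hlast : D (σ p) = d := by rw [hσp, hD, Fin.snoc_last]
  have hs : Equiv.Perm.sign σ = ∏ i, ∏ j, if i < j ∧ σ j < σ i then (-1 : ℤˣ) else 1 := by
    rw [Equiv.Perm.sign_eq_prod_prod_Ioi]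
    refine Finset.prod_congr rfl fun i _ => ?_
    rw [← Finset.filter_lt_eq_Ioi, Finset.prod_filter]
    refine Finset.prod_congr rfl fun j _ => ?_
    by_cases h : i < j
    · have hne : σ i ≠ σ j := fun e => h.ne (σ.injective e)
      rcases lt_or_gt_of_ne hne with h' | h'
      · simp [h, h', h'.le]
      · simp [h, h', h'.not_gt]
    · simp [h]
  have hpt : ∀ i j : Fin (n + 1), (if i < j ∧ σ j < σ i then (-1 : ℤˣ) else 1) *
      (if i < j ∧ σ j < σ i then (D (σ i) * D (σ j)).negOnePow else 1) =
        if i = p then (if p < j then (d - 1).negOnePow else 1) else 1 := by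
    intro i j
    by_cases hi : i = p
    · rw [hi]
      by_cases hj : p < j
      · have hlt : σ j < σ p := by
          rw [hσp]
          exact Fin.lt_last_iff_ne_last.mpr fun e => hj.ne (σ.injective (hσp.trans e.symm))
        rw [if_pos ⟨hj, hlt⟩, if_pos ⟨hj, hlt⟩, if_pos rfl, if_pos hj, hlast, hone j hj.ne',
          mul_one, Int.negOnePow_sub]
        simp
      · simp [hj]
    · rw [if_neg hi]
      by_cases h : i < j ∧ σ j < σ i
      · have hj : j ≠ p := by
          rintro rfl
          rw [hσp] at h
          exact absurd h.2 (Fin.le_last _).not_gt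
        simp [h, hone i hi, hone j hj]
      · simp [h]
  rw [koszulSign, hs, ← Finset.prod_mul_distrib]
  simp only [← Finset.prod_mul_distrib, hpt]
  rw [Finset.prod_eq_single p (fun i _ hi => by simp [hi]) (by simp)]
  simp only [if_true]
  rw [← Finset.prod_filter, Finset.prod_const, Finset.filter_lt_eq_Ioi, Fin.card_Ioi,
    negOnePow_pow]
  congr 2
  omega

lemma suspExponent_pow (n : ℕ) (a : 𝒜 1) : suspExponent (pow n a) = 0 := by
  induction n with
  | zero => rfl
  | succ n ih => simp [pow_succ', suspExponent, ih]

lemma b_pow_cons_pow (i j : ℕ) {d : ℤ} (a : 𝒜 1) (y : 𝒜 d) :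
    (S.b (pow i a ++ Homog.of y :: pow j a)).val = (j * (d - 1)).negOnePow •
      S.μ (i + j + 1) (Function.update (fun _ => (a : A)) ⟨i, by omega⟩ (y : A)) := by
  rw [val_b, evalWord_eq (n := i + j + 1) S.μ _ (by simp; omega)]
  congr 1
  · rw [suspExponent_append, suspExponent_pow]
    simp [suspExponent, suspExponent_pow, Homog.sdeg]
  · congr 1
    funext k
    have hL : (pow i a ++ Homog.of y :: pow j a).map Homog.val =
        List.replicate i (a : A) ++ (y : A) :: List.replicate j (a : A) := by simp [pow]
    have hget : ∀ (m : ℕ) (hm : m < ((pow i a ++ Homog.of y :: pow j a).map Homog.val).length),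
        ((pow i a ++ Homog.of y :: pow j a).map Homog.val)[m] =
          if m = i then (y : A) else (a : A) := by
      intro m hm
      simp only [hL, List.getElem_append, List.getElem_cons, List.getElem_replicate,
        List.length_replicate]
      split_ifs <;> first | rfl | omega
    refine (hget k _).trans ?_
    rw [Function.update_apply]
    simp only [Fin.ext_iff]

/-- A summand depends on the permutation only through the position of `y`, so each position occurs
`n!` times and the denominator cancels. The remaining sign is the suspension sign between `μ` and
`b`. -/
lemma nu_snoc (n : ℕ) {d : ℤ} (a : 𝒜 1) (y : 𝒜 d) :
    ((n.factorial : 𝕜)⁻¹) • S.nu (n + 1) (Fin.snoc (α := fun _ => ℤ) (fun _ => 1) d)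
      (Fin.snoc (α := fun _ => A) (fun _ => (a : A)) (y : A)) =
        sumSplit (fun X Z => (S.b (X ++ Homog.of y :: Z)).val) (pow n a) := by
  have key : ∀ σ : Equiv.Perm (Fin (n + 1)),
      (Fin.snoc (α := fun _ => A) (fun _ => (a : A)) (y : A)) ∘ σ =
        Function.update (fun _ => (a : A)) (σ.symm (Fin.last n)) (y : A) := by
    intro σ
    funext i
    rcases eq_or_ne i (σ.symm (Fin.last n)) with rfl | h
    · simp
    · have h' : σ i ≠ Fin.last n := fun e => h (by rw [← e]; simp)
      obtain ⟨j, hj⟩ := Fin.exists_castSucc_eq.mpr h'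
      rw [Function.update_of_ne h, Function.comp_apply, ← hj, Fin.snoc_castSucc]
  have hG := sum_perm_symm_last n fun i : Fin (n + 1) =>
    ((n - (i : ℕ) : ℤ) * (d - 1)).negOnePow •
      S.μ (n + 1) (Function.update (fun _ => (a : A)) i (y : A))
  unfold nu
  simp only [key, koszulSign_snoc]
  rw [hG, ← Nat.cast_smul_eq_nsmul 𝕜, smul_smul,
    inv_mul_cancel₀ (by exact_mod_cast n.factorial_ne_zero), one_smul, sumSplit_pow,
    Finset.sum_range]
  refine Finset.sum_congr rfl fun i _ => ?_
  rw [b_pow_cons_pow]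
  obtain ⟨j, hj⟩ : ∃ j, n = i + j := ⟨n - i, by omega⟩
  have hj' : n - (i : ℕ) = j := by omega
  rw [hj']
  congr 1
  · congr 2
    omega
  · obtain ⟨i, hi⟩ := i
    simp only at hj
    subst hj
    rfl

lemma isBounded_b : IsBounded fun w : List (Homog 𝒜) => (S.b w).val := S.b_bounded

lemma gaugeVal_eq (x : 𝒜 0) (a : 𝒜 1) : S.gaugeVal x a = ins S.isMultilinear_b 0 a x := by
  rw [ins_apply _ S.isBounded_b]
  exact finsum_congr fun n => S.nu_snoc n a x

lemma snoc_one (n : ℕ) : (Fin.snoc (α := fun _ => ℤ) (fun _ : Fin n => (1 : ℤ)) 1 :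
    Fin (n + 1) → ℤ) = fun _ => 1 := by
  funext i
  refine Fin.lastCases ?_ (fun j => ?_) i <;> simp

lemma dcurv_eq (a Y : 𝒜 1) : S.dcurv a Y = ins S.isMultilinear_b 1 a Y := by
  rw [ins_apply _ S.isBounded_b]
  refine finsum_congr fun n => ?_
  rw [← S.nu_snoc n a Y, snoc_one]

lemma curv_eq (a : 𝒜 1) : S.curv a = tot (fun w => (S.b w).val) a := by
  refine finsum_congr fun n => ?_
  have h1 : ∀ σ : Equiv.Perm (Fin n), koszulSign (fun _ => 1) σ = 1 := by
    intro σ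
    cases n with
    | zero => simp [koszulSign, Subsingleton.elim σ 1]
    | succ n =>
      rw [← snoc_one, koszulSign_snoc]
      simp
  have h2 : (S.b (pow n a)).val = S.μ n fun _ => (a : A) := by
    rw [val_b, evalWord_eq (n := n) S.μ _ (by simp), suspExponent_pow]
    simp [pow]
  simp only [nu, h1, h2, one_smul, Function.comp_def]
  rw [Finset.sum_const, Finset.card_univ, Fintype.card_perm, Fintype.card_fin,
    ← Nat.cast_smul_eq_nsmul 𝕜, smul_smul,
    inv_mul_cancel₀ (by exact_mod_cast n.factorial_ne_zero), one_smul]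

end CyclicAInfinityAlgebra

end StringBracket

end

/-! ### The curvature, its derivative and the gauge action. -/

noncomputable section

namespace StringBracket

section TotSplit

variable {𝕜 A M P Q : Type*} [RCLike 𝕜] [AddCommGroup A] [Module 𝕜 A] {𝒜 : ℤ → Submodule 𝕜 A}
  [AddCommGroup M] [AddCommGroup P] [Module 𝕜 P] [AddCommGroup Q] [Module 𝕜 Q]

lemma tot_sumSplit3_congr {F G : List (Homog 𝒜) → List (Homog 𝒜) → List (Homog 𝒜) → M} {a : 𝒜 1}
    (h : ∀ i j k, F (pow i a) (pow j a) (pow k a) = G (pow i a) (pow j a) (pow k a)) :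
    tot (sumSplit3 F) a = tot (sumSplit3 G) a :=
  tot_congr fun n => by simp only [sumSplit3, sumSplit_pow, h]

lemma tot_sumSplit_swap {G : List (Homog 𝒜) → List (Homog 𝒜) → M} (hG : IsBounded₂ G) (a : 𝒜 1) :
    tot (sumSplit fun X Z => G Z X) a = tot (sumSplit G) a := by
  have hG' : IsBounded₂ fun X Z => G Z X := by
    obtain ⟨k, hk⟩ := hG
    exact ⟨k, fun X Z hw => hk _ _ (by omega)⟩
  rw [tot_sumSplit hG', tot_sumSplit hG, tot_comm hG]

variable [Module 𝕜 M]

lemma tot_mem (K : Submodule 𝕜 M) {F : List (Homog 𝒜) → M} {a : 𝒜 1}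
    (h : ∀ n, F (pow n a) ∈ K) : tot F a ∈ K :=
  finsum_induction (· ∈ K) K.zero_mem (fun _ _ => K.add_mem) h

lemma IsBounded₂.sumSplit3 (B : P →ₗ[𝕜] Q →ₗ[𝕜] M) {G : List (Homog 𝒜) → List (Homog 𝒜) → P}
    {K : List (Homog 𝒜) → Q} (hG : IsBounded₂ G) (hK : IsBounded K) :
    IsBounded₂ fun X R => StringBracket.sumSplit (fun Y Z => B (G X Z) (K Y)) R := by
  obtain ⟨m, hm⟩ := hG
  obtain ⟨k, hk⟩ := hK
  refine ⟨m + k, fun X R hw => sumSplit_zero fun Y Z e => ?_⟩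
  rw [e, List.length_append] at hw
  by_cases h : m < X.length + Z.length
  · simp [hm X Z h]
  · simp [hk Y (by omega)]

lemma tot_sumSplit3 (B : P →ₗ[𝕜] Q →ₗ[𝕜] M) {G : List (Homog 𝒜) → List (Homog 𝒜) → P}
    {K : List (Homog 𝒜) → Q} (hG : IsBounded₂ G) (hK : IsBounded K) (a : 𝒜 1) :
    tot (sumSplit3 fun X Y Z => B (G X Z) (K Y)) a = B (tot (sumSplit G) a) (tot K a) := by
  have h1 : tot (sumSplit3 fun X Y Z => B (G X Z) (K Y)) a =
      tot (fun X => tot (sumSplit fun Y Z => B (G X Z) (K Y)) a) a :=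
    tot_sumSplit (hG.sumSplit3 B hK) a
  have h2 : ∀ X, tot (sumSplit fun Y Z => B (G X Z) (K Y)) a = B (tot (G X) a) (tot K a) := by
    intro X
    have hb : IsBounded₂ fun Y Z => B (G X Z) (K Y) := by
      obtain ⟨m, hm⟩ := hG
      obtain ⟨k, hk⟩ := hK
      refine ⟨m + k, fun Y Z hw => ?_⟩
      by_cases h : m < X.length + Z.length
      · simp [hm X Z h]
      · simp [hk Y (by omega)]
    rw [tot_sumSplit hb, map_tot (B (tot (G X) a)) hK]
    exact tot_congr fun n => (map_tot (B.flip (K (pow n a))) (hG.left X) a).symm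
  rw [h1, funext h2, tot_sumSplit hG]
  exact (map_tot (B.flip (tot K a)) (hG.tot a) a).symm

lemma tot_sumSplit_bilinear (B : P →ₗ[𝕜] Q →ₗ[𝕜] M) {G : List (Homog 𝒜) → P}
    {K : List (Homog 𝒜) → Q} (hG : IsBounded G) (hK : IsBounded K) (a : 𝒜 1) :
    tot (sumSplit fun X Y => B (G X) (K Y)) a = B (tot G a) (tot K a) := by
  have hb : IsBounded₂ fun X Y => B (G X) (K Y) := by
    obtain ⟨m, hm⟩ := hG
    obtain ⟨k, hk⟩ := hK
    refine ⟨m + k, fun X Y hw => ?_⟩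
    by_cases h : m < X.length
    · simp [hm X h]
    · simp [hk Y (by omega)]
  rw [tot_sumSplit hb]
  rw [funext fun X => (map_tot (B (G X)) hK a).symm]
  exact (map_tot (B.flip (tot K a)) hG a).symm

end TotSplit

section Slot

variable {𝕜 A M : Type*} [RCLike 𝕜] [AddCommGroup A] [Module 𝕜 A] {𝒜 : ℤ → Submodule 𝕜 A}
  [DirectSum.Decomposition 𝒜] [AddCommGroup M] [Module 𝕜 M]

variable (𝒜) in
/-- The degree `d` component. -/
def proj (d : ℤ) : A →ₗ[𝕜] 𝒜 d :=
  (DirectSum.component 𝕜 ℤ (fun i => 𝒜 i) d) ∘ₗ (DirectSum.decomposeLinearEquiv 𝒜).toLinearMap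

lemma coe_proj {d : ℤ} {x : A} (h : x ∈ 𝒜 d) : (proj 𝒜 d x : A) = x := Homog.val_comp h

@[simp] lemma proj_coe {d : ℤ} (x : 𝒜 d) : proj 𝒜 d x = x := Subtype.ext (coe_proj x.2)

/-- `x ↦ H(X, x, Z)`, on the degree `d` component of `x`. -/
def slot {H : List (Homog 𝒜) → M} (hH : IsMultilinear (𝕜 := 𝕜) H) (d : ℤ)
    (X Z : List (Homog 𝒜)) : A →ₗ[𝕜] M :=
  hH.letter X Z d ∘ₗ proj 𝒜 d

lemma slot_apply {H : List (Homog 𝒜) → M} (hH : IsMultilinear (𝕜 := 𝕜) H) (d : ℤ)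
    (X Z : List (Homog 𝒜)) (x : A) : slot hH d X Z x = H (X ++ Homog.comp d x :: Z) := rfl

lemma slot_val {H : List (Homog 𝒜) → M} (hH : IsMultilinear (𝕜 := 𝕜) H) {d : ℤ}
    (X Z : List (Homog 𝒜)) (y : Homog 𝒜) (h : y.deg = d) :
    slot hH d X Z y.val = H (X ++ y :: Z) := by
  subst h
  exact congrArg (fun a => H (X ++ a :: Z)) (Homog.comp_eq y.mem)

lemma isBounded_slot {H : List (Homog 𝒜) → M} (hH : IsMultilinear (𝕜 := 𝕜) H) (h : IsBounded H)
    (d : ℤ) : IsBounded₂ (slot hH d) := by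
  obtain ⟨k, hk⟩ := h
  exact ⟨k, fun X Z hw => LinearMap.ext fun y => hk _ (by simp; omega)⟩

/-- `x ↦ ∑ H(a, …, a, x, a, …, a)`, on the degree `d` component of `x`. -/
def insA {H : List (Homog 𝒜) → M} (hH : IsMultilinear (𝕜 := 𝕜) H) (d : ℤ) (a : 𝒜 1) :
    A →ₗ[𝕜] M :=
  ins hH d a ∘ₗ proj 𝒜 d

lemma insA_coe {H : List (Homog 𝒜) → M} (hH : IsMultilinear (𝕜 := 𝕜) H) {d : ℤ} (a : 𝒜 1)
    (x : 𝒜 d) : insA hH d a x = ins hH d a x := by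
  simp [insA]

lemma insA_mem_polyMap {H : List (Homog 𝒜) → M} (hH : IsMultilinear (𝕜 := 𝕜) H) (h : IsBounded H)
    (d : ℤ) : insA hH d ∈ PolyMap 𝕜 (𝒜 1) (A →ₗ[𝕜] M) :=
  comp_mem_polyMap (ins_mem_polyMap hH h d) (const_mem_polyMap _)

lemma insA_eq_tot {H : List (Homog 𝒜) → M} (hH : IsMultilinear (𝕜 := 𝕜) H) (h : IsBounded H)
    (d : ℤ) (a : 𝒜 1) : insA hH d a = tot (sumSplit (slot hH d)) a := by
  have := map_tot (LinearMap.lcomp 𝕜 M (proj 𝒜 d)) (h.letter hH d).sumSplit a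
  refine this.trans (tot_congr fun n => ?_)
  rw [map_sumSplit]
  rfl

lemma tot_sumSplit3_slot {H : List (Homog 𝒜) → M} (hH : IsMultilinear (𝕜 := 𝕜) H)
    (h : IsBounded H) (d : ℤ) {K : List (Homog 𝒜) → A} (hK : IsBounded K) (a : 𝒜 1) :
    tot (sumSplit3 fun X Y Z => slot hH d X Z (K Y)) a = insA hH d a (tot K a) := by
  rw [insA_eq_tot hH h]
  exact tot_sumSplit3 LinearMap.id (isBounded_slot hH h d) hK a

end Slot

lemma sumSplit_regroup_middle {α M : Type*} [AddCommMonoid M]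
    (F : List α → List α → List α → List α → M) (w : List α) :
    sumSplit (fun U V => sumSplit (fun U₁ U₂ => sumSplit (fun V₁ V₂ => F U₁ U₂ V₁ V₂) V) U) w =
      sumSplit3 (fun X Y Z => sumSplit (fun U₂ V₁ => F X U₂ V₁ Z) Y) w := by
  rw [sumSplit_assoc (fun U₁ U₂ V => sumSplit (fun V₁ V₂ => F U₁ U₂ V₁ V₂) V)]
  exact sumSplit_congr fun X R _ => (sumSplit_assoc (fun U₂ V₁ Z => F X U₂ V₁ Z) R).symm

namespace CyclicAInfinityAlgebra

variable {𝕜 A M : Type*} [RCLike 𝕜] [AddCommGroup A] [Module 𝕜 A] {𝒜 : ℤ → Submodule 𝕜 A}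
  (S : CyclicAInfinityAlgebra 𝕜 𝒜)

lemma curv_mem_polyMap : S.curv ∈ PolyMap 𝕜 (𝒜 1) A := by
  rw [funext S.curv_eq]
  exact tot_mem_polyMap S.isMultilinear_b S.isBounded_b

lemma hasPolyDeriv_curv : HasPolyDeriv S.curv (ins S.isMultilinear_b 1) := by
  rw [funext S.curv_eq]
  exact hasPolyDeriv_tot S.isMultilinear_b S.isBounded_b

lemma ω_antisymm (x y : 𝒜 1) : S.ω x y = - S.ω y x := by
  have := S.ω_symm (Homog.of x) (Homog.of y)
  simpa using this

/-! ### The gauge action -/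

/-- `∑ ± b(…, x, …)`. -/
def insertDegZero (x : 𝒜 0) : List (Homog 𝒜) → A :=
  sumSplit fun U V => (sdegSum U).negOnePow • (S.b (U ++ Homog.of x :: V)).val

lemma isMultilinear_insertDegZero (x : 𝒜 0) :
    IsMultilinear (𝕜 := 𝕜) (S.insertDegZero x) := by
  refine isMultilinear_sumSplit (fun U l r i c y z => ?_) (fun V => ?_)
  · have := S.isMultilinear_b (U ++ Homog.of x :: l) r i c y z
    simp only [List.append_assoc, List.cons_append] at this
    rw [this, smul_add, sign_smul_comm]
  · refine IsMultilinear.units_smul_left (fun l r i c y z => ?_) _ fun _ _ h => sdegSum_congr h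
    have := S.isMultilinear_b l (r ++ Homog.of x :: V) i c y z
    simpa using this

lemma isBounded_insertDegZero (x : 𝒜 0) : IsBounded (S.insertDegZero x) := by
  obtain ⟨k, hk⟩ := S.isBounded_b.insert (Homog.of x)
  exact IsBounded₂.sumSplit ⟨k, fun X Z hw => (congrArg _ (hk X Z hw)).trans (smul_zero _)⟩

/-- In the `A_∞` relation for `U, x, V`, the terms whose inner operation avoids `x` make up the left
side and those whose inner operation contains `x` the right side. The signs use that `x` has
suspended degree `-1`. -/
lemma coder_insertDegZero (x : 𝒜 0) (w : List (Homog 𝒜)) :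
    S.coder (S.insertDegZero x) w = sumSplit (fun U V => (sdegSum U).negOnePow •
      sumSplit (fun U₁ U₂ => sumSplit (fun V₁ V₂ => (sdegSum U₁).negOnePow •
        (S.b (U₁ ++ S.b (U₂ ++ Homog.of x :: V₁) :: V₂)).val) V) U) w := by
  rw [insertDegZero, coder_sumSplit]
  refine sumSplit_congr fun U V _ => ?_
  have h := S.coder_b (U ++ Homog.of x :: V)
  rw [coder_append_cons] at h
  have hs : (sdegSum U + (Homog.of x : Homog 𝒜).sdeg).negOnePow = - (sdegSum U).negOnePow := by
    rw [Int.negOnePow_add]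
    simp
  rw [hs, Units.neg_smul, add_neg_eq_zero] at h
  rw [S.coder_units_smul (fun v => sdegSum v) (sdegSum U + 1)
    (fun P => (S.b (P ++ Homog.of x :: V)).val) U (fun v hv => by rw [hv])]
  have h2 : S.coder (fun P => (sdegSum U).negOnePow • (S.b (U ++ Homog.of x :: P)).val) V =
      (sdegSum U).negOnePow • S.coder (fun P => (S.b (U ++ Homog.of x :: P)).val) V :=
    S.coder_units_smul (fun _ => sdegSum U) (sdegSum U)
      (fun P => (S.b (U ++ Homog.of x :: P)).val) V fun _ _ => rfl
  rw [h2, ← h, Int.negOnePow_succ, Units.neg_smul, smul_add]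
  abel_nf

/-- This adjunction is cyclic rotation. The rotation exchanges the letters `a` before and after the
inserted one, hence the use of `tot_sumSplit_swap`. -/
lemma ω_gauge (x : 𝒜 0) (a X : 𝒜 1) :
    S.ω X (S.gauge x a) = S.ω (ins S.isMultilinear_b 1 a X) x := by
  have h1 : ∀ {d : ℤ} (y : 𝒜 d) (z : A), S.ω (ins S.isMultilinear_b d a y) z =
      tot (sumSplit fun U V => S.ω (S.b (U ++ Homog.of y :: V)).val z) a := by
    intro d y z
    rw [ins_apply _ S.isBounded_b]
    refine (map_tot (S.ωL.flip z) (S.isBounded_b.insert (Homog.of y)).sumSplit a).trans ?_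
    exact tot_congr fun n => map_sumSplit (S.ωL.flip z) _ _
  have e : (S.gauge x a : A) = ins S.isMultilinear_b 0 a x := S.gaugeVal_eq x a
  rw [ω_antisymm, e, h1, h1]
  have hb : IsBounded₂ fun U V => S.ω (S.b (U ++ Homog.of x :: V)).val (X : A) := by
    obtain ⟨k, hk⟩ := S.isBounded_b.insert (Homog.of x)
    exact ⟨k, fun U V hw =>
      (congrArg (S.ωL.flip (X : A)) (hk U V hw)).trans (map_zero _)⟩
  rw [← tot_sumSplit_swap hb]
  refine (map_tot (-LinearMap.id (R := 𝕜) (M := 𝕜)) ?_ a).trans (tot_congr fun n => ?_)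
  · obtain ⟨k, hk⟩ := hb
    exact IsBounded₂.sumSplit ⟨k, fun U V hw => hk _ _ (by omega)⟩
  · rw [map_sumSplit]
    simp only [sumSplit_pow]
    refine Finset.sum_congr rfl fun r _ => ?_
    have := S.ω_b_rotate (pow r a) (pow (n - r) a) (Homog.of X) (Homog.of x)
    simp at this
    simpa using this.symm

variable [DirectSum.Decomposition 𝒜] [AddCommGroup M] [Module 𝕜 M]

/-- On powers of `a` the signs of the coderivation are trivial, and the sum over the middle piece
alone is the curvature. -/
lemma tot_coder {H : List (Homog 𝒜) → M} (hH : IsMultilinear (𝕜 := 𝕜) H) (h : IsBounded H)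
    (a : 𝒜 1) : tot (S.coder H) a = insA hH 2 a (S.curv a) := by
  rw [curv_eq, ← tot_sumSplit3_slot hH h 2 S.isBounded_b]
  refine tot_sumSplit3_congr fun i j k => ?_
  rw [slot_val hH _ _ _ (by simp)]
  simp

lemma tot_insert_b {H : List (Homog 𝒜) → M} (hH : IsMultilinear (𝕜 := 𝕜) H) (h : IsBounded H)
    {d : ℤ} (a : 𝒜 1) (y : 𝒜 d) :
    tot (sumSplit fun U V => sumSplit (fun U₁ U₂ => sumSplit (fun V₁ V₂ =>
      H (U₁ ++ S.b (U₂ ++ Homog.of y :: V₁) :: V₂)) V) U) a =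
        insA hH (d + 1) a (ins S.isMultilinear_b d a y) := by
  rw [ins_apply _ S.isBounded_b,
    ← tot_sumSplit3_slot hH h (d + 1) (S.isBounded_b.insert (Homog.of y)).sumSplit]
  refine (tot_congr fun n => sumSplit_regroup_middle _ _).trans ?_
  refine tot_sumSplit3_congr fun i j k => ?_
  rw [map_sumSplit]
  simp only [sumSplit_pow]
  refine Finset.sum_congr rfl fun r _ => ?_
  rw [slot_val hH _ _ _ (by simp; ring)]

/-- Summing `coder_insertDegZero` over the powers of `a` shows that gauge fields are tangent to the
Maurer-Cartan space, with an explicit multiplier of the curvature. -/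
lemma dcurv_gauge (x : 𝒜 0) (a : 𝒜 1) :
    ins S.isMultilinear_b 1 a (S.gauge x a) =
      insA (S.isMultilinear_insertDegZero x) 2 a (S.curv a) := by
  rw [← tot_coder _ _ (S.isBounded_insertDegZero x), ← insA_coe]
  have e : (S.gauge x a : A) = ins S.isMultilinear_b 0 a x := S.gaugeVal_eq x a
  rw [e]
  refine (S.tot_insert_b S.isMultilinear_b S.isBounded_b a x).symm.trans (tot_congr fun n => ?_)
  rw [coder_insertDegZero]
  simp [sumSplit_pow]

end CyclicAInfinityAlgebra

end StringBracket

end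

/-! ### Hamiltonian fields modulo the Maurer-Cartan equation, and the Poisson bracket. -/

noncomputable section

namespace StringBracket

/-! ## Hamiltonian vector fields along the zero locus of a polynomial map -/

section Hamiltonian

variable {𝕜 V W : Type*} [RCLike 𝕜] [AddCommGroup V] [Module 𝕜 V] [AddCommGroup W] [Module 𝕜 W]

/-- A vector field `X` is tangent to the zero locus of `F`, and it is Hamiltonian on the zero locus
for a function with derivative `ψ'`. -/
def IsHamiltonianAlong (F : V → W) (F' : V → V →ₗ[𝕜] W) (Ω : V →ₗ[𝕜] V →ₗ[𝕜] 𝕜)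
    (ψ' : V → V →ₗ[𝕜] 𝕜) (X : V → V) : Prop :=
  X ∈ PolyMap 𝕜 V V ∧
  (∃ L ∈ PolyMap 𝕜 V (W →ₗ[𝕜] W), ∀ a, F' a (X a) = L a (F a)) ∧
  ∃ M ∈ PolyMap 𝕜 V (W →ₗ[𝕜] V →ₗ[𝕜] 𝕜), ∃ Λ ∈ PolyMap 𝕜 V (W →ₗ[𝕜] 𝕜),
    ∀ a Y, Ω (X a) Y = ψ' a Y + M a (F a) Y + Λ a (F' a Y)

variable {F : V → W} {F' : V → V →ₗ[𝕜] W} {F'' : V → V →ₗ[𝕜] V →ₗ[𝕜] W}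
  {Ω : V →ₗ[𝕜] V →ₗ[𝕜] 𝕜} {ψ' χ' : V → V →ₗ[𝕜] 𝕜} {ψ'' χ'' : V → V →ₗ[𝕜] V →ₗ[𝕜] 𝕜} {X Z : V → V}

lemma IsHamiltonianAlong.add_smul (hX : IsHamiltonianAlong F F' Ω ψ' X)
    (hZ : IsHamiltonianAlong F F' Ω χ' Z) (c : 𝕜) :
    IsHamiltonianAlong F F' Ω (c • ψ' + χ') (c • X + Z) := by
  obtain ⟨pX, ⟨L, pL, hL⟩, M, pM, Λ, pΛ, hM⟩ := hX
  obtain ⟨pZ, ⟨K, pK, hK⟩, N, pN, Γ, pΓ, hN⟩ := hZ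
  refine ⟨Submodule.add_mem _ (Submodule.smul_mem _ c pX) pZ,
    ⟨c • L + K, Submodule.add_mem _ (Submodule.smul_mem _ c pL) pK, fun a => by simp [hL, hK]⟩,
    c • M + N, Submodule.add_mem _ (Submodule.smul_mem _ c pM) pN,
    c • Λ + Γ, Submodule.add_mem _ (Submodule.smul_mem _ c pΛ) pΓ, fun a Y => ?_⟩
  simp only [Pi.add_apply, Pi.smul_apply, map_add, map_smul, LinearMap.add_apply,
    LinearMap.smul_apply, hM, hN, smul_eq_mul]
  ring

/-- The derivative of the tangency equation. -/
lemma deriv_tangency {L : V → W →ₗ[𝕜] W} {X' : V → V →ₗ[𝕜] V} {L' : V → V →ₗ[𝕜] W →ₗ[𝕜] W}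
    (hF : HasPolyDeriv F F') (hF' : HasPolyDeriv F' F'') (hX : HasPolyDeriv X X')
    (hL : HasPolyDeriv L L') (h : ∀ a, F' a (X a) = L a (F a)) (a Y : V) :
    F'' a Y (X a) + F' a (X' a Y) = L' a Y (F a) + L a (F' a Y) := by
  have h1 := hF'.bilinear LinearMap.id hX
  have h2 := hL.bilinear LinearMap.id hF
  have e : (fun a => LinearMap.id (R := 𝕜) (F' a) (X a)) =
      fun a => LinearMap.id (R := 𝕜) (L a) (F a) := funext h
  rw [e] at h1
  exact LinearMap.congr_fun (congrFun (h1.unique h2) a) Y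

/-- The derivative of the equation of a Hamiltonian vector field. -/
lemma deriv_hamiltonian {M : V → W →ₗ[𝕜] V →ₗ[𝕜] 𝕜} {Λ : V → W →ₗ[𝕜] 𝕜} {X' : V → V →ₗ[𝕜] V}
    {M' : V → V →ₗ[𝕜] W →ₗ[𝕜] V →ₗ[𝕜] 𝕜} {Λ' : V → V →ₗ[𝕜] W →ₗ[𝕜] 𝕜}
    (hF : HasPolyDeriv F F') (hF' : HasPolyDeriv F' F'') (hψ : HasPolyDeriv ψ' ψ'')
    (hX : HasPolyDeriv X X') (hM : HasPolyDeriv M M') (hΛ : HasPolyDeriv Λ Λ')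
    (h : ∀ a Y, Ω (X a) Y = ψ' a Y + M a (F a) Y + Λ a (F' a Y)) (a U Y : V) :
    Ω (X' a U) Y = ψ'' a U Y + (M' a U (F a) Y + M a (F' a U) Y) +
      (Λ' a U (F' a Y) + Λ a (F'' a U Y)) := by
  have h1 := hX.linear_comp Ω
  have h2 := (hψ.add (hM.bilinear LinearMap.id hF)).add
    (hΛ.bilinear (LinearMap.llcomp 𝕜 V W 𝕜) hF')
  have e : (fun a => Ω (X a)) = ψ' + (fun a => LinearMap.id (R := 𝕜) (M a) (F a)) +
      fun a => LinearMap.llcomp 𝕜 V W 𝕜 (Λ a) (F' a) := by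
    funext a
    exact LinearMap.ext fun Y => h a Y
  rw [e] at h1
  exact LinearMap.congr_fun (LinearMap.congr_fun (congrFun (h1.unique h2) a) U) Y

/-- The part of the error term of the bracket of two Hamiltonian fields which comes from one of
them. -/
def bracketError (M' : V → V →ₗ[𝕜] W →ₗ[𝕜] V →ₗ[𝕜] 𝕜) (M : V → W →ₗ[𝕜] V →ₗ[𝕜] 𝕜)
    (Λ' : V → V →ₗ[𝕜] W →ₗ[𝕜] 𝕜) (Z : V → V) (K : V → W →ₗ[𝕜] W) (a : V) : W →ₗ[𝕜] V →ₗ[𝕜] 𝕜 :=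
  M' a (Z a) - LinearMap.llcomp 𝕜 V (V →ₗ[𝕜] 𝕜) 𝕜 (LinearMap.applyₗ (Z a)) ∘ₗ (M' a).flip +
    M a ∘ₗ K a - (Λ' a).flip ∘ₗ K a

set_option maxSynthPendingDepth 3 in
lemma bracketError_mem_polyMap {M' : V → V →ₗ[𝕜] W →ₗ[𝕜] V →ₗ[𝕜] 𝕜} {M : V → W →ₗ[𝕜] V →ₗ[𝕜] 𝕜}
    {Λ' : V → V →ₗ[𝕜] W →ₗ[𝕜] 𝕜} {K : V → W →ₗ[𝕜] W}
    (hM' : M' ∈ PolyMap 𝕜 V (V →ₗ[𝕜] W →ₗ[𝕜] V →ₗ[𝕜] 𝕜))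
    (hM : M ∈ PolyMap 𝕜 V (W →ₗ[𝕜] V →ₗ[𝕜] 𝕜)) (hΛ' : Λ' ∈ PolyMap 𝕜 V (V →ₗ[𝕜] W →ₗ[𝕜] 𝕜))
    (hZ : Z ∈ PolyMap 𝕜 V V) (hK : K ∈ PolyMap 𝕜 V (W →ₗ[𝕜] W)) :
    bracketError M' M Λ' Z K ∈ PolyMap 𝕜 V (W →ₗ[𝕜] V →ₗ[𝕜] 𝕜) :=
  sub_mem_polyMap (add_mem_polyMap (sub_mem_polyMap (apply_mem_polyMap hM' hZ)
    (comp_mem_polyMap (linear_comp_mem_polyMap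
      (LinearMap.llcomp 𝕜 V (V →ₗ[𝕜] 𝕜) 𝕜 ∘ₗ LinearMap.applyₗ) hZ) (flip_mem_polyMap hM')))
    (comp_mem_polyMap hM hK)) (comp_mem_polyMap (flip_mem_polyMap hΛ') hK)

/-- Since `Ω` is constant, the commutator of the fields is Hamiltonian for `Ω(X, Z)`: differentiate
both Hamiltonian equations and antisymmetrize, so that the second derivatives of `ψ`, `χ` and `F`
drop out. No non-degeneracy is needed. The equations hold only modulo `F` and `F'(Y)`, so polynomial
multipliers are carried along. -/
lemma IsHamiltonianAlong.bracket (hF : IsPolyJet F F' F'') (hΩ : ∀ x y, Ω x y = - Ω y x)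
    (hψ : HasPolyDeriv ψ' ψ'') (sψ : ∀ a Y U, ψ'' a Y U = ψ'' a U Y)
    (hχ : HasPolyDeriv χ' χ'') (sχ : ∀ a Y U, χ'' a Y U = χ'' a U Y)
    (hX : IsHamiltonianAlong F F' Ω ψ' X) (hZ : IsHamiltonianAlong F F' Ω χ' Z) :
    ∃ (h' : V → V →ₗ[𝕜] 𝕜) (U : V → V), HasPolyDeriv (fun a => Ω (X a) (Z a)) h' ∧
      IsHamiltonianAlong F F' Ω h' U := by
  obtain ⟨pX, ⟨L, pL, hL⟩, M, pM, Λ, pΛ, hM⟩ := hX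
  obtain ⟨pZ, ⟨K, pK, hK⟩, N, pN, Γ, pΓ, hN⟩ := hZ
  obtain ⟨X', _, jX⟩ := exists_isPolyJet pX
  obtain ⟨Z', _, jZ⟩ := exists_isPolyJet pZ
  obtain ⟨L', _, jL⟩ := exists_isPolyJet pL
  obtain ⟨K', _, jK⟩ := exists_isPolyJet pK
  obtain ⟨M', _, jM⟩ := exists_isPolyJet pM
  obtain ⟨N', _, jN⟩ := exists_isPolyJet pN
  obtain ⟨Λ', _, jΛ⟩ := exists_isPolyJet pΛ
  obtain ⟨Γ', _, jΓ⟩ := exists_isPolyJet pΓ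
  refine ⟨_, fun a => X' a (Z a) - Z' a (X a), jX.deriv.bilinear Ω jZ.deriv,
    sub_mem_polyMap (apply_mem_polyMap jX.mem' pZ) (apply_mem_polyMap jZ.mem' pX),
    -- Differentiating `F'(X) = L F` along `Z` produces `L (F'(Z)) = L K F`; the symmetric
    -- computation gives `K L F`, hence the commutator of `L` and `K`.
    ⟨fun a => L' a (Z a) - K' a (X a) + (L a ∘ₗ K a - K a ∘ₗ L a),
      add_mem_polyMap (sub_mem_polyMap (apply_mem_polyMap jL.mem' pZ)
        (apply_mem_polyMap jK.mem' pX)) (sub_mem_polyMap (comp_mem_polyMap pL pK)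
        (comp_mem_polyMap pK pL)), fun a => ?_⟩,
    fun a => bracketError M' M Λ' Z K a - bracketError N' N Γ' X L a,
    sub_mem_polyMap (bracketError_mem_polyMap jM.mem' pM jΛ.mem' pZ pK)
      (bracketError_mem_polyMap jN.mem' pN jΓ.mem' pX pL),
    fun a => Λ' a (Z a) - (M a).flip (Z a) - (Γ' a (X a) - (N a).flip (X a)),
    sub_mem_polyMap (sub_mem_polyMap (apply_mem_polyMap jΛ.mem' pZ)
      (apply_mem_polyMap (flip_mem_polyMap pM) pZ)) (sub_mem_polyMap (apply_mem_polyMap jΓ.mem' pX)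
      (apply_mem_polyMap (flip_mem_polyMap pN) pX)), fun a Y => ?_⟩
  · have h1 := deriv_tangency hF.deriv hF.deriv' jX.deriv jL.deriv hL a (Z a)
    have h2 := deriv_tangency hF.deriv hF.deriv' jZ.deriv jK.deriv hK a (X a)
    rw [hK] at h1
    rw [hL, hF.symm] at h2
    have h3 := congrArg₂ (· - ·) h1 h2
    simp only [add_sub_add_left_eq_sub] at h3
    simp only [map_sub, h3, LinearMap.add_apply, LinearMap.sub_apply, LinearMap.comp_apply]
    abel
  · have dX := deriv_hamiltonian hF.deriv hF.deriv' hψ jX.deriv jM.deriv jΛ.deriv hM a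
    have dZ := deriv_hamiltonian hF.deriv hF.deriv' hχ jZ.deriv jN.deriv jΓ.deriv hN a
    have x1 := dX (Z a) Y
    have x2 := dX Y (Z a)
    have z1 := dZ (X a) Y
    have z2 := dZ Y (X a)
    rw [hK] at x1 x2
    rw [hL] at z1 z2
    rw [sψ, hF.symm] at x1
    rw [sχ, hF.symm] at z1
    have o := hΩ (X a) (Z' a Y)
    simp only [leibniz_apply, bracketError, map_sub, LinearMap.add_apply, LinearMap.sub_apply,
      LinearMap.comp_apply, LinearMap.llcomp_apply, LinearMap.flip_apply, LinearMap.applyₗ_apply_apply]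
    linear_combination x1 - x2 - z1 + z2 - o

/-- If `ψ = Θ(F)` vanishes on the zero locus of `F`, then so does `Ω(X^ψ, Z)`. -/
lemma IsHamiltonianAlong.bracket_ideal {Θ : V → W →ₗ[𝕜] 𝕜} {ψ : V → 𝕜} (hF : HasPolyDeriv F F')
    (hψ : HasPolyDeriv ψ ψ') (pΘ : Θ ∈ PolyMap 𝕜 V (W →ₗ[𝕜] 𝕜)) (hΘ : ∀ a, ψ a = Θ a (F a))
    (hX : IsHamiltonianAlong F F' Ω ψ' X) (hZ : IsHamiltonianAlong F F' Ω χ' Z) :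
    ∃ Ξ ∈ PolyMap 𝕜 V (W →ₗ[𝕜] 𝕜), ∀ a, Ω (X a) (Z a) = Ξ a (F a) := by
  obtain ⟨pX, -, M, pM, Λ, pΛ, hM⟩ := hX
  obtain ⟨pZ, ⟨K, pK, hK⟩, -⟩ := hZ
  obtain ⟨Θ', _, jΘ⟩ := exists_isPolyJet pΘ
  have h1 := jΘ.deriv.bilinear LinearMap.id hF
  have e : (fun a => LinearMap.id (R := 𝕜) (Θ a) (F a)) = ψ := (funext hΘ).symm
  rw [e] at h1
  have h2 := hψ.unique h1
  -- Here `dψ(Z) = Θ'(Z)(F) + Θ(F'(Z))`, and tangency of `Z` replaces `F'(Z)` by `K F`. The last two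
  -- summands are the error terms of the Hamiltonian equation for `X`.
  refine ⟨fun a => Θ' a (Z a) + Θ a ∘ₗ K a + (M a).flip (Z a) + Λ a ∘ₗ K a,
    add_mem_polyMap (add_mem_polyMap (add_mem_polyMap (apply_mem_polyMap jΘ.mem' pZ)
      (comp_mem_polyMap pΘ pK)) (apply_mem_polyMap (flip_mem_polyMap pM) pZ))
      (comp_mem_polyMap pΛ pK), fun a => ?_⟩
  rw [hM, h2, leibniz_apply, hK]
  simp only [LinearMap.id_apply, LinearMap.add_apply, LinearMap.comp_apply, LinearMap.flip_apply]

end Hamiltonian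

/-! ## The Poisson bracket -/

namespace CyclicAInfinityAlgebra

variable {𝕜 A : Type*} [RCLike 𝕜] [AddCommGroup A] [Module 𝕜 A] {𝒜 : ℤ → Submodule 𝕜 A}
  (S : CyclicAInfinityAlgebra 𝕜 𝒜)

/-- The restriction of `ω` to `A^1`. -/
def ωOne : 𝒜 1 →ₗ[𝕜] 𝒜 1 →ₗ[𝕜] 𝕜 := S.ωL.domRestrict₁₂ (𝒜 1) (𝒜 1)

@[simp] lemma ωOne_apply (x y : 𝒜 1) : S.ωOne x y = S.ω x y := rfl

lemma isHamiltonianField_iff {ψ : 𝒜 1 → 𝕜} {ψ' : 𝒜 1 → 𝒜 1 →ₗ[𝕜] 𝕜} (hψ : HasPolyDeriv ψ ψ')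
    (X : 𝒜 1 → 𝒜 1) : S.IsHamiltonianField ψ X ↔
      IsHamiltonianAlong S.curv (ins S.isMultilinear_b 1) S.ωOne ψ' X := by
  simp only [IsHamiltonianField, IsHamiltonianAlong, dcurv_eq, dirDeriv_eq_of_hasPolyDeriv hψ,
    ωOne_apply]

lemma exists_isPolyJet_curv : ∃ F'', IsPolyJet S.curv (ins S.isMultilinear_b 1) F'' := by
  obtain ⟨F', F'', h⟩ := exists_isPolyJet S.curv_mem_polyMap
  rw [h.deriv.unique S.hasPolyDeriv_curv] at h
  exact ⟨F'', h⟩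

lemma ω_mem_mcIdeal {ψ χ : S.invFunctions} (hψ : ψ.1 ∈ S.mcIdeal) {X Z : 𝒜 1 → 𝒜 1}
    (hX : S.IsHamiltonianField ψ X) (hZ : S.IsHamiltonianField χ Z) :
    (fun a => S.ω (X a) (Z a)) ∈ S.mcIdeal := by
  obtain ⟨ψ', ψ'', jψ⟩ := exists_isPolyJet ψ.2.1
  obtain ⟨χ', χ'', jχ⟩ := exists_isPolyJet χ.2.1
  obtain ⟨Θ, pΘ, hΘ⟩ := hψ
  rw [S.isHamiltonianField_iff jψ.deriv] at hX
  rw [S.isHamiltonianField_iff jχ.deriv] at hZ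
  exact hX.bracket_ideal S.hasPolyDeriv_curv jψ.deriv pΘ hΘ hZ

lemma IsHamiltonianField.add_smul {ψ χ : S.invFunctions} {X Z : 𝒜 1 → 𝒜 1}
    (hX : S.IsHamiltonianField ψ X) (hZ : S.IsHamiltonianField χ Z) (c : 𝕜) :
    S.IsHamiltonianField (c • ψ + χ : S.invFunctions) (c • X + Z) := by
  obtain ⟨ψ', ψ'', jψ⟩ := exists_isPolyJet ψ.2.1
  obtain ⟨χ', χ'', jχ⟩ := exists_isPolyJet χ.2.1
  rw [S.isHamiltonianField_iff jψ.deriv] at hX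
  rw [S.isHamiltonianField_iff jχ.deriv] at hZ
  have hd : HasPolyDeriv (c • ψ + χ : S.invFunctions).1 (c • ψ' + χ') :=
    (jψ.deriv.linear_comp (c • LinearMap.id)).add jχ.deriv
  exact (S.isHamiltonianField_iff hd _).mpr (hX.add_smul hZ c)

lemma ModuliFunction.mk_eq_zero (ψ : S.invFunctions) :
    ModuliFunction.mk S ψ = 0 ↔ ψ.1 ∈ S.mcIdeal :=
  Submodule.Quotient.mk_eq_zero _

/-- The pairs of an invariant function and a Hamiltonian vector field for it. -/
def hamiltonianPairs : Submodule 𝕜 (S.invFunctions × (𝒜 1 → 𝒜 1)) where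
  carrier := {p | S.IsHamiltonianField p.1 p.2}
  zero_mem' := by
    -- Some field `X` of the zero function is given, and then `(-1) • X + X = 0` is one as well.
    obtain ⟨X, hX⟩ := (0 : S.invFunctions).2.2.2
    simpa using hX.add_smul S hX (-1)
  add_mem' {p q} hp hq := by simpa using IsHamiltonianField.add_smul S hp hq 1
  smul_mem' c p hp := by
    obtain ⟨X, hX⟩ := (0 : S.invFunctions).2.2.2
    have h0 : S.IsHamiltonianField (0 : S.invFunctions) (0 : 𝒜 1 → 𝒜 1) := by
      simpa using hX.add_smul S hX (-1)
    simpa using IsHamiltonianField.add_smul S hp h0 c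

/-- The type of pairs of an invariant function and a Hamiltonian vector field for it. -/
def HamiltonianPair : Type _ := S.hamiltonianPairs

instance : AddCommGroup S.HamiltonianPair := inferInstanceAs (AddCommGroup S.hamiltonianPairs)

instance : Module 𝕜 S.HamiltonianPair := inferInstanceAs (Module 𝕜 S.hamiltonianPairs)

/-- The relation between a function on the moduli space and the Hamiltonian vector fields of its
representatives. -/
def hamiltonianRelation : Submodule 𝕜 (S.ModuliFunction × S.HamiltonianPair) :=
  LinearMap.range (LinearMap.prod
    (Submodule.mkQ _ ∘ₗ LinearMap.fst 𝕜 S.invFunctions (𝒜 1 → 𝒜 1) ∘ₗ S.hamiltonianPairs.subtype)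
    LinearMap.id)

lemma mem_hamiltonianRelation (v : S.ModuliFunction) (p : S.HamiltonianPair) :
    (v, p) ∈ S.hamiltonianRelation ↔ ModuliFunction.mk S p.1.1 = v := by
  constructor
  · rintro ⟨q, hq⟩
    rw [Prod.ext_iff] at hq
    obtain ⟨h1, h2⟩ := hq
    have h2 : q = p := h2
    subst h2
    exact h1
  · rintro rfl
    exact ⟨p, rfl⟩

variable [DirectSum.Decomposition 𝒜]

lemma gauge_mem_polyMap (x : 𝒜 0) : S.gauge x ∈ PolyMap 𝕜 (𝒜 1) (𝒜 1) := by
  have e : S.gauge x = fun a => proj 𝒜 1 (ins S.isMultilinear_b 0 a x) := by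
    funext a
    rw [← gaugeVal_eq]
    exact (proj_coe (S.gauge x a)).symm
  rw [e]
  exact linear_comp_mem_polyMap _ (apply_mem_polyMap
    (ins_mem_polyMap S.isMultilinear_b S.isBounded_b 0) (const_mem_polyMap x))

/-- Gauge invariance is automatic. Modulo the ideal, `dψ(ξ_x) = ω(X, ξ_x) = ω(μ'_a(X), x)`, which
vanishes because `X` is tangent; the error term in `μ'_a(ξ_x)` lies in the ideal because gauge
fields are tangent. -/
lemma mem_invFunctions {ψ : 𝒜 1 → 𝕜} (hψ : ψ ∈ PolyMap 𝕜 (𝒜 1) 𝕜) {X : 𝒜 1 → 𝒜 1}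
    (hX : S.IsHamiltonianField ψ X) : ψ ∈ S.invFunctions := by
  refine ⟨hψ, fun x => ?_, X, hX⟩
  obtain ⟨pX, ⟨L, pL, hL⟩, M, pM, Λ, pΛ, hM⟩ := hX
  refine ⟨fun a => S.ωL.flip x ∘ₗ L a - (M a).flip (S.gauge x a) -
      Λ a ∘ₗ insA (S.isMultilinear_insertDegZero x) 2 a,
    sub_mem_polyMap (sub_mem_polyMap (comp_mem_polyMap (const_mem_polyMap _) pL)
      (apply_mem_polyMap (flip_mem_polyMap pM) (S.gauge_mem_polyMap x))) (comp_mem_polyMap pΛ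
      (insA_mem_polyMap _ (S.isBounded_insertDegZero x) 2)), fun a => ?_⟩
  have h1 := hM a (S.gauge x a)
  rw [ω_gauge, ← dcurv_eq, hL, dcurv_eq, dcurv_gauge] at h1
  simp only [LinearMap.sub_apply, LinearMap.comp_apply, LinearMap.flip_apply, ωL_apply]
  linear_combination -h1

lemma ω_mem_invFunctions {ψ χ : S.invFunctions} {X Z : 𝒜 1 → 𝒜 1}
    (hX : S.IsHamiltonianField ψ X) (hZ : S.IsHamiltonianField χ Z) :
    (fun a => S.ω (X a) (Z a)) ∈ S.invFunctions := by
  obtain ⟨ψ', ψ'', jψ⟩ := exists_isPolyJet ψ.2.1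
  obtain ⟨χ', χ'', jχ⟩ := exists_isPolyJet χ.2.1
  obtain ⟨F'', jF⟩ := S.exists_isPolyJet_curv
  rw [S.isHamiltonianField_iff jψ.deriv] at hX
  rw [S.isHamiltonianField_iff jχ.deriv] at hZ
  obtain ⟨h', U, hh, hU⟩ := hX.bracket jF S.ω_antisymm jψ.deriv' jψ.symm jχ.deriv' jχ.symm hZ
  exact S.mem_invFunctions (bilinear_mem_polyMap S.ωOne hX.1 hZ.1)
    ((S.isHamiltonianField_iff hh U).mpr hU)

/-- `ω(X, Z)`, as a function on the moduli space. -/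
def hamiltonianPairing :
    S.HamiltonianPair →ₗ[𝕜] S.HamiltonianPair →ₗ[𝕜] S.ModuliFunction :=
  LinearMap.mk₂ 𝕜 (fun p q => ModuliFunction.mk S ⟨_, S.ω_mem_invFunctions p.2 q.2⟩)
    (fun p p' q => congrArg (ModuliFunction.mk S) (Subtype.ext (funext fun a =>
      S.ωOne.map_add₂ (p.1.2 a) (p'.1.2 a) (q.1.2 a))))
    (fun c p q => congrArg (ModuliFunction.mk S) (Subtype.ext (funext fun a =>
      S.ωOne.map_smul₂ c (p.1.2 a) (q.1.2 a))))
    (fun p q q' => congrArg (ModuliFunction.mk S) (Subtype.ext (funext fun a =>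
      map_add (S.ωOne (p.1.2 a)) (q.1.2 a) (q'.1.2 a))))
    (fun c p q => congrArg (ModuliFunction.mk S) (Subtype.ext (funext fun a =>
      map_smul (S.ωOne (p.1.2 a)) c (q.1.2 a))))

lemma exists_mem_hamiltonianRelation (v : S.ModuliFunction) :
    ∃ p, (v, p) ∈ S.hamiltonianRelation := by
  obtain ⟨ψ, rfl⟩ := Submodule.Quotient.mk_surjective _ v
  obtain ⟨X, hX⟩ := ψ.2.2.2
  exact ⟨⟨(ψ, X), hX⟩, (S.mem_hamiltonianRelation _ _).mpr rfl⟩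

lemma hamiltonianPairing_eq_zero_left (p q : S.HamiltonianPair)
    (hp : (0, p) ∈ S.hamiltonianRelation) : S.hamiltonianPairing p q = 0 := by
  have h0 := (ModuliFunction.mk_eq_zero S p.1.1).mp ((S.mem_hamiltonianRelation _ _).mp hp)
  exact (ModuliFunction.mk_eq_zero S _).mpr (S.ω_mem_mcIdeal h0 p.2 q.2)

lemma hamiltonianPairing_eq_zero_right (p q : S.HamiltonianPair)
    (hq : (0, q) ∈ S.hamiltonianRelation) : S.hamiltonianPairing p q = 0 := by
  have h0 := (ModuliFunction.mk_eq_zero S q.1.1).mp ((S.mem_hamiltonianRelation _ _).mp hq)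
  refine (ModuliFunction.mk_eq_zero S _).mpr ?_
  have := S.mcIdeal.neg_mem (S.ω_mem_mcIdeal h0 q.2 p.2)
  convert this using 1
  funext a
  exact S.ω_antisymm _ _

lemma exists_poissonPairing :
    ∃ PB : S.ModuliFunction →ₗ[𝕜] S.ModuliFunction →ₗ[𝕜] S.ModuliFunction,
      ∀ v p v' p', (v, p) ∈ S.hamiltonianRelation → (v', p') ∈ S.hamiltonianRelation →
        PB v v' = S.hamiltonianPairing p p' :=
  exists_bilinear_of_relations S.hamiltonianRelation S.hamiltonianRelation
    S.exists_mem_hamiltonianRelation S.exists_mem_hamiltonianRelation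
    S.hamiltonianPairing S.hamiltonianPairing_eq_zero_left S.hamiltonianPairing_eq_zero_right

lemma exists_isPoissonBracket :
    ∃ PB : S.ModuliFunction →ₗ[𝕜] S.ModuliFunction →ₗ[𝕜] S.ModuliFunction,
      S.IsPoissonBracket PB :=
  S.exists_poissonPairing.imp fun _ h ψ χ X Z hX hZ => ⟨S.ω_mem_invFunctions hX hZ,
    h (ModuliFunction.mk S ψ) ⟨(ψ, X), hX⟩ (ModuliFunction.mk S χ) ⟨(χ, Z), hZ⟩
      ((S.mem_hamiltonianRelation _ ⟨(ψ, X), hX⟩).mpr rfl)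
      ((S.mem_hamiltonianRelation _ ⟨(χ, Z), hZ⟩).mpr rfl)⟩

end CyclicAInfinityAlgebra

end StringBracket

end

/-! ### From cochains to functions, one-forms and vector fields; the map `ρ`. -/

noncomputable section

namespace StringBracket

/-! ## Hochschild cochains as functions and vector fields -/

lemma sumSplit3_pow_congr {𝕜 A M : Type*} [RCLike 𝕜] [AddCommGroup A] [Module 𝕜 A]
    {𝒜 : ℤ → Submodule 𝕜 A} [AddCommGroup M]
    {F G : List (Homog 𝒜) → List (Homog 𝒜) → List (Homog 𝒜) → M} {a : 𝒜 1}
    (h : ∀ i j k, F (pow i a) (pow j a) (pow k a) = G (pow i a) (pow j a) (pow k a)) (n : ℕ) :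
    sumSplit3 F (pow n a) = sumSplit3 G (pow n a) := by
  simp only [sumSplit3, sumSplit_pow, h]

lemma isBounded_sumSplit3 {𝕜 A M P Q : Type*} [RCLike 𝕜] [AddCommGroup A] [Module 𝕜 A]
    {𝒜 : ℤ → Submodule 𝕜 A} [AddCommGroup M] [Module 𝕜 M] [AddCommGroup P] [Module 𝕜 P]
    [AddCommGroup Q] [Module 𝕜 Q] (B : P →ₗ[𝕜] Q →ₗ[𝕜] M)
    {G : List (Homog 𝒜) → List (Homog 𝒜) → P} {K : List (Homog 𝒜) → Q} (hG : IsBounded₂ G)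
    (hK : IsBounded K) : IsBounded (sumSplit3 fun X Y Z => B (G X Z) (K Y)) :=
  (hG.sumSplit3 B hK).sumSplit

namespace CyclicAInfinityAlgebra

variable {𝕜 A : Type*} [RCLike 𝕜] [AddCommGroup A] [Module 𝕜 A] {𝒜 : ℤ → Submodule 𝕜 A}
  {S : CyclicAInfinityAlgebra 𝕜 𝒜}

section HochDual

variable {q : ℤ} {φ : Homog 𝒜 → List (Homog 𝒜) → 𝕜}

lemma isBounded_hochDual (hφ : φ ∈ S.hochDual q) (x : Homog 𝒜) : IsBounded (φ x) := by
  obtain ⟨k, hk⟩ := hφ.2.2.2.2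
  exact ⟨k, hk x⟩

lemma isMultilinear_coeffLin (hφ : φ ∈ S.hochDual q) (d : ℤ) :
    IsMultilinear (𝕜 := 𝕜) (coeffLin hφ d) :=
  fun l r i c x y => LinearMap.ext fun z => hφ.2.1 (Homog.of z) l r i c x y

lemma isBounded_coeffLin (hφ : φ ∈ S.hochDual q) (d : ℤ) : IsBounded (coeffLin hφ d) := by
  obtain ⟨k, hk⟩ := hφ.2.2.2.2
  exact ⟨k, fun w hw => LinearMap.ext fun z => hk _ w hw⟩

/-- For `y` of degree one the right side is the derivative of `a ↦ ∑ φ(1; a, …, a)` along `y`: the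
Connes operator acts as the de Rham differential. -/
lemma connesDual_tot (hφ : φ ∈ S.hochDual q) {d : ℤ} (a : 𝒜 1) (y : 𝒜 d) :
    tot (S.connesDual φ (Homog.of y)) a = ins (hφ.2.1 S.unit) d a y := by
  rw [ins_apply _ (isBounded_hochDual hφ _),
    ← tot_sumSplit_swap ((isBounded_hochDual hφ S.unit).insert (Homog.of y))]
  refine tot_congr fun n => ?_
  simp only [connesDual_apply, sumSplit_pow]
  simp

variable [DirectSum.Decomposition 𝒜]

/-- `x ↦ ∑ φ(x; a, …, a)`, on the degree `d` component of `x`. -/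
def coeffTot (hφ : φ ∈ S.hochDual q) (d : ℤ) : 𝒜 1 → A →ₗ[𝕜] 𝕜 :=
  tot fun w => coeffLin hφ d w ∘ₗ proj 𝒜 d

lemma isBounded_coeffLin_proj (hφ : φ ∈ S.hochDual q) (d : ℤ) :
    IsBounded fun w => coeffLin hφ d w ∘ₗ proj 𝒜 d := by
  obtain ⟨k, hk⟩ := isBounded_coeffLin hφ d
  exact ⟨k, fun w hw => by simp [hk w hw]⟩

lemma coeffTot_mem_polyMap (hφ : φ ∈ S.hochDual q) (d : ℤ) :
    coeffTot hφ d ∈ PolyMap 𝕜 (𝒜 1) (A →ₗ[𝕜] 𝕜) := by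
  refine tot_mem_polyMap (fun l r i c x y => ?_) (isBounded_coeffLin_proj hφ d)
  simp only [isMultilinear_coeffLin hφ d l r i c x y, LinearMap.add_comp, LinearMap.smul_comp]

lemma insA_coeffLin (hφ : φ ∈ S.hochDual q) {d : ℤ} (e : ℤ) (a : 𝒜 1) (x : A) (y : 𝒜 d) :
    insA (isMultilinear_coeffLin hφ d) e a x y = insA (hφ.2.1 (Homog.of y)) e a x := by
  simp only [insA, LinearMap.comp_apply]
  rw [ins_apply _ (isBounded_coeffLin hφ d), ins_apply _ (isBounded_hochDual hφ _)]
  refine (map_tot (LinearMap.applyₗ (R := 𝕜) (M₂ := 𝕜) y)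
    ((isBounded_coeffLin hφ d).insert _).sumSplit a).trans (tot_congr fun n => ?_)
  rw [map_sumSplit]
  rfl

/-- Either the arguments of `b` are all `a`, which yields the curvature, or `y` is one of them,
which yields `μ'_a(y)` when `y` has degree one. These are the two kinds of error terms that a
Hamiltonian field may have. -/
lemma deltaDual_tot (hφ : φ ∈ S.hochDual q) {d : ℤ} (a : 𝒜 1) (y : 𝒜 d) :
    tot (S.deltaDual φ (Homog.of y)) a =
      (d - 1).negOnePow • insA (hφ.2.1 (Homog.of y)) 2 a (S.curv a) +
        coeffTot hφ (d + 1) a (ins S.isMultilinear_b d a y) := by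
  have hy := hφ.2.1 (Homog.of y)
  have hb := isBounded_hochDual hφ (Homog.of y)
  have hins := S.isBounded_b.insert (Homog.of y)
  have hins' : IsBounded₂ fun X Z => (S.b (Z ++ Homog.of y :: X)).val := by
    obtain ⟨k, hk⟩ := hins
    exact ⟨k, fun X Z hw => hk _ _ (by omega)⟩
  have hB1 := isBounded_sumSplit3 LinearMap.id (isBounded_slot hy hb 2) S.isBounded_b
  have hB2 := isBounded_sumSplit3 (LinearMap.applyₗ (R := 𝕜) (M₂ := 𝕜)) hins'
    (isBounded_coeffLin_proj hφ (d + 1))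
  have hB3 : IsBounded fun w => (d - 1).negOnePow • sumSplit3 (fun X Y Z =>
      LinearMap.id (R := 𝕜) (slot hy 2 X Z) (S.b Y).val) w := by
    obtain ⟨k, hk⟩ := hB1
    exact ⟨k, fun w hw => (congrArg _ (hk w hw)).trans (smul_zero _)⟩
  refine (tot_congr (G := fun w => (d - 1).negOnePow • sumSplit3 (fun X Y Z =>
      LinearMap.id (R := 𝕜) (slot hy 2 X Z) (S.b Y).val) w +
    sumSplit3 (fun X Y Z => LinearMap.applyₗ (R := 𝕜) (S.b (Z ++ Homog.of y :: X)).val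
      (coeffLin hφ (d + 1) Y ∘ₗ proj 𝒜 (d + 1))) w) fun n => ?_).trans ?_
  · rw [deltaDual_apply, smul_sumSplit3]
    congr 1
    · refine sumSplit3_pow_congr (fun i j k => ?_) n
      rw [LinearMap.id_apply, slot_val hy _ _ _ (by simp)]
      simp [Homog.sdeg]
    · refine sumSplit3_pow_congr (fun i j k => ?_) n
      have hm : (S.b (pow k a ++ Homog.of y :: pow i a)).val ∈ 𝒜 (d + 1) := by
        have h := (S.b (pow k a ++ Homog.of y :: pow i a)).mem
        have e : (S.b (pow k a ++ Homog.of y :: pow i a)).deg = d + 1 := by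
          simp
          ring
        rwa [e] at h
      have e : S.b (pow k a ++ Homog.of y :: pow i a) = Homog.of (⟨_, hm⟩ : 𝒜 (d + 1)) :=
        Homog.eq_of _ _ (by simp; ring) rfl
      have e2 : proj 𝒜 (d + 1) (S.b (pow k a ++ Homog.of y :: pow i a)).val = ⟨_, hm⟩ :=
        proj_coe (⟨_, hm⟩ : 𝒜 (d + 1))
      simp only [sdegSum_pow, zero_mul, Int.negOnePow_zero, one_smul, LinearMap.applyₗ_apply_apply,
        LinearMap.comp_apply, e2]
      exact congrArg (fun z => φ z (pow j a)) e
  · rw [tot_add hB3 hB2, tot_sumSplit3 _ hins' (isBounded_coeffLin_proj hφ (d + 1)),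
      tot_sumSplit_swap hins, ← ins_apply S.isMultilinear_b S.isBounded_b]
    congr 1
    rw [curv_eq, ← tot_sumSplit3_slot hy hb 2 S.isBounded_b]
    exact (map_tot (DistribSMul.toAddMonoidHom 𝕜 (d - 1).negOnePow) hB1 a).symm

end HochDual

/-! ### Coboundaries -/

/-- Strict unitality leaves only `b(1, a) = -a` and `b(a, 1) = a`. In other words, the unit acts
trivially as an infinitesimal gauge transformation. -/
lemma ins_b_unit (a : 𝒜 1) : ins S.isMultilinear_b 0 a ⟨S.one, S.one_mem⟩ = 0 := by
  rw [ins_apply _ S.isBounded_b]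
  refine tot_zero fun n => ?_
  by_cases hn : n = 1
  · subst hn
    have h1 := S.b_unit_left (Homog.of a)
    have h2 := S.b_unit_right (Homog.of a)
    simp only [pow_succ', sumSplit_cons]
    simp only [pow, List.replicate_zero, sumSplit_nil, List.nil_append, List.cons_append]
    refine (congrArg₂ (· + ·) h1 h2).trans ?_
    simp
  · refine sumSplit_zero fun X Z hw => S.evalWord_unit X Z rfl ?_
    have := congrArg List.length hw
    simp at this ⊢
    omega

lemma isBounded_hochA {p : ℤ} {f : List (Homog 𝒜) → A} (hf : f ∈ S.hochA p) : IsBounded f :=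
  hf.2.2.2

/-- The chains `1 ⊗ a^{⊗ n}` have total degree zero. -/
lemma pairingR_eq_zero {q : ℤ} {α : ℕ → Homog 𝒜 → List (Homog 𝒜) → 𝕜} (hα : α 0 ∈ S.hochDual q)
    (hq : q ≠ 0) : S.pairingR α = 0 := by
  funext a
  refine tot_zero fun n => hα.2.2.2.1 _ _ ?_
  simpa using hq.symm

/-- Rotation moves the unit inside `b`, where strict unitality allows only operations with two
arguments. -/
lemma ω_b_one (X Z : List (Homog 𝒜)) (y : Homog 𝒜) (h : X.length + Z.length ≠ 1) :
    S.ω (S.b (X ++ y :: Z)).val S.one = 0 := by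
  have h1 := S.ω_b_rotate X Z y S.unit
  rw [S.evalWord_unit Z X rfl (by simp; omega)] at h1
  refine h1.trans ?_
  have := map_zero (S.ωL.flip y.val)
  simp only [LinearMap.flip_apply, ωL_apply] at this
  rw [this, smul_zero]

lemma tot_eq_zero_of_neg (hpos : ∀ i : ℤ, i < 0 → 𝒜 i = ⊥) {p : ℤ} (hp : p < 0)
    {f : List (Homog 𝒜) → A} (hf : f ∈ S.hochA p) (a : 𝒜 1) : tot f a = 0 :=
  tot_zero fun n => by
    have := hf.2.2.1 (pow n a)
    rw [sdegSum_pow, zero_add, hpos p hp] at this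
    exact (Submodule.mem_bot 𝕜).mp this

variable (S) in
lemma pairingR_add_smul {k : ℤ} {α β : ℕ → Homog 𝒜 → List (Homog 𝒜) → 𝕜} (hα : α ∈ S.negCyclic k)
    (hβ : β ∈ S.negCyclic k) (c : 𝕜) :
    S.pairingR (c • α + β) = c • S.pairingR α + S.pairingR β := by
  funext a
  have h1 := isBounded_hochDual (hα.1 0) S.unit
  have h2 := isBounded_hochDual (hβ.1 0) S.unit
  have h3 : IsBounded fun w => c • α 0 S.unit w := by
    obtain ⟨k, hk⟩ := h1
    exact ⟨k, fun w hw => (congrArg (c • ·) (hk w hw)).trans (smul_zero _)⟩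
  refine (tot_add h3 h2 a).trans ?_
  exact congrArg (· + _) (map_tot (c • LinearMap.id (R := 𝕜) (M := 𝕜)) h1 a).symm

lemma mk_eq_mk_of_eq {ψ χ : 𝒜 1 → 𝕜} (hψ : ψ ∈ S.invFunctions) (hχ : χ ∈ S.invFunctions)
    (h : ψ = χ) : ModuliFunction.mk S ⟨ψ, hψ⟩ = ModuliFunction.mk S ⟨χ, hχ⟩ := by
  subst h
  rfl

lemma mk_eq_zero_of_eq {ψ : 𝒜 1 → 𝕜} (hψ : ψ ∈ S.invFunctions) (h : ψ = 0) :
    ModuliFunction.mk S ⟨ψ, hψ⟩ = 0 := by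
  subst h
  exact (ModuliFunction.mk_eq_zero S _).mpr (Submodule.zero_mem _)

lemma HCeven.induction {P : S.HCeven → Prop} (h0 : P 0) (hadd : ∀ x y, P x → P y → P (x + y))
    (hmk : ∀ m α, P (HCeven.mk S m α)) (x : S.HCeven) : P x := by
  induction x using DirectSum.induction_on with
  | zero => exact h0
  | of m x =>
    obtain ⟨α, rfl⟩ := Submodule.Quotient.mk_surjective _ x
    exact hmk m α
  | add x y hx hy => exact hadd x y hx hy

variable [DirectSum.Decomposition 𝒜]

/-- On chains with coefficient `1` the term `B^* β₁` vanishes by normalization. In `δ^* β₀` the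
terms with the unit inside `b` add up to zero by `ins_b_unit`, and the others have the curvature
inserted. -/
lemma pairingR_dNeg_mem {k : ℤ} {β : ℕ → Homog 𝒜 → List (Homog 𝒜) → 𝕜} (hβ : β ∈ S.negCyclic k) :
    S.pairingR (S.dNeg β) ∈ S.mcIdeal := by
  have h0 := hβ.1 0
  have h1 := hβ.1 1
  refine ⟨fun a => - insA (h0.2.1 S.unit) 2 a,
    neg_mem_polyMap (insA_mem_polyMap _ (isBounded_hochDual h0 _) 2), fun a => ?_⟩
  have e : S.pairingR (S.dNeg β) a = tot (S.deltaDual (β 0) S.unit) a := by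
    change tot (fun w => S.deltaDual (β 0) S.unit w + S.connesDual (β 1) S.unit w) a = _
    refine tot_congr fun n => ?_
    have hc : S.connesDual (β 1) S.unit (pow n a) = 0 := by
      rw [connesDual_apply]
      exact sumSplit_zero fun X Z _ => by rw [h1.2.2.1, smul_zero]
    rw [hc, add_zero]
  rw [e]
  refine (deltaDual_tot h0 a ⟨S.one, S.one_mem⟩).trans ?_
  rw [ins_b_unit, map_zero, add_zero]
  simp
  rfl

/-! ### Cocycles -/

/-- The vector field of a Hochschild cochain. -/
def cochainField (f : List (Homog 𝒜) → A) (a : 𝒜 1) : 𝒜 1 := proj 𝒜 1 (tot f a)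

lemma coe_cochainField {f : List (Homog 𝒜) → A} (hf : f ∈ S.hochA 1) (a : 𝒜 1) :
    (cochainField f a : A) = tot f a :=
  coe_proj (tot_mem _ fun n => by simpa using hf.2.2.1 (pow n a))

/-- Summed over the powers of `a`, the cocycle equation equates the terms `b(…, f, …)`, which form
`μ'_a(X_f)`, with the terms `f(…, b, …)`, which insert the curvature into `f`. -/
lemma dcurv_cochainField {f : List (Homog 𝒜) → A} (hf : f ∈ S.hochA 1)
    (hδ : S.deltaA 1 f = 0) (a : 𝒜 1) :
    S.dcurv a (cochainField f a) = insA hf.1 2 a (S.curv a) := by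
  rw [dcurv_eq, ← tot_coder S hf.1 (isBounded_hochA hf)]
  refine (tot_sumSplit3_slot S.isMultilinear_b S.isBounded_b 1 (isBounded_hochA hf) a).symm.trans
    (tot_congr fun n => ?_)
  have h := congrFun hδ (pow n a)
  rw [deltaA, Pi.zero_apply, sub_eq_zero, sub_self, Int.negOnePow_zero, one_smul] at h
  rw [coder, ← h]
  refine sumSplit3_pow_congr (fun i j k => ?_) n
  simp [slot_apply]

/-- Evaluated on `(Y; a, …, a)` and summed, `h` becomes the Hamiltonian equation: `B^* α₀` gives the
differential, `ω_♯ f` gives `ω(X_f, Y)`, and `δ^* γ` gives the permitted errors in `F(a)` and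
`μ'_a(Y)`. -/
lemma isHamiltonianField_pairingR {q r : ℤ} {α : ℕ → Homog 𝒜 → List (Homog 𝒜) → 𝕜}
    {γ : Homog 𝒜 → List (Homog 𝒜) → 𝕜} {f : List (Homog 𝒜) → A} (hα : α 0 ∈ S.hochDual q)
    (hγ : γ ∈ S.hochDual r) (hf : f ∈ S.hochA 1) (hδ : S.deltaA 1 f = 0)
    (h : S.connesDual (α 0) = S.sharp f + S.deltaDual γ) :
    S.IsHamiltonianField (S.pairingR α) (cochainField f) := by
  have hd : HasPolyDeriv (S.pairingR α) (ins (hα.2.1 S.unit) 1) :=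
    hasPolyDeriv_tot (hα.2.1 S.unit) (isBounded_hochDual hα S.unit)
  refine ⟨linear_comp_mem_polyMap _ (tot_mem_polyMap hf.1 (isBounded_hochA hf)),
    ⟨_, insA_mem_polyMap hf.1 (isBounded_hochA hf) 2, dcurv_cochainField hf hδ⟩,
    fun a => - insA (isMultilinear_coeffLin hγ 1) 2 a,
    neg_mem_polyMap (insA_mem_polyMap _ (isBounded_coeffLin hγ 1) 2),
    fun a => - coeffTot hγ 2 a, neg_mem_polyMap (coeffTot_mem_polyMap hγ 2), fun a Y => ?_⟩
  have hs := S.sharp_mem hf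
  have hc := S.connesDual_mem hα
  have e1 : tot (S.sharp f (Homog.of Y)) a = S.ω (tot f a) Y := by
    refine Eq.trans (tot_congr fun n => ?_) (map_tot (S.ωL.flip Y) (isBounded_hochA hf) a).symm
    simp [sharp]
  have e2 := tot_sub (isBounded_hochDual hc (Homog.of Y)) (isBounded_hochDual hs (Homog.of Y)) a
  have e3 : (fun w => S.connesDual (α 0) (Homog.of Y) w - S.sharp f (Homog.of Y) w) =
      S.deltaDual γ (Homog.of Y) := by
    funext w
    rw [h]
    simp
  rw [e3, deltaDual_tot hγ, connesDual_tot hα, e1] at e2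
  rw [coe_cochainField hf, dirDeriv_eq_of_hasPolyDeriv hd, dcurv_eq, LinearMap.neg_apply,
    LinearMap.neg_apply, LinearMap.neg_apply, insA_coeffLin]
  simp only [sub_self, Int.negOnePow_zero, one_smul, Int.reduceAdd] at e2
  linear_combination e2

lemma pairingR_mem_invFunctions (hHH : S.SharpIsIso) {m : ℤ} (α : S.negCocycle (2 * m)) :
    S.pairingR α ∈ S.invFunctions := by
  have hα := α.2.1.1 0
  by_cases hm : m = 0
  · subst hm
    obtain ⟨f, hf, hδ, γ, hγ, h⟩ := S.exists_represents hHH α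
    exact S.mem_invFunctions (tot_mem_polyMap (hα.2.1 S.unit) (isBounded_hochDual hα S.unit))
      (isHamiltonianField_pairingR hα hγ (by simpa using hf) (by simpa using hδ) h)
  · rw [pairingR_eq_zero hα (by simpa using hm)]
    exact Submodule.zero_mem _

/-! ### The cup product -/

/-- By `ω_b_one` the outer pieces must be empty, so only `b` of the two values survives, and
`ω(μ₂(x, y), 1) = ω(x, y)`. -/
lemma ω_cup_one {p q : ℤ} {f g : List (Homog 𝒜) → A} (hf : f ∈ S.hochA p) (hg : g ∈ S.hochA q)
    (w : List (Homog 𝒜)) : S.ω (S.cup p q f g w) S.one =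
      sumSplit (fun X Y => (q * sdegSum X).negOnePow • S.ω (f X) (g Y)) w := by
  have h0 := map_sumSplit5 (S.ωL.flip S.one) (fun X₁ X₂ X₃ X₄ X₅ =>
    (p - 1 + (p - 1) * sdegSum X₁ +
      (q - 1) * (sdegSum X₁ + sdegSum X₂ + sdegSum X₃)).negOnePow •
    (S.b (X₁ ++ Homog.comp (sdegSum X₂ + p) (f X₂) :: (X₃ ++
      Homog.comp (sdegSum X₄ + q) (g X₄) :: X₅))).val) w
  refine h0.trans ?_
  have hz : ∀ X₁ X₂ X₃ X₄ X₅ : List (Homog 𝒜), X₁ ≠ [] ∨ X₃ ≠ [] ∨ X₅ ≠ [] →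
      S.ωL.flip S.one ((p - 1 + (p - 1) * sdegSum X₁ +
        (q - 1) * (sdegSum X₁ + sdegSum X₂ + sdegSum X₃)).negOnePow •
      (S.b (X₁ ++ Homog.comp (sdegSum X₂ + p) (f X₂) :: (X₃ ++
        Homog.comp (sdegSum X₄ + q) (g X₄) :: X₅))).val) = 0 := by
    intro X₁ X₂ X₃ X₄ X₅ h
    rw [map_units_smul, LinearMap.flip_apply, ωL_apply, ω_b_one, smul_zero]
    simp only [List.length_append, List.length_cons]
    simp only [ne_eq, ← List.length_eq_zero_iff] at h
    omega
  simp only [sumSplit5, sumSplit3]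
  rw [sumSplit_eq_left_nil fun X₁ R hX => sumSplit_zero fun X₂ R _ => sumSplit_zero fun X₃ R _ =>
    sumSplit_zero fun X₄ X₅ _ => hz _ _ _ _ _ (Or.inl hX)]
  refine sumSplit_congr fun X₂ R _ => ?_
  rw [sumSplit_eq_left_nil fun X₃ R hX => sumSplit_zero fun X₄ X₅ _ =>
    hz _ _ _ _ _ (Or.inr (Or.inl hX)),
    sumSplit_eq_right_nil fun X₄ X₅ hX => hz _ _ _ _ _ (Or.inr (Or.inr hX)),
    map_units_smul, LinearMap.flip_apply, ωL_apply, val_b, ω_units_left, smul_smul,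
    ← Int.negOnePow_add]
  simp only [List.nil_append, List.map_cons, List.map_nil, evalWord_two,
    Homog.val_comp (hf.2.2.1 X₂), Homog.val_comp (hg.2.2.1 R)]
  congr 1
  · apply negOnePow_congr
    simp [suspExponent]
    ring_nf
    grind
  · rw [ω, S.mu_two_one, ω]

lemma pairingR_cup {p q : ℤ} {f g : List (Homog 𝒜) → A} (hf : f ∈ S.hochA p) (hg : g ∈ S.hochA q)
    (a : 𝒜 1) : S.pairingR (incl (S.sharp (S.cup p q f g))) a = S.ω (tot f a) (tot g a) := by
  have h1 := tot_sumSplit_bilinear S.ωL (isBounded_hochA hf) (isBounded_hochA hg) a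
  have h3 : S.pairingR (incl (S.sharp (S.cup p q f g))) a =
      tot (S.sharp (S.cup p q f g) S.unit) a := by
    change tot (incl (S.sharp (S.cup p q f g)) 0 S.unit) a = _
    rw [incl, Pi.single_eq_same]
  refine (h3.trans (tot_congr fun n => ?_)).trans h1
  have h2 : S.sharp (S.cup p q f g) S.unit (pow n a) = S.ω (S.cup p q f g (pow n a)) S.one := by
    simp [sharp, unit]
  refine h2.trans ?_
  rw [ω_cup_one hf hg, sumSplit_pow, sumSplit_pow]
  simp

/-- For `m + n ≠ 0` the degree of the cochain is non-zero. Otherwise one of `1 - 2m` and `1 - 2n` is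
negative, and that cochain has no values on powers of `a` because `A` is non-negatively graded. -/
lemma pairingR_cup_eq_zero (hpos : ∀ i : ℤ, i < 0 → 𝒜 i = ⊥) {m n : ℤ} (hmn : ¬ (m = 0 ∧ n = 0))
    {f g : List (Homog 𝒜) → A} (hf : f ∈ S.hochA (1 - 2 * m)) (hg : g ∈ S.hochA (1 - 2 * n))
    (h : incl (S.sharp (S.cup (1 - 2 * m) (1 - 2 * n) f g)) ∈ S.negCocycle (2 * (m + n))) :
    S.pairingR (incl (S.sharp (S.cup (1 - 2 * m) (1 - 2 * n) f g))) = 0 := by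
  by_cases h0 : m + n = 0
  · funext a
    rw [pairingR_cup hf hg]
    rcases lt_or_gt_of_ne (show m ≠ 0 by omega) with hm | hm
    · rw [tot_eq_zero_of_neg hpos (by omega) hg]
      exact map_zero (S.ωL _)
    · rw [tot_eq_zero_of_neg hpos (by omega) hf]
      exact map_zero (S.ωL.flip _)
  · exact pairingR_eq_zero (h.1.1 0) (by simpa using h0)

/-! ### The map from negative cyclic cohomology to functions on the moduli space -/

/-- `α ↦ ⟨α, R(a)⟩` on cocycles. -/
def pairingMap (hHH : S.SharpIsIso) (m : ℤ) : S.negCocycle (2 * m) →ₗ[𝕜] S.invFunctions where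
  toFun α := ⟨S.pairingR α, pairingR_mem_invFunctions hHH α⟩
  map_add' α β := Subtype.ext (by simpa using S.pairingR_add_smul α.2.1 β.2.1 1)
  map_smul' c α := Subtype.ext (by
    have h0 := S.pairingR_add_smul α.2.1 α.2.1 (-1)
    have h := S.pairingR_add_smul α.2.1 (Submodule.zero_mem (S.negCyclic (2 * m))) c
    simp at h0
    simpa [h0] using h)

/-- The map `ρ` on the part of degree `2m`. -/
def rhoPart (hHH : S.SharpIsIso) (m : ℤ) : S.HC (2 * m) →ₗ[𝕜] S.ModuliFunction :=
  Submodule.mapQ _ _ (pairingMap hHH m) (by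
    rintro α ⟨β, hβ, e⟩
    have := pairingR_dNeg_mem hβ
    rw [e] at this
    exact this)

/-- The map `ρ`. -/
def rho (hHH : S.SharpIsIso) : S.HCeven →ₗ[𝕜] S.ModuliFunction :=
  DirectSum.toModule 𝕜 ℤ _ (rhoPart hHH)

lemma rho_mk (hHH : S.SharpIsIso) (m : ℤ) (α : S.negCocycle (2 * m)) :
    rho hHH (HCeven.mk S m α) =
      ModuliFunction.mk S ⟨S.pairingR α, pairingR_mem_invFunctions hHH α⟩ :=
  DirectSum.toModule_lof (M := fun m => S.HC (2 * m)) (φ := rhoPart hHH) 𝕜 m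
    (Submodule.Quotient.mk α)

lemma isRho_rho (hHH : S.SharpIsIso) : S.IsRho (rho hHH) := fun m α =>
  ⟨⟨_, rho_mk hHH m α⟩, fun a => by rw [rho_mk]; rfl⟩

lemma rho_bracket_mk (hpos : ∀ i : ℤ, i < 0 → 𝒜 i = ⊥) (hHH : S.SharpIsIso)
    {br : S.HCeven →ₗ[𝕜] S.HCeven →ₗ[𝕜] S.HCeven}
    {PB : S.ModuliFunction →ₗ[𝕜] S.ModuliFunction →ₗ[𝕜] S.ModuliFunction}
    (hbr : S.IsCyclicBracket br) (hPB : S.IsPoissonBracket PB) (m n : ℤ)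
    (α : S.negCocycle (2 * m)) (β : S.negCocycle (2 * n)) :
    rho hHH (br (HCeven.mk S m α) (HCeven.mk S n β)) =
      PB (rho hHH (HCeven.mk S m α)) (rho hHH (HCeven.mk S n β)) := by
  obtain ⟨f, hf⟩ := (hbr m n α β).1
  obtain ⟨g, hg⟩ := (hbr n n β β).1
  obtain ⟨h, e⟩ := (hbr m n α β).2 f g hf hg
  rw [e, rho_mk, rho_mk, rho_mk]
  by_cases hmn : m = 0 ∧ n = 0
  · obtain ⟨rfl, rfl⟩ := hmn
    obtain ⟨hf, hδf, γ, hγ, ef⟩ := hf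
    obtain ⟨hg, hδg, κ, hκ, eg⟩ := hg
    have hf1 : f ∈ S.hochA 1 := by simpa using hf
    have hg1 : g ∈ S.hochA 1 := by simpa using hg
    have hX := isHamiltonianField_pairingR (α.2.1.1 0) hγ hf1 (by simpa using hδf) ef
    have hZ := isHamiltonianField_pairingR (β.2.1.1 0) hκ hg1 (by simpa using hδg) eg
    obtain ⟨hm, e'⟩ := hPB ⟨_, pairingR_mem_invFunctions hHH α⟩ ⟨_, pairingR_mem_invFunctions hHH β⟩
      _ _ hX hZ
    rw [e']
    refine mk_eq_mk_of_eq _ _ (funext fun a => ?_)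
    rw [coe_cochainField hf1, coe_cochainField hg1]
    exact pairingR_cup hf hg a
  · have h1 := mk_eq_zero_of_eq (pairingR_mem_invFunctions hHH ⟨_, h⟩)
      (pairingR_cup_eq_zero hpos hmn hf.1 hg.1 h)
    have hz : ∀ {k : ℤ} (η : S.negCocycle (2 * k)), k ≠ 0 →
        ModuliFunction.mk S ⟨_, pairingR_mem_invFunctions hHH η⟩ = 0 := fun η hk =>
      mk_eq_zero_of_eq _ (pairingR_eq_zero (η.2.1.1 0) (by simpa using hk))
    rw [h1]
    by_cases hm : m = 0
    · rw [hz β fun hn => hmn ⟨hm, hn⟩, map_zero]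
    · rw [hz α hm, map_zero, LinearMap.zero_apply]

end CyclicAInfinityAlgebra

end StringBracket

end

theorem mainTheorem3 {𝕜 A : Type*} [RCLike 𝕜] [AddCommGroup A] [Module 𝕜 A]
    (𝒜 : ℤ → Submodule 𝕜 A) [DirectSum.Decomposition 𝒜]
    (hpos : ∀ i : ℤ, i < 0 → 𝒜 i = ⊥)
    (S : StringBracket.CyclicAInfinityAlgebra 𝕜 𝒜)
    (hω : S.TraceIsQuasiIso)
    (hHH : S.SharpIsIso) :
    ∃ (br : S.HCeven →ₗ[𝕜] S.HCeven →ₗ[𝕜] S.HCeven)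
      (PB : S.ModuliFunction →ₗ[𝕜] S.ModuliFunction →ₗ[𝕜] S.ModuliFunction)
      (ρ : S.HCeven →ₗ[𝕜] S.ModuliFunction),
      S.IsCyclicBracket br ∧ S.IsPoissonBracket PB ∧ S.IsRho ρ ∧
        ∀ x y : S.HCeven, ρ (br x y) = PB (ρ x) (ρ y) := by
  obtain ⟨br, hbr⟩ := S.exists_isCyclicBracket hHH
  obtain ⟨PB, hPB⟩ := S.exists_isPoissonBracket
  refine ⟨br, PB, StringBracket.CyclicAInfinityAlgebra.rho hHH, hbr, hPB,
    StringBracket.CyclicAInfinityAlgebra.isRho_rho hHH, fun x y => ?_⟩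
  induction x using StringBracket.CyclicAInfinityAlgebra.HCeven.induction with
  | h0 => simp only [map_zero, LinearMap.zero_apply]
  | hadd x x' hx hx' => simp only [map_add, LinearMap.add_apply, hx, hx']
  | hmk m α =>
    induction y using StringBracket.CyclicAInfinityAlgebra.HCeven.induction with
    | h0 => simp only [map_zero]
    | hadd y y' hy hy' => simp only [map_add, hy, hy']
    | hmk n β =>
      exact StringBracket.CyclicAInfinityAlgebra.rho_bracket_mk hpos hHH hbr hPB m n α β
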